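/- **Theorem (Zero velocity Lieb–Robinson bounds).** *Model.* Let $\Delta>1$, $\lambda>0$, $\beta\ge\frac12(1-\frac1\Delta)$. Let $\omega=(\omega_i)_{i\in\mathbb Z}$ be identically distributed real random variables whose joint law is ergodic with respect to shifts of $\mathbb Z$ and whose single-site law $\mu$ satisfies $\{0,1\}\subset\operatorname{supp}\mu\subset[0,1]$ and $\mu(\{0\})=0$. For $L\in\mathbb N$ let $$H=H^{(L)}_\omega=\sum_{i=-L}^{L-1}\Big[\tfrac14(1-\sigma^z_i\sigma^z_{i+1})-\tfrac1{4\Delta}(\sigma^x_i\sigma^x_{i+1}+\sigma^y_i\sigma^y_{i+1})\Big]+\lambda\sum_{i=-L}^{L}\omega_i\mathcal N_i+\beta(\mathcal N_{-L}+\mathcal N_L)$$ on $\bigotimes_{i\in[-L,L]}\mathbb C^2$, where $[-L,L]$ denotes the set of integers $-L\le i\le L$ and $\mathcal N_i=\frac12(1-\sigma^z_i)$ (the disordered XXZ chain; it is called *random* if in addition the $\omega_i$ are independent). Let $\|\cdot\|$ be the operator norm and $\|\cdot\|_1$ the trace norm. *Property DL.* Put $\Theta_0=1-\frac1\Delta$.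 Assume that there are $\Theta_1>\Theta_0$, $C_0<\infty$ and $m>0$ such that, with $I=[\Theta_0,\Theta_1]$, for all $L$ and all $i,j\in[-L,L]$, $$\mathbb E\Big(\sup_{g}\|\mathcal N_i\,g(H^{(L)})\,\mathcal N_j\|_1\Big)\le C_0e^{-m|i-j|},$$ the supremum being over Borel functions $g:\mathbb R\to\mathbb C$ with $|g|\le\chi_I$. *Notation.* Let $I_0=[0,\Theta_1]$, $P_B=\chi_B(H^{(L)})$, $P_0=P_{\{0\}}$, $A_B=P_BAP_B$ and $\tau_t(A)=e^{itH^{(L)}}Ae^{-itH^{(L)}}$. A local observable $X$ is a (nonrandom) operator on $\bigotimes_{i\in\mathcal S_X}\mathbb C^2$, where its support $\mathcal S_X\subset[-L,L]$ is a specified nonempty interval of integers, extended by the identity to the other sites; $\operatorname{dist}(X,Y)=\operatorname{dist}(\mathcal S_X,\mathcal S_Y)$. *Conclusion.* There is a constant $C<\infty$ such that for all $L\in\mathbb N$ and all local observables $X,Y,Z$ on $[-L,L]$ the following hold. If $\operatorname{dist}(X,Y)>0$, then $$\mathbb E\Big(\sup_{t\in\mathbb R}\big\|[\tau_t(X_I),Y_I]\big\|_1\Big)\le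 C\|X\|\|Y\|e^{-\frac18m\operatorname{dist}(X,Y)},$$ $$\mathbb E\Big(\sup_{t\in\mathbb R}\big\|[\tau_t(X_{I_0}),Y_{I_0}]-\big(\tau_t(X)P_0Y-YP_0\tau_t(X)\big)_I\big\|_1\Big)\le C\|X\|\|Y\|e^{-\frac18m\operatorname{dist}(X,Y)};$$ and if $\operatorname{dist}(X,Y)$, $\operatorname{dist}(X,Z)$, $\operatorname{dist}(Y,Z)$ are all positive, then $$\mathbb E\Big(\sup_{t,s\in\mathbb R}\big\|[[\tau_t(X_{I_0}),\tau_s(Y_{I_0})],Z_{I_0}]\big\|_1\Big)\le C\|X\|\|Y\|\|Z\|e^{-\frac18m\min\{\operatorname{dist}(X,Y),\operatorname{dist}(X,Z),\operatorname{dist}(Y,Z)\}}.$$ Moreover, if the $\omega_i$ are independent, the second estimate is not true without the counterterms, whatever the rate of decay: for every function $\Upsilon:\mathbb N\to[0,\infty)$ with $\Upsilon(r)\to0$ as $r\to\infty$ (in particular for $\Upsilon(r)=e^{-\frac18mr}$) there is no constant $C<\infty$ such that $$\mathbb E\Big(\sup_{t\in\mathbb R}\big\|[\tau_t(X_{I_0}),Y_{I_0}]\big\|_1\Big)\le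 C\|X\|\|Y\|\,\Upsilon(\operatorname{dist}(X,Y))$$ for all $L\in\mathbb N$ and all local observables $X,Y$ on $[-L,L]$ with $\operatorname{dist}(X,Y)>0$. -/

import Mathlib

open MeasureTheory ProbabilityTheory Filter Topology Matrix
open scoped ENNReal

namespace XXZ

noncomputable section

/-! ## Finite-dimensional functional calculus and norms -/

section MatrixTools

variable {n : Type*} [Fintype n] [DecidableEq n]

/-- The functional calculus `g(A)` of a Hermitian matrix `A` for an arbitrary function
`g : ℝ → ℂ`, obtained by diagonalising `A` in an orthonormal basis of eigenvectors. -/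
def fnCalc {A : Matrix n n ℂ} (hA : A.IsHermitian) (g : ℝ → ℂ) : Matrix n n ℂ :=
  (hA.eigenvectorUnitary : Matrix n n ℂ) * Matrix.diagonal (fun k => g (hA.eigenvalues k)) *
    star (hA.eigenvectorUnitary : Matrix n n ℂ)

/-- The operator norm on the Hilbert space `ℂⁿ`. -/
def opNorm (A : Matrix n n ℂ) : ℝ := ‖Matrix.toEuclideanCLM (n := n) (𝕜 := ℂ) A‖

/-- The trace norm `‖A‖₁ = tr |A|`: the sum of the singular values of `A`, which are the square
roots of the eigenvalues of `Aᴴ * A`. -/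
def traceNorm (A : Matrix n n ℂ) : ℝ :=
  ∑ k, Real.sqrt ((Matrix.isHermitian_conjTranspose_mul_self A).eigenvalues k)

end MatrixTools

/-! ## The finite spin chain on `[-L, L]` -/

/-- The sites of the finite chain `[-L, L] ∩ ℤ`. -/
abbrev Site (L : ℕ) : Type := {i : ℤ // i ∈ Finset.Icc (-(L : ℤ)) (L : ℤ)}

/-- Classical spin configurations; `0` is spin up (`e₊`) and `1` is spin down (`e₋`). They label
the product orthonormal basis of `⨂_{i ∈ [-L, L]} ℂ²`. -/
abbrev Config (L : ℕ) : Type := Site L → Fin 2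

/-- Operators on `⨂_{i ∈ [-L, L]} ℂ²`, as matrices in the product basis. -/
abbrev Op (L : ℕ) : Type := Matrix (Config L) (Config L) ℂ

/-- The `2 × 2` matrix `a` acting on the site `i`, tensored with the identity elsewhere. -/
def siteOp {L : ℕ} (i : Site L) (a : Matrix (Fin 2) (Fin 2) ℂ) : Op L :=
  Matrix.of fun s s' => if ∀ k, k ≠ i → s k = s' k then a (s i) (s' i) else 0

/-- Pauli matrix `σˣ`. -/
def pauliX : Matrix (Fin 2) (Fin 2) ℂ := !![0, 1; 1, 0]

/-- Pauli matrix `σʸ`. -/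
def pauliY : Matrix (Fin 2) (Fin 2) ℂ := !![0, -Complex.I; Complex.I, 0]

/-- Pauli matrix `σᶻ`. -/
def pauliZ : Matrix (Fin 2) (Fin 2) ℂ := !![1, 0; 0, -1]

/-- The local number operator `𝒩ᵢ = (1 - σᶻᵢ) / 2`. -/
def numOp {L : ℕ} (i : Site L) : Op L := ((1 / 2 : ℝ) : ℂ) • (1 - siteOp i pauliZ)

/-- The two-site Hamiltonian
`(1 - σᶻᵢ σᶻⱼ) / 4 - (σˣᵢ σˣⱼ + σʸᵢ σʸⱼ) / (4 Δ)`. -/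
def bondOp {L : ℕ} (Δ : ℝ) (i j : Site L) : Op L :=
  ((1 / 4 : ℝ) : ℂ) • (1 - siteOp i pauliZ * siteOp j pauliZ)
    - ((1 / (4 * Δ) : ℝ) : ℂ) •
      (siteOp i pauliX * siteOp j pauliX + siteOp i pauliY * siteOp j pauliY)

/-- The left end point `-L` of the chain. -/
def leftEnd (L : ℕ) : Site L := ⟨-(L : ℤ), by simp⟩

/-- The right end point `L` of the chain. -/
def rightEnd (L : ℕ) : Site L := ⟨(L : ℤ), by simp⟩

/-- The deterministic parameters of the XXZ chain in the Ising phase: anisotropy `Δ > 1`, disorder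
strength `λ > 0`, boundary field `β ≥ (1 - 1/Δ) / 2`. -/
structure Params where
  Δ : ℝ
  lam : ℝ
  β : ℝ
  one_lt_Δ : 1 < Δ
  lam_pos : 0 < lam
  le_β : (1 / 2) * (1 - 1 / Δ) ≤ β

/-- The bottom `Θ₀ = 1 - 1/Δ` of the droplet spectrum. -/
def Params.Θ₀ (p : Params) : ℝ := 1 - 1 / p.Δ

/-- The XXZ Hamiltonian on `[-L, L]` in the field `v : ℤ → ℝ`:
`∑_{i=-L}^{L-1} h_{i,i+1} + λ ∑_{i=-L}^{L} vᵢ 𝒩ᵢ + β (𝒩_{-L} + 𝒩_L)`. -/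
def ham (p : Params) (L : ℕ) (v : ℤ → ℝ) : Op L :=
  (∑ i : Site L, ∑ j : Site L, if j.1 = i.1 + 1 then bondOp p.Δ i j else 0)
    + (p.lam : ℂ) • ∑ i : Site L, (v i.1 : ℂ) • numOp i
    + (p.β : ℂ) • (numOp (leftEnd L) + numOp (rightEnd L))

lemma siteOp_isHermitian {L : ℕ} (i : Site L) {a : Matrix (Fin 2) (Fin 2) ℂ}
    (ha : a.IsHermitian) : (siteOp i a).IsHermitian := by
  ext s s'
  have h : (∀ k, k ≠ i → s' k = s k) ↔ (∀ k, k ≠ i → s k = s' k) :=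
    ⟨fun h k hk => (h k hk).symm, fun h k hk => (h k hk).symm⟩
  simp only [siteOp, Matrix.conjTranspose_apply, Matrix.of_apply, h]
  split_ifs
  · exact ha.apply _ _
  · simp

lemma siteOp_mul_apply {L : ℕ} {i j : Site L} (hij : i ≠ j) (a b : Matrix (Fin 2) (Fin 2) ℂ)
    (s s' : Config L) : (siteOp i a * siteOp j b) s s' =
      if ∀ k, k ≠ i → k ≠ j → s k = s' k then a (s i) (s' i) * b (s j) (s' j) else 0 := by
  rw [Matrix.mul_apply, Finset.sum_eq_single (Function.update s i (s' i))]
  · simp only [siteOp, Matrix.of_apply]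
    have h1 : ∀ k, k ≠ i → s k = Function.update s i (s' i) k := fun k hk => by simp [hk]
    rw [if_pos h1]
    have h2 : (∀ k, k ≠ j → Function.update s i (s' i) k = s' k) ↔
        ∀ k, k ≠ i → k ≠ j → s k = s' k := by
      constructor
      · intro h k hki hkj
        have := h k hkj
        simpa [hki] using this
      · intro h k hkj
        by_cases hki : k = i
        · subst hki; simp
        · simpa [hki] using h k hki hkj
    simp only [h2, Function.update_self, Function.update_of_ne hij.symm]
    split_ifs <;> simp
  · intro t _ ht
    simp only [siteOp, Matrix.of_apply]
    by_cases h1 : ∀ k, k ≠ i → s k = t k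
    · by_cases h2 : ∀ k, k ≠ j → t k = s' k
      · exfalso
        apply ht
        funext k
        by_cases hk : k = i
        · subst hk; simpa using h2 k hij
        · simpa [hk] using (h1 k hk).symm
      · rw [if_neg h2, mul_zero]
    · rw [if_neg h1, zero_mul]
  · simp

lemma siteOp_mul_isHermitian {L : ℕ} {i j : Site L} (hij : i ≠ j)
    {a b : Matrix (Fin 2) (Fin 2) ℂ} (ha : a.IsHermitian) (hb : b.IsHermitian) :
    (siteOp i a * siteOp j b).IsHermitian := by
  ext s s'
  have h : (∀ k, k ≠ i → k ≠ j → s' k = s k) ↔ (∀ k, k ≠ i → k ≠ j → s k = s' k) :=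
    ⟨fun h k hk hk' => (h k hk hk').symm, fun h k hk hk' => (h k hk hk').symm⟩
  rw [Matrix.conjTranspose_apply, siteOp_mul_apply hij, siteOp_mul_apply hij]
  simp only [h]
  split_ifs
  · rw [star_mul', ha.apply, hb.apply]
  · simp

lemma pauliX_isHermitian : pauliX.IsHermitian := by
  ext i j; fin_cases i <;> fin_cases j <;> simp [pauliX]

lemma pauliY_isHermitian : pauliY.IsHermitian := by
  ext i j; fin_cases i <;> fin_cases j <;> simp [pauliY]

lemma pauliZ_isHermitian : pauliZ.IsHermitian := by
  ext i j; fin_cases i <;> fin_cases j <;> simp [pauliZ]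

lemma isHermitian_real_smul {n : Type*} (r : ℝ) {A : Matrix n n ℂ} (hA : A.IsHermitian) :
    ((r : ℂ) • A).IsHermitian := by
  ext i j
  simp [Matrix.conjTranspose_apply, ← hA.apply i j]

lemma isHermitian_finset_sum {n ι : Type*} (t : Finset ι) (f : ι → Matrix n n ℂ)
    (hf : ∀ i ∈ t, (f i).IsHermitian) : (∑ i ∈ t, f i).IsHermitian := by
  unfold Matrix.IsHermitian
  rw [Matrix.conjTranspose_sum]
  exact Finset.sum_congr rfl hf

lemma numOp_isHermitian {L : ℕ} (i : Site L) : (numOp i).IsHermitian :=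
  isHermitian_real_smul _ (Matrix.isHermitian_one.sub (siteOp_isHermitian i pauliZ_isHermitian))

lemma bondOp_isHermitian {L : ℕ} (Δ : ℝ) {i j : Site L} (hij : i ≠ j) :
    (bondOp Δ i j).IsHermitian :=
  (isHermitian_real_smul _ (Matrix.isHermitian_one.sub
    (siteOp_mul_isHermitian hij pauliZ_isHermitian pauliZ_isHermitian))).sub
    (isHermitian_real_smul _
      ((siteOp_mul_isHermitian hij pauliX_isHermitian pauliX_isHermitian).add
        (siteOp_mul_isHermitian hij pauliY_isHermitian pauliY_isHermitian)))

lemma ham_isHermitian (p : Params) (L : ℕ) (v : ℤ → ℝ) : (ham p L v).IsHermitian := by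
  refine Matrix.IsHermitian.add (Matrix.IsHermitian.add ?_ ?_) ?_
  · refine isHermitian_finset_sum _ _ fun i _ => isHermitian_finset_sum _ _ fun j _ => ?_
    split_ifs with h
    · refine bondOp_isHermitian _ fun hij => ?_
      rw [hij] at h
      omega
    · exact Matrix.isHermitian_zero
  · exact isHermitian_real_smul _
      (isHermitian_finset_sum _ _ fun i _ => isHermitian_real_smul _ (numOp_isHermitian i))
  · exact isHermitian_real_smul _ ((numOp_isHermitian _).add (numOp_isHermitian _))

/-- `g(H)` for the Hamiltonian `H` on `[-L, L]` in the field `v`. -/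
def hamFn (p : Params) (L : ℕ) (v : ℤ → ℝ) (g : ℝ → ℂ) : Op L :=
  fnCalc (ham_isHermitian p L v) g

/-- The spectral projection `P_B = χ_B(H)`. -/
def specProj (p : Params) (L : ℕ) (v : ℤ → ℝ) (B : Set ℝ) : Op L :=
  hamFn p L v (B.indicator 1)

/-- The restriction `A_B = P_B A P_B` of `A` to the energy window `B`. -/
def window (p : Params) (L : ℕ) (v : ℤ → ℝ) (B : Set ℝ) (A : Op L) : Op L :=
  specProj p L v B * A * specProj p L v B

/-- The Heisenberg evolution `τ_t(A) = e^{itH} A e^{-itH}`. -/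
def evol (p : Params) (L : ℕ) (v : ℤ → ℝ) (t : ℝ) (A : Op L) : Op L :=
  hamFn p L v (fun x => Complex.exp (Complex.I * t * x)) * A *
    hamFn p L v (fun x => Complex.exp (-(Complex.I * t * x)))

/-! ## Local observables -/

/-- A local observable on `[-L, L]` together with its support, a nonempty integer interval
`[lo, hi] ⊆ [-L, L]`: an operator `core` on `⨂_{i ∈ [lo, hi]} ℂ²`. -/
structure LocalObs (L : ℕ) where
  lo : ℤ
  hi : ℤ
  neg_L_le_lo : -(L : ℤ) ≤ lo
  lo_le_hi : lo ≤ hi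
  hi_le_L : hi ≤ (L : ℤ)
  core : Matrix ({i : Site L // lo ≤ i.1 ∧ i.1 ≤ hi} → Fin 2)
    ({i : Site L // lo ≤ i.1 ∧ i.1 ≤ hi} → Fin 2) ℂ

/-- The local observable as an operator on the whole chain, acting as the identity on the spins
outside its support. -/
def LocalObs.op {L : ℕ} (X : LocalObs L) : Op L :=
  Matrix.of fun s s' =>
    if ∀ k : Site L, ¬ (X.lo ≤ k.1 ∧ k.1 ≤ X.hi) → s k = s' k then
      X.core (fun i => s i.1) (fun i => s' i.1)
    else 0

/-- `‖X‖`, the operator norm. -/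
def LocalObs.norm {L : ℕ} (X : LocalObs L) : ℝ := opNorm X.op

/-- `dist(X, Y)`: the distance between the supports of `X` and `Y`. -/
def LocalObs.dist {L : ℕ} (X Y : LocalObs L) : ℕ :=
  sInf {d : ℕ | ∃ i ∈ Set.Icc X.lo X.hi, ∃ j ∈ Set.Icc Y.lo Y.hi, d = (i - j).natAbs}

/-! ## Disorder and droplet localization -/

/-- The random field `ω = (ωᵢ)_{i ∈ ℤ}` of a disordered XXZ chain: identically distributed, with
joint law ergodic under the shift of `ℤ`, and single-site law `μ` such that
`{0, 1} ⊆ supp μ ⊆ [0, 1]` and `μ {0} = 0`. -/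
structure IsDisorder {Ω : Type*} [MeasurableSpace Ω] (P : Measure Ω) (ω : ℤ → Ω → ℝ) : Prop where
  measurable : ∀ i, Measurable (ω i)
  identDistrib : ∀ i, IdentDistrib (ω i) (ω 0) P P
  ergodic : Ergodic (fun (v : ℤ → ℝ) (i : ℤ) => v (i + 1))
    (P.map fun (w : Ω) (i : ℤ) => ω i w)
  subset_support : {0, 1} ⊆ (P.map (ω 0)).support
  support_subset : (P.map (ω 0)).support ⊆ Set.Icc 0 1
  no_atom_zero : P.map (ω 0) {0} = 0

/-- The class `G_B` of Borel functions `g : ℝ → ℂ` with `|g| ≤ χ_B`. -/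
def borelClass (B : Set ℝ) : Set (ℝ → ℂ) :=
  {g | Measurable g ∧ ∀ x, ‖g x‖ ≤ B.indicator (fun _ => (1 : ℝ)) x}

/-- Property DL (droplet localization) in the interval `I = [Θ₀, Θ₁]`, with constants `C` and `m`:
`𝔼 (sup_{g ∈ G_I} ‖𝒩ᵢ g(H) 𝒩ⱼ‖₁) ≤ C e^{-m |i - j|}` for all `L` and all `i, j ∈ [-L, L]`. -/
structure PropertyDL (p : Params) {Ω : Type*} [MeasurableSpace Ω] (P : Measure Ω)
    (ω : ℤ → Ω → ℝ) (Θ₁ C m : ℝ) : Prop where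
  lt : p.Θ₀ < Θ₁
  m_pos : 0 < m
  bound : ∀ (L : ℕ) (i j : Site L),
    ∫⁻ w, ⨆ g ∈ borelClass (Set.Icc p.Θ₀ Θ₁),
        ENNReal.ofReal (traceNorm (numOp i * hamFn p L (fun k => ω k w) g * numOp j)) ∂P
      ≤ ENNReal.ofReal (C * Real.exp (-m * |((i.1 - j.1 : ℤ) : ℝ)|))

end

end XXZ

namespace XXZ

open scoped Matrix.Norms.L2Operator

/-! ### The trace norm -/

section TraceNorm

variable {n : Type*} [Fintype n] [DecidableEq n]

/-! Write `O` for the projection onto the all-spins-up vector (the vacuum), `P` for the spectral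
projection on `[Θ₀, Θ₁]` and `Q` for that on `[0, Θ₁]`. Each domain wall costs at least `Θ₀/2`, and
the boundary field makes the ends of the chain count as walls, so `H ≥ Θ₀ (1 - O)` while `H O = 0`
(`hasGap_ham`). Hence `P_{0} = O` and `Q = P + O`. Subtracting from an observable its expectation in
the local all-up state changes no commutator inside a window, since the window projection acts there
as the identity. The resulting centered observable `A` satisfies `O A O = 0`, and more: where all
spins near its support are up, it must create a down spin.

The heart is that `Q A U B Q` is small in trace norm for centered `A`, `B` with distant supports and
`U = e^{irH} P` (`IsCentered.traceNorm_mul_le`). Insert projections on "all spins up near `A`" and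
"all spins up near `B`" beside `U`. Where there is no down spin near `A`, there is one far away
because `U` avoids the vacuum, and `A` creates another one on its support; the outer `Q` then meets
two distant down spins. The same holds at `B`. What remains is `U` between spin-down projections of
two distant regions, which Property DL controls directly.

Two distant down spins are rare in the droplet window (`ofReal_traceNorm_pair_le`). With `D`, `E`
the two spin-down projections, `‖D E P‖₁ ≤ ∑ₖ ‖D E P 𝒩ₖ‖₁`. A site `k` on one side is far from the
opposite region, so DL applies. For `k` in between, Hölder gives `s ‖D E P‖₂² + s⁻¹ ‖P 𝒩ₖ‖₂²`, where
`‖D E P‖₂² = tr (D P E)` decays like `e^{-mr}`; taking `s = e^{mr/2}` leaves `e^{-mr/2}`. Summing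
over about `r` sites lowers the rate to `3m/8`, and splitting the gap between the supports into
thirds gives the rate `m/8`.

The rest of the direct part is algebra (`IsSplit.lie_window`): since `O A O = O B O = 0`, the
commutator of `Q A Q` and `Q B Q` consists of products with `P` between `A` and `B`, which are
small, and of the counterterm `P (A O B - B O A) P`. In a double commutator the counterterm meets
the third observable through `Q B P C Q` and its analogues, so it is small again.

For the converse let `X` flip spins down collectively on a block of small field, and let `Y` be the
adjoint flip on another such block at distance `D`. `X` sends the vacuum to a flat superposition of
one-spin-down states; a trial-energy computation puts at least half of its weight in the droplet
window (`half_le_qform_specProj`). The counterterm then has trace norm at least `1/4` on an event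
whose probability is positive and, by independence, does not depend on `D`. By the corrected
estimate the commutator itself cannot tend to zero. -/

lemma opNorm_eq_norm (A : Matrix n n ℂ) : opNorm A = ‖A‖ := rfl

lemma norm_mulVec_toLp_le (A : Matrix n n ℂ) (v : n → ℂ) :
    ‖WithLp.toLp 2 (A *ᵥ v)‖ ≤ ‖A‖ * ‖WithLp.toLp 2 v‖ :=
  Matrix.l2_opNorm_mulVec A (WithLp.toLp 2 v)

lemma norm_toLp_col_sq (A : Matrix n n ℂ) (k : n) :
    ((‖WithLp.toLp 2 (fun j => A j k)‖ ^ 2 : ℝ) : ℂ) = (Aᴴ * A) k k := by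
  rw [EuclideanSpace.norm_sq_eq, Matrix.mul_apply]
  push_cast
  refine Finset.sum_congr rfl fun j _ => ?_
  rw [Matrix.conjTranspose_apply, ← Complex.conj_mul']
  rfl

lemma norm_apply_le_norm (A : Matrix n n ℂ) (i j : n) : ‖A i j‖ ≤ ‖A‖ := by
  have h := norm_mulVec_toLp_le A (Pi.single j 1)
  rw [PiLp.toLp_single, PiLp.norm_single, norm_one, mul_one,
    Matrix.mulVec_single_one] at h
  exact (PiLp.norm_apply_le (WithLp.toLp 2 (A.col j)) i).trans h

lemma norm_mul_apply_self_le (C M : Matrix n n ℂ) (k : n) :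
    ‖(C * M) k k‖ ≤ ‖C‖ * ‖WithLp.toLp 2 (fun j => M j k)‖ := by
  have h := norm_mulVec_toLp_le C (fun j => M j k)
  exact (PiLp.norm_apply_le (WithLp.toLp 2 (C *ᵥ fun j => M j k)) k).trans h

lemma norm_one_matrix_le : ‖(1 : Matrix n n ℂ)‖ ≤ 1 := by
  rw [← Matrix.diagonal_one, Matrix.l2_opNorm_diagonal]
  exact (pi_norm_le_iff_of_nonneg zero_le_one).2 fun _ => by simp

lemma norm_eigenvectorUnitary_le {A : Matrix n n ℂ} (hA : A.IsHermitian) :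
    ‖(hA.eigenvectorUnitary : Matrix n n ℂ)‖ ≤ 1 :=
  by
  have h := CStarRing.norm_coe_unitary_mul hA.eigenvectorUnitary (1 : Matrix n n ℂ)
  rw [mul_one] at h
  exact h.trans_le norm_one_matrix_le

lemma norm_star_eigenvectorUnitary_le {A : Matrix n n ℂ} (hA : A.IsHermitian) :
    ‖star (hA.eigenvectorUnitary : Matrix n n ℂ)‖ ≤ 1 := by
  rw [norm_star]; exact norm_eigenvectorUnitary_le hA

lemma star_eigenvectorUnitary_mul {A : Matrix n n ℂ} (hA : A.IsHermitian) :
    star (hA.eigenvectorUnitary : Matrix n n ℂ) * (hA.eigenvectorUnitary : Matrix n n ℂ) = 1 :=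
  Unitary.star_mul_self_of_mem hA.eigenvectorUnitary.2

lemma eigenvectorUnitary_mul_star {A : Matrix n n ℂ} (hA : A.IsHermitian) :
    (hA.eigenvectorUnitary : Matrix n n ℂ) * star (hA.eigenvectorUnitary : Matrix n n ℂ) = 1 :=
  Unitary.mul_star_self_of_mem hA.eigenvectorUnitary.2

lemma eq_eigenvectorUnitary_mul_diagonal {A : Matrix n n ℂ} (hA : A.IsHermitian) :
    A = (hA.eigenvectorUnitary : Matrix n n ℂ) *
      Matrix.diagonal (fun k => (hA.eigenvalues k : ℂ)) *
      star (hA.eigenvectorUnitary : Matrix n n ℂ) := by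
  have h := hA.spectral_theorem
  rw [Unitary.conjStarAlgAut_apply] at h
  exact h

lemma star_eigenvectorUnitary_mul_mul {A : Matrix n n ℂ} (hA : A.IsHermitian) :
    star (hA.eigenvectorUnitary : Matrix n n ℂ) * A * (hA.eigenvectorUnitary : Matrix n n ℂ) =
      Matrix.diagonal (fun k => (hA.eigenvalues k : ℂ)) := by
  have h1 := star_eigenvectorUnitary_mul hA
  have h2 := eq_eigenvectorUnitary_mul_diagonal hA
  set V := (hA.eigenvectorUnitary : Matrix n n ℂ)
  set D := Matrix.diagonal (fun k => (hA.eigenvalues k : ℂ))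
  calc star V * A * V = (star V * V) * D * (star V * V) := by
        conv_lhs => rw [h2]
        simp only [Matrix.mul_assoc]
    _ = D := by rw [h1, Matrix.one_mul, Matrix.mul_one]

open scoped ComplexOrder in
lemma eigenvalues_conjTranspose_mul_self_nonneg (A : Matrix n n ℂ) (k : n) :
    0 ≤ (Matrix.isHermitian_conjTranspose_mul_self A).eigenvalues k :=
  (Matrix.posSemidef_conjTranspose_mul_self A).eigenvalues_nonneg k

/-- The trace is computed in an orthonormal eigenbasis of `Aᴴ * A`: the matrix `A` maps its vectors
to vectors whose lengths are the singular values. -/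
lemma norm_trace_mul_le (C A : Matrix n n ℂ) : ‖(C * A).trace‖ ≤ ‖C‖ * traceNorm A := by
  set hA := Matrix.isHermitian_conjTranspose_mul_self A with hAdef
  have h2 := eigenvectorUnitary_mul_star hA
  have h3 := star_eigenvectorUnitary_mul_mul hA
  have hs := norm_star_eigenvectorUnitary_le hA
  set V := (hA.eigenvectorUnitary : Matrix n n ℂ)
  have htr : (C * A).trace = ((star V * C) * (A * V)).trace := by
    calc (C * A).trace = (C * A * (V * star V)).trace := by rw [h2, Matrix.mul_one]
      _ = ((C * A * V) * star V).trace := by simp only [Matrix.mul_assoc]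
      _ = (star V * (C * A * V)).trace := Matrix.trace_mul_comm _ _
      _ = _ := by simp only [Matrix.mul_assoc]
  have hcol : ∀ k, ‖WithLp.toLp 2 (fun j => (A * V) j k)‖ = Real.sqrt (hA.eigenvalues k) := by
    intro k
    rw [← Real.sqrt_sq (norm_nonneg (WithLp.toLp 2 (fun j => (A * V) j k)))]
    congr 1
    have h := norm_toLp_col_sq (A * V) k
    have h4 : (A * V)ᴴ * (A * V) = star V * (Aᴴ * A) * V := by
      rw [Matrix.conjTranspose_mul, Matrix.star_eq_conjTranspose]
      simp only [Matrix.mul_assoc]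
    rw [h4, h3, Matrix.diagonal_apply_eq] at h
    exact_mod_cast h
  have hC : ‖star V * C‖ ≤ ‖C‖ := by
    calc ‖star V * C‖ ≤ ‖star V‖ * ‖C‖ := norm_mul_le _ _
      _ ≤ 1 * ‖C‖ := by gcongr
      _ = ‖C‖ := one_mul _
  rw [htr, traceNorm, Finset.mul_sum]
  refine (norm_sum_le _ _).trans (Finset.sum_le_sum fun k _ => ?_)
  have h := norm_mul_apply_self_le (star V * C) (A * V) k
  rw [hcol] at h
  exact h.trans (by gcongr)

/-- Equality in the duality holds for `C = |A|⁻¹ Aᴴ`, the adjoint of the partial isometry in the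
polar decomposition. The triangle, ideal and Hölder inequalities below all follow from this dual
description. -/
lemma exists_trace_mul_eq_traceNorm (A : Matrix n n ℂ) :
    ∃ C : Matrix n n ℂ, ‖C‖ ≤ 1 ∧ (C * A).trace = traceNorm A := by
  set hA := Matrix.isHermitian_conjTranspose_mul_self A with hAdef
  have h1 := star_eigenvectorUnitary_mul hA
  have h3 := star_eigenvectorUnitary_mul_mul hA
  have hs := norm_star_eigenvectorUnitary_le hA
  have hv := norm_eigenvectorUnitary_le hA
  have hd := eigenvalues_conjTranspose_mul_self_nonneg A
  rw [← hAdef] at hd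
  set V := (hA.eigenvectorUnitary : Matrix n n ℂ)
  -- Since `0⁻¹ = 0`, `σ` vanishes on the kernel of `A`, so `C` makes sense for singular `A`.
  set σ : n → ℂ := fun k => ((Real.sqrt (hA.eigenvalues k))⁻¹ : ℝ) with hσ
  have hσs : (Matrix.diagonal σ)ᴴ = Matrix.diagonal σ := by
    rw [Matrix.diagonal_conjTranspose]
    congr 1
    ext k
    simp [hσ, Complex.conj_ofReal]
  have h3' : star V * (Aᴴ * (A * V)) = Matrix.diagonal (fun k => (hA.eigenvalues k : ℂ)) := by
    rw [← h3]; simp only [Matrix.mul_assoc]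
  refine ⟨V * Matrix.diagonal σ * (star V * Aᴴ), ?_, ?_⟩
  · set W := Matrix.diagonal σ * (star V * Aᴴ)
    have hW : W * Wᴴ = Matrix.diagonal (fun k => σ k * (hA.eigenvalues k : ℂ) * σ k) := by
      have : Wᴴ = A * V * Matrix.diagonal σ := by
        simp only [W, Matrix.conjTranspose_mul, hσs, Matrix.star_eq_conjTranspose,
          Matrix.conjTranspose_conjTranspose]
      rw [this]
      calc W * (A * V * Matrix.diagonal σ)
          = Matrix.diagonal σ * (star V * (Aᴴ * (A * V))) * Matrix.diagonal σ := by
            simp only [W, Matrix.mul_assoc]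
        _ = _ := by rw [h3', Matrix.diagonal_mul_diagonal, Matrix.diagonal_mul_diagonal]
    have hWn : ‖W‖ * ‖W‖ ≤ 1 := by
      have h5 : ‖W * Wᴴ‖ = ‖W‖ * ‖W‖ := CStarRing.norm_self_mul_star
      rw [← h5, hW, Matrix.l2_opNorm_diagonal]
      refine (pi_norm_le_iff_of_nonneg zero_le_one).2 fun k => ?_
      simp only [hσ]
      rw [← Complex.ofReal_mul, ← Complex.ofReal_mul, Complex.norm_real]
      rcases (hd k).eq_or_lt with h0 | h0
      · simp [← h0]
      · have : (Real.sqrt (hA.eigenvalues k))⁻¹ * hA.eigenvalues k *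
            (Real.sqrt (hA.eigenvalues k))⁻¹ = 1 := by
          have h6 : Real.sqrt (hA.eigenvalues k) ≠ 0 := (Real.sqrt_pos.2 h0).ne'
          field_simp
          exact (Real.sq_sqrt h0.le).symm
        rw [this]; simp
    have hWle : ‖W‖ ≤ 1 := by nlinarith [norm_nonneg W]
    calc ‖V * Matrix.diagonal σ * (star V * Aᴴ)‖ = ‖V * W‖ := by simp only [W, Matrix.mul_assoc]
      _ ≤ ‖V‖ * ‖W‖ := norm_mul_le _ _
      _ ≤ 1 * 1 := by gcongr
      _ = 1 := one_mul _
  · calc (V * Matrix.diagonal σ * (star V * Aᴴ) * A).trace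
        = (V * (Matrix.diagonal σ * (star V * Aᴴ) * A)).trace := by simp only [Matrix.mul_assoc]
      _ = (Matrix.diagonal σ * (star V * Aᴴ) * A * V).trace := Matrix.trace_mul_comm _ _
      _ = (Matrix.diagonal σ * (star V * (Aᴴ * (A * V)))).trace := by
          simp only [Matrix.mul_assoc]
      _ = ∑ k, σ k * (hA.eigenvalues k : ℂ) := by
          rw [h3', Matrix.diagonal_mul_diagonal, Matrix.trace_diagonal]
      _ = traceNorm A := by
          rw [traceNorm, Complex.ofReal_sum]
          refine Finset.sum_congr rfl fun k _ => ?_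
          simp only [hσ]
          rw [← Complex.ofReal_mul]
          congr 1
          rcases (hd k).eq_or_lt with h0 | h0
          · simp [← h0]
          · have h6 : Real.sqrt (hA.eigenvalues k) ≠ 0 := (Real.sqrt_pos.2 h0).ne'
            field_simp
            exact (Real.sq_sqrt h0.le).symm

lemma traceNorm_nonneg (A : Matrix n n ℂ) : 0 ≤ traceNorm A :=
  Finset.sum_nonneg fun _ _ => Real.sqrt_nonneg _

lemma traceNorm_le_of_forall {A : Matrix n n ℂ} {r : ℝ}
    (h : ∀ C : Matrix n n ℂ, ‖C‖ ≤ 1 → ‖(C * A).trace‖ ≤ r) : traceNorm A ≤ r := by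
  obtain ⟨C, hC, hA⟩ := exists_trace_mul_eq_traceNorm A
  have := h C hC
  rw [hA, Complex.norm_real] at this
  exact (le_abs_self _).trans this

lemma norm_trace_mul_le_of_norm_le_one {C : Matrix n n ℂ} (hC : ‖C‖ ≤ 1) (A : Matrix n n ℂ) :
    ‖(C * A).trace‖ ≤ traceNorm A :=
  (norm_trace_mul_le C A).trans (mul_le_of_le_one_left (traceNorm_nonneg A) hC)

lemma norm_trace_le_traceNorm (A : Matrix n n ℂ) : ‖A.trace‖ ≤ traceNorm A := by
  simpa using norm_trace_mul_le_of_norm_le_one (C := 1)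
    norm_one_matrix_le A

lemma traceNorm_add_le (A B : Matrix n n ℂ) : traceNorm (A + B) ≤ traceNorm A + traceNorm B := by
  refine traceNorm_le_of_forall fun C hC => ?_
  rw [Matrix.mul_add, Matrix.trace_add]
  exact (norm_add_le _ _).trans (add_le_add (norm_trace_mul_le_of_norm_le_one hC A)
    (norm_trace_mul_le_of_norm_le_one hC B))

@[simp] lemma traceNorm_zero : traceNorm (0 : Matrix n n ℂ) = 0 :=
  le_antisymm (traceNorm_le_of_forall fun C _ => by simp) (traceNorm_nonneg _)

lemma traceNorm_sum_le {ι : Type*} (s : Finset ι) (f : ι → Matrix n n ℂ) :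
    traceNorm (∑ i ∈ s, f i) ≤ ∑ i ∈ s, traceNorm (f i) :=
  Finset.le_sum_of_subadditive _ traceNorm_zero.le traceNorm_add_le s f

lemma traceNorm_mul_le_norm_mul (A B : Matrix n n ℂ) :
    traceNorm (A * B) ≤ ‖A‖ * traceNorm B := by
  refine traceNorm_le_of_forall fun C hC => ?_
  rw [← Matrix.mul_assoc]
  refine (norm_trace_mul_le _ _).trans ?_
  have := traceNorm_nonneg B
  gcongr
  calc ‖C * A‖ ≤ ‖C‖ * ‖A‖ := norm_mul_le _ _
    _ ≤ 1 * ‖A‖ := by gcongr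
    _ = ‖A‖ := one_mul _

lemma traceNorm_mul_le_mul_norm (A B : Matrix n n ℂ) :
    traceNorm (A * B) ≤ traceNorm A * ‖B‖ := by
  refine traceNorm_le_of_forall fun C hC => ?_
  rw [← Matrix.mul_assoc, Matrix.trace_mul_comm, ← Matrix.mul_assoc]
  refine (norm_trace_mul_le _ _).trans ?_
  rw [mul_comm (traceNorm A)]
  have := traceNorm_nonneg A
  gcongr
  calc ‖B * C‖ ≤ ‖B‖ * ‖C‖ := norm_mul_le _ _
    _ ≤ ‖B‖ * 1 := by gcongr
    _ = ‖B‖ := mul_one _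

lemma traceNorm_mul_mul_le (A B C : Matrix n n ℂ) :
    traceNorm (A * B * C) ≤ ‖A‖ * traceNorm B * ‖C‖ :=
  (traceNorm_mul_le_mul_norm _ _).trans
    (mul_le_mul_of_nonneg_right (traceNorm_mul_le_norm_mul _ _) (norm_nonneg _))

lemma traceNorm_mul_mul_le_of_le_one {A C : Matrix n n ℂ} (hA : ‖A‖ ≤ 1) (hC : ‖C‖ ≤ 1)
    (B : Matrix n n ℂ) : traceNorm (A * B * C) ≤ traceNorm B := by
  refine (traceNorm_mul_mul_le A B C).trans ?_
  have := traceNorm_nonneg B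
  calc ‖A‖ * traceNorm B * ‖C‖ ≤ 1 * traceNorm B * 1 := by gcongr
    _ = traceNorm B := by ring

lemma traceNorm_conjTranspose_le (A : Matrix n n ℂ) : traceNorm Aᴴ ≤ traceNorm A := by
  refine traceNorm_le_of_forall fun C hC => ?_
  have : (C * Aᴴ).trace = star (Cᴴ * A).trace := by
    rw [← Matrix.trace_conjTranspose, Matrix.conjTranspose_mul,
      Matrix.conjTranspose_conjTranspose, Matrix.trace_mul_comm]
  rw [this, norm_star]
  exact norm_trace_mul_le_of_norm_le_one (by rwa [Matrix.l2_opNorm_conjTranspose]) A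

@[simp] lemma traceNorm_conjTranspose (A : Matrix n n ℂ) : traceNorm Aᴴ = traceNorm A :=
  le_antisymm (traceNorm_conjTranspose_le A) (by simpa using traceNorm_conjTranspose_le Aᴴ)

lemma traceNorm_smul_le (c : ℂ) (A : Matrix n n ℂ) : traceNorm (c • A) ≤ ‖c‖ * traceNorm A := by
  refine traceNorm_le_of_forall fun C hC => ?_
  rw [Matrix.mul_smul, Matrix.trace_smul, norm_smul]
  exact mul_le_mul_of_nonneg_left (norm_trace_mul_le_of_norm_le_one hC A) (norm_nonneg _)

@[simp] lemma traceNorm_neg (A : Matrix n n ℂ) : traceNorm (-A) = traceNorm A := by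
  have h : ∀ B : Matrix n n ℂ, traceNorm (-B) ≤ traceNorm B := fun B => by
    simpa using traceNorm_smul_le (-1) B
  exact le_antisymm (h A) (by simpa using h (-A))

lemma traceNorm_sub_le (A B : Matrix n n ℂ) : traceNorm (A - B) ≤ traceNorm A + traceNorm B := by
  rw [sub_eq_add_neg, ← traceNorm_neg B]
  exact traceNorm_add_le _ _

lemma traceNorm_le_card_mul_norm (A : Matrix n n ℂ) : traceNorm A ≤ Fintype.card n * ‖A‖ := by
  refine traceNorm_le_of_forall fun C hC => ?_
  calc ‖(C * A).trace‖ ≤ ∑ k, ‖(C * A) k k‖ := norm_sum_le _ _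
    _ ≤ ∑ _k : n, ‖A‖ := Finset.sum_le_sum fun k _ => by
        refine (norm_apply_le_norm _ k k).trans ((norm_mul_le _ _).trans ?_)
        exact mul_le_of_le_one_left (norm_nonneg _) hC
    _ = Fintype.card n * ‖A‖ := by simp

/-- The Lipschitz constant grows with the dimension, which is harmless: only continuity is needed,
for measurability in the disorder and for restricting suprema to rational times. -/
lemma continuous_traceNorm : Continuous (traceNorm : Matrix n n ℂ → ℝ) := by
  refine (LipschitzWith.of_dist_le_mul (K := Fintype.card n) fun A B => ?_).continuous
  rw [dist_eq_norm, dist_eq_norm, Real.norm_eq_abs]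
  have h : ∀ A B : Matrix n n ℂ, traceNorm A - traceNorm B ≤ Fintype.card n * ‖A - B‖ := by
    intro A B
    have h1 := traceNorm_add_le (A - B) B
    rw [sub_add_cancel] at h1
    have h2 := traceNorm_le_card_mul_norm (A - B)
    linarith
  refine abs_sub_le_iff.2 ⟨by simpa using h A B, ?_⟩
  rw [norm_sub_rev]
  simpa using h B A

/-- The squared Hilbert–Schmidt norm does not increase under a contraction. -/
lemma sum_norm_sq_mul_le {C : Matrix n n ℂ} (hC : ‖C‖ ≤ 1) (A : Matrix n n ℂ) :
    ∑ i, ∑ j, ‖(C * A) i j‖ ^ 2 ≤ ∑ i, ∑ j, ‖A i j‖ ^ 2 := by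
  rw [Finset.sum_comm, Finset.sum_comm (f := fun i j => ‖A i j‖ ^ 2)]
  refine Finset.sum_le_sum fun k _ => ?_
  have h := norm_mulVec_toLp_le C (fun j => A j k)
  have h2 := pow_le_pow_left₀ (norm_nonneg _)
    (h.trans (mul_le_of_le_one_left (norm_nonneg _) hC)) 2
  rw [EuclideanSpace.norm_sq_eq, EuclideanSpace.norm_sq_eq] at h2
  exact h2

lemma sum_norm_sq_eq_re_trace (A : Matrix n n ℂ) :
    ∑ i, ∑ j, ‖A i j‖ ^ 2 = (Aᴴ * A).trace.re := by
  have : (((∑ i, ∑ j, ‖A i j‖ ^ 2 : ℝ)) : ℂ) = (Aᴴ * A).trace := by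
    rw [Finset.sum_comm, Matrix.trace, Complex.ofReal_sum]
    refine Finset.sum_congr rfl fun k _ => ?_
    rw [Matrix.diag_apply, ← norm_toLp_col_sq, EuclideanSpace.norm_sq_eq]
  rw [← this, Complex.ofReal_re]

/-- Hölder's inequality for the trace norm and the Hilbert–Schmidt norm, in additive form. -/
lemma traceNorm_mul_le_hilbertSchmidt {s : ℝ} (hs : 0 < s) (A B : Matrix n n ℂ) :
    traceNorm (A * B) ≤ s * (Aᴴ * A).trace.re + s⁻¹ * (Bᴴ * B).trace.re := by
  refine traceNorm_le_of_forall fun C hC => ?_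
  rw [← Matrix.mul_assoc, ← sum_norm_sq_eq_re_trace, ← sum_norm_sq_eq_re_trace]
  set M := C * A with hM
  have h1 : ‖(M * B).trace‖ ≤ ∑ i, ∑ j, ‖M i j‖ * ‖B j i‖ := by
    refine (norm_sum_le _ _).trans (Finset.sum_le_sum fun i _ => ?_)
    rw [Matrix.diag_apply, Matrix.mul_apply]
    refine (norm_sum_le _ _).trans (Finset.sum_le_sum fun j _ => ?_)
    rw [norm_mul]
  -- Weighted arithmetic-geometric mean. The additive form with a free weight survives taking
  -- expectations, where `s` is then chosen.
  have h2 : ∑ i, ∑ j, ‖M i j‖ * ‖B j i‖ ≤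
      ∑ i, ∑ j, (s * ‖M i j‖ ^ 2 + s⁻¹ * ‖B j i‖ ^ 2) := by
    refine Finset.sum_le_sum fun i _ => Finset.sum_le_sum fun j _ => ?_
    have h3 : 0 ≤ s * (‖M i j‖ - s⁻¹ * ‖B j i‖) ^ 2 := by positivity
    have h4 : s * (‖M i j‖ - s⁻¹ * ‖B j i‖) ^ 2 =
        s * ‖M i j‖ ^ 2 + s⁻¹ * ‖B j i‖ ^ 2 - 2 * (‖M i j‖ * ‖B j i‖) := by
      field_simp; ring
    have h5 : 0 ≤ ‖M i j‖ * ‖B j i‖ := by positivity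
    linarith
  refine h1.trans (h2.trans ?_)
  simp only [Finset.sum_add_distrib, ← Finset.mul_sum]
  rw [Finset.sum_comm (f := fun i j => ‖B j i‖ ^ 2)]
  have := sum_norm_sq_mul_le hC A
  gcongr

end TraceNorm

end XXZ

namespace XXZ

open scoped Matrix.Norms.L2Operator

/-! ### The functional calculus -/

section FnCalc

variable {n : Type*} [Fintype n] [DecidableEq n] {A : Matrix n n ℂ} (hA : A.IsHermitian)

lemma fnCalc_mul (g h : ℝ → ℂ) : fnCalc hA g * fnCalc hA h = fnCalc hA (fun x => g x * h x) := by
  have h1 := star_eigenvectorUnitary_mul hA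
  unfold fnCalc
  set V := (hA.eigenvectorUnitary : Matrix n n ℂ)
  calc V * diagonal (fun k => g (hA.eigenvalues k)) * star V *
        (V * diagonal (fun k => h (hA.eigenvalues k)) * star V)
      = V * (diagonal (fun k => g (hA.eigenvalues k)) * (star V * V) *
          diagonal (fun k => h (hA.eigenvalues k))) * star V := by simp only [Matrix.mul_assoc]
    _ = _ := by rw [h1, Matrix.mul_one, Matrix.diagonal_mul_diagonal]

lemma fnCalc_congr {g h : ℝ → ℂ} (hgh : ∀ k, g (hA.eigenvalues k) = h (hA.eigenvalues k)) :
    fnCalc hA g = fnCalc hA h := by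
  unfold fnCalc
  simp only [hgh]

lemma fnCalc_add (g h : ℝ → ℂ) : fnCalc hA g + fnCalc hA h = fnCalc hA (fun x => g x + h x) := by
  unfold fnCalc
  rw [← Matrix.add_mul, ← Matrix.mul_add, Matrix.diagonal_add]

lemma fnCalc_smul (c : ℂ) (g : ℝ → ℂ) : c • fnCalc hA g = fnCalc hA (fun x => c * g x) := by
  unfold fnCalc
  rw [← Matrix.smul_mul, ← Matrix.mul_smul, ← Matrix.diagonal_smul]
  rfl

lemma fnCalc_one : fnCalc hA (fun _ => 1) = 1 := by
  unfold fnCalc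
  rw [Matrix.diagonal_one, Matrix.mul_one, eigenvectorUnitary_mul_star hA]

lemma fnCalc_id : fnCalc hA (fun x => (x : ℂ)) = A :=
  (eq_eigenvectorUnitary_mul_diagonal hA).symm

lemma fnCalc_conjTranspose (g : ℝ → ℂ) :
    (fnCalc hA g)ᴴ = fnCalc hA (fun x => star (g x)) := by
  unfold fnCalc
  rw [Matrix.conjTranspose_mul, Matrix.conjTranspose_mul, Matrix.diagonal_conjTranspose,
    Matrix.star_eq_conjTranspose, Matrix.conjTranspose_conjTranspose, Matrix.mul_assoc]
  rfl

lemma norm_fnCalc_le {g : ℝ → ℂ} (hg : ∀ x, ‖g x‖ ≤ 1) : ‖fnCalc hA g‖ ≤ 1 := by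
  have hd : ‖(diagonal (fun k => g (hA.eigenvalues k)) : Matrix n n ℂ)‖ ≤ 1 := by
    rw [Matrix.l2_opNorm_diagonal]
    exact (pi_norm_le_iff_of_nonneg zero_le_one).2 fun k => hg _
  have h1 := norm_eigenvectorUnitary_le hA
  have h2 := norm_star_eigenvectorUnitary_le hA
  unfold fnCalc
  refine (norm_mul_le _ _).trans ?_
  refine mul_le_one₀ ((norm_mul_le _ _).trans ?_) (norm_nonneg _) h2
  exact mul_le_one₀ h1 (norm_nonneg _) hd

/-- The functional calculus acts on eigenvectors (the columns of `M`) through the eigenvalue. -/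
lemma fnCalc_mul_of_mul_eq_smul {E : ℝ} {M : Matrix n n ℂ} (hM : A * M = (E : ℂ) • M)
    (g : ℝ → ℂ) : fnCalc hA g * M = g E • M := by
  have h1 := star_eigenvectorUnitary_mul hA
  have h2 := eigenvectorUnitary_mul_star hA
  have h3 := eq_eigenvectorUnitary_mul_diagonal hA
  unfold fnCalc
  set V := (hA.eigenvectorUnitary : Matrix n n ℂ)
  set D := diagonal (fun k => (hA.eigenvalues k : ℂ)) with hD
  have h4 : D * (star V * M) = (E : ℂ) • (star V * M) := by
    rw [← Matrix.mul_smul, ← hM]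
    conv_rhs => rw [h3]
    calc D * (star V * M) = (star V * V) * (D * (star V * M)) := by rw [h1, Matrix.one_mul]
      _ = _ := by simp only [Matrix.mul_assoc]
  have h5 : diagonal (fun k => g (hA.eigenvalues k)) * (star V * M) = g E • (star V * M) := by
    ext k j
    have h6 := congrFun (congrFun h4 k) j
    rw [hD, Matrix.diagonal_mul, Matrix.smul_apply, smul_eq_mul] at h6
    rw [Matrix.diagonal_mul, Matrix.smul_apply, smul_eq_mul]
    rcases mul_eq_mul_right_iff.1 h6 with h7 | h7
    · rw [Complex.ofReal_inj.1 h7]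
    · rw [h7, mul_zero, mul_zero]
  calc V * diagonal (fun k => g (hA.eigenvalues k)) * star V * M
      = V * (diagonal (fun k => g (hA.eigenvalues k)) * (star V * M)) := by
        simp only [Matrix.mul_assoc]
    _ = g E • ((V * star V) * M) := by rw [h5, Matrix.mul_smul, Matrix.mul_assoc]
    _ = g E • M := by rw [h2, Matrix.one_mul]

/-! ### Quadratic forms and the spectral gap -/

lemma re_star_dotProduct_self_nonneg (x : n → ℂ) : 0 ≤ (star x ⬝ᵥ x).re := by
  rw [dotProduct, Complex.re_sum]
  refine Finset.sum_nonneg fun i _ => ?_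
  rw [Pi.star_apply, RCLike.star_def, Complex.conj_mul', ← Complex.ofReal_pow, Complex.ofReal_re]
  positivity

lemma eq_zero_of_re_star_dotProduct_self_le {x : n → ℂ} (h : (star x ⬝ᵥ x).re ≤ 0) : x = 0 := by
  have h2 : (star x ⬝ᵥ x).re = ∑ i, ‖x i‖ ^ 2 := by
    rw [dotProduct, Complex.re_sum]
    refine Finset.sum_congr rfl fun i _ => ?_
    rw [Pi.star_apply, RCLike.star_def, Complex.conj_mul', ← Complex.ofReal_pow, Complex.ofReal_re]
  have h3 : ∑ i, ‖x i‖ ^ 2 = 0 :=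
    le_antisymm (h2 ▸ h) (Finset.sum_nonneg fun i _ => by positivity)
  rw [Finset.sum_eq_zero_iff_of_nonneg fun i _ => by positivity] at h3
  ext i
  simpa using h3 i (Finset.mem_univ _)

lemma star_mulVec_dotProduct (B C : Matrix n n ℂ) (x y : n → ℂ) :
    star (B *ᵥ x) ⬝ᵥ (C *ᵥ y) = star x ⬝ᵥ ((Bᴴ * C) *ᵥ y) := by
  rw [Matrix.star_mulVec, Matrix.dotProduct_mulVec, Matrix.vecMul_vecMul,
    ← Matrix.dotProduct_mulVec]

lemma re_star_dotProduct_fnCalc_nonneg {g : ℝ → ℝ} (hg : ∀ k, 0 ≤ g (hA.eigenvalues k))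
    (x : n → ℂ) : 0 ≤ (star x ⬝ᵥ (fnCalc hA (fun t => (g t : ℂ)) *ᵥ x)).re := by
  have h : fnCalc hA (fun t => (g t : ℂ)) = (fnCalc hA (fun t => (Real.sqrt (g t) : ℂ)))ᴴ *
      fnCalc hA (fun t => (Real.sqrt (g t) : ℂ)) := by
    rw [fnCalc_conjTranspose, fnCalc_mul]
    refine fnCalc_congr hA fun k => ?_
    rw [RCLike.star_def, Complex.conj_ofReal, ← Complex.ofReal_mul, Real.mul_self_sqrt (hg k)]
  rw [h, ← star_mulVec_dotProduct]
  exact re_star_dotProduct_self_nonneg _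

/-- The lower bound `A ≥ θ (1 - O)` with an orthogonal projection `O` on eigenvectors of
eigenvalue `0` opens a spectral gap. -/
structure HasGap (A O : Matrix n n ℂ) (θ : ℝ) : Prop where
  pos : 0 < θ
  isHermitian : O.IsHermitian
  mul_self : O * O = O
  mul_eq_zero : A * O = 0
  le : ∀ x : n → ℂ, θ * (star x ⬝ᵥ ((1 - O) *ᵥ x)).re ≤ (star x ⬝ᵥ (A *ᵥ x)).re

variable {O : Matrix n n ℂ} {θ : ℝ}

/-- From `O A = 0`, an eigenvector with nonzero eigenvalue is annihilated by `O`; the form bound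
evaluated on it is then `θ ‖x‖² ≤ E ‖x‖²`. -/
lemma HasGap.eigenvalues_eq_zero_or_le (h : HasGap A O θ) (k : n) :
    hA.eigenvalues k = 0 ∨ θ ≤ hA.eigenvalues k := by
  by_cases h0 : hA.eigenvalues k = 0
  · exact Or.inl h0
  right
  have hx := hA.mulVec_eigenvectorBasis k
  have hne : (hA.eigenvectorBasis k).ofLp ≠ 0 := by
    intro h1
    exact hA.eigenvectorBasis.orthonormal.ne_zero k ((WithLp.ofLp_eq_zero 2).1 h1)
  set x : n → ℂ := (hA.eigenvectorBasis k).ofLp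
  set E := hA.eigenvalues k
  have hx' : A *ᵥ x = (E : ℂ) • x := by rw [hx]; ext i; simp
  have hOA : O * A = 0 := by
    have := congrArg conjTranspose h.mul_eq_zero
    rwa [Matrix.conjTranspose_mul, hA.eq, h.isHermitian.eq, Matrix.conjTranspose_zero] at this
  have hOx : O *ᵥ x = 0 := by
    have h1 : (E : ℂ) • (O *ᵥ x) = 0 := by
      rw [← Matrix.mulVec_smul, ← hx', Matrix.mulVec_mulVec, hOA, Matrix.zero_mulVec]
    exact (smul_eq_zero.1 h1).resolve_left (by exact_mod_cast h0)
  have h2 := h.le x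
  rw [Matrix.sub_mulVec, hOx, sub_zero, Matrix.one_mulVec, hx', dotProduct_smul, smul_eq_mul,
    Complex.re_ofReal_mul] at h2
  have h3 : 0 < (star x ⬝ᵥ x).re := by
    by_contra h4
    exact hne (eq_zero_of_re_star_dotProduct_self_le (not_lt.1 h4))
  exact le_of_mul_le_mul_right h2 h3

/-- The range of `O` consists of null vectors of `A`, which gives `F O = O`. Conversely the form
bound on the kernel of `A` forces `(1 - O) F = 0`. Taking adjoints identifies the two projections.
-/
lemma HasGap.fnCalc_indicator_zero (h : HasGap A O θ) :
    fnCalc hA (({0} : Set ℝ).indicator 1) = O := by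
  set F := fnCalc hA (({0} : Set ℝ).indicator 1) with hF
  have hFO : F * O = O := by
    rw [hF, fnCalc_mul_of_mul_eq_smul hA (E := 0) (by simpa using h.mul_eq_zero)]
    simp
  have hFs : Fᴴ = F := by
    rw [hF, fnCalc_conjTranspose]
    refine fnCalc_congr hA fun k => ?_
    by_cases hk : hA.eigenvalues k = 0 <;> simp [hk]
  have hAF : A * F = 0 := by
    conv_lhs => rw [← fnCalc_id hA, hF, fnCalc_mul]
    have : fnCalc hA (fun x => (x : ℂ) * ({0} : Set ℝ).indicator 1 x) =
        fnCalc hA (fun _ => 0) := by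
      refine fnCalc_congr hA fun k => ?_
      by_cases hk : hA.eigenvalues k = 0 <;> simp [hk]
    rw [this]
    unfold fnCalc
    simp
  have hproj : (1 - O)ᴴ * (1 - O) = 1 - O := by
    rw [Matrix.conjTranspose_sub, h.isHermitian.eq, Matrix.conjTranspose_one, Matrix.mul_sub,
      Matrix.sub_mul, Matrix.sub_mul, h.mul_self]
    simp
  have hzero : (1 - O) * F = 0 := by
    refine Matrix.ext_of_mulVec_single fun i => ?_
    set x : n → ℂ := Pi.single i 1
    rw [Matrix.zero_mulVec, ← Matrix.mulVec_mulVec]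
    refine eq_zero_of_re_star_dotProduct_self_le ?_
    rw [star_mulVec_dotProduct, hproj]
    have h1 := h.le (F *ᵥ x)
    rw [Matrix.mulVec_mulVec (M := A), hAF, Matrix.zero_mulVec, dotProduct_zero,
      Complex.zero_re] at h1
    have := h.pos
    exact nonpos_of_mul_nonpos_right h1 this
  rw [Matrix.sub_mul, Matrix.one_mul, sub_eq_zero] at hzero
  have h4 := congrArg conjTranspose hFO
  rw [Matrix.conjTranspose_mul, hFs, h.isHermitian.eq] at h4
  rw [hzero, h4]

end FnCalc

end XXZ

namespace XXZ

open scoped Matrix.Norms.L2Operator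

/-! ### Measurability of the functional calculus -/

section Measurability

variable {n : Type*} [Fintype n] [DecidableEq n] {Ω : Type*} [MeasurableSpace Ω]

/-- Entrywise measurability of a random matrix. -/
def EntryMeasurable (M : Ω → Matrix n n ℂ) : Prop := ∀ i j, Measurable fun w => M w i j

lemma EntryMeasurable.const (M : Matrix n n ℂ) : EntryMeasurable fun _ : Ω => M :=
  fun _ _ => measurable_const

lemma EntryMeasurable.add {M N : Ω → Matrix n n ℂ} (hM : EntryMeasurable M)
    (hN : EntryMeasurable N) : EntryMeasurable fun w => M w + N w :=
  fun i j => (hM i j).add (hN i j)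

lemma EntryMeasurable.mul {M N : Ω → Matrix n n ℂ} (hM : EntryMeasurable M)
    (hN : EntryMeasurable N) : EntryMeasurable fun w => M w * N w := by
  intro i j
  simp only [Matrix.mul_apply]
  exact Finset.measurable_sum _ fun k _ => (hM i k).mul (hN k j)

lemma EntryMeasurable.smul {c : Ω → ℂ} (hc : Measurable c) {M : Ω → Matrix n n ℂ}
    (hM : EntryMeasurable M) : EntryMeasurable fun w => c w • M w :=
  fun i j => hc.mul (hM i j)

lemma EntryMeasurable.sum {ι : Type*} (s : Finset ι) {M : ι → Ω → Matrix n n ℂ}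
    (hM : ∀ i, EntryMeasurable (M i)) : EntryMeasurable fun w => ∑ i ∈ s, M i w := by
  intro k l
  simp only [Matrix.sum_apply]
  exact Finset.measurable_sum _ fun i _ => hM i k l

lemma EntryMeasurable.traceNorm {M : Ω → Matrix n n ℂ} (hM : EntryMeasurable M) :
    Measurable fun w => traceNorm (M w) := by
  have h : Continuous fun f : n → n → ℂ => XXZ.traceNorm (Matrix.of f) := continuous_traceNorm
  exact h.measurable.comp (measurable_pi_iff.2 fun i => measurable_pi_iff.2 fun j => hM i j)

lemma fnCalc_apply {A : Matrix n n ℂ} (hA : A.IsHermitian) (g : ℝ → ℂ) (i j : n) :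
    fnCalc hA g i j = ∑ k, (hA.eigenvectorUnitary : Matrix n n ℂ) i k * g (hA.eigenvalues k) *
      star (hA.eigenvectorUnitary : Matrix n n ℂ) k j := by
  unfold fnCalc
  rw [Matrix.mul_apply]
  simp only [Matrix.mul_diagonal]

/-- Only finitely many eigenvalues enter, so pointwise convergence of the functions is enough. -/
lemma tendsto_fnCalc_apply {A : Matrix n n ℂ} (hA : A.IsHermitian) {ι : Type*} {l : Filter ι}
    {f : ι → ℝ → ℂ} {g : ℝ → ℂ} (hfg : ∀ x, Tendsto (fun k => f k x) l (𝓝 (g x))) (i j : n) :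
    Tendsto (fun k => fnCalc hA (f k) i j) l (𝓝 (fnCalc hA g i j)) := by
  simp only [fnCalc_apply]
  exact tendsto_finsetSum _ fun k _ => ((hfg _).const_mul _).mul_const _

variable {A : Ω → Matrix n n ℂ} (hA : ∀ w, (A w).IsHermitian)

lemma EntryMeasurable.fnCalc_of_tendsto {f : ℕ → ℝ → ℂ} {g : ℝ → ℂ}
    (hf : ∀ k, EntryMeasurable fun w => fnCalc (hA w) (f k))
    (hfg : ∀ x, Tendsto (fun k => f k x) atTop (𝓝 (g x))) :
    EntryMeasurable fun w => fnCalc (hA w) g :=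
  fun i j => measurable_of_tendsto_metrizable (fun k => hf k i j)
    (tendsto_pi_nhds.2 fun w => tendsto_fnCalc_apply (hA w) hfg i j)

lemma EntryMeasurable.fnCalc_mul {f g : ℝ → ℂ}
    (hf : EntryMeasurable fun w => fnCalc (hA w) f)
    (hg : EntryMeasurable fun w => fnCalc (hA w) g) :
    EntryMeasurable fun w => fnCalc (hA w) (fun x => f x * g x) := by
  simp only [← XXZ.fnCalc_mul]
  exact hf.mul hg

variable (hAm : EntryMeasurable A)
include hAm

/-- The eigenbasis is an arbitrary choice for each matrix, so measurability cannot be read off the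
spectral decomposition. Instead it is obtained for polynomials, whose values are polynomial in the
entries, and then passed to continuous functions and to indicators by pointwise limits. -/
lemma EntryMeasurable.fnCalc_polynomial (q : Polynomial ℝ) :
    EntryMeasurable fun w => fnCalc (hA w) (fun x => ((q.eval x : ℝ) : ℂ)) := by
  have hid : EntryMeasurable fun w => fnCalc (hA w) (fun x => (x : ℂ)) := by
    simp only [fnCalc_id]; exact hAm
  have hC : ∀ a : ℝ, EntryMeasurable fun w => fnCalc (hA w) (fun _ => (a : ℂ)) := by
    intro a
    have : ∀ w, fnCalc (hA w) (fun _ => (a : ℂ)) = (a : ℂ) • 1 := fun w => by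
      rw [← fnCalc_one (hA w), fnCalc_smul]; simp
    simp only [this]
    exact EntryMeasurable.const _
  induction q using Polynomial.induction_on with
  | C a => simpa using hC a
  | add p q hp hq =>
    simp only [Polynomial.eval_add, Complex.ofReal_add, ← fnCalc_add]
    exact hp.add hq
  | monomial k a h =>
    have := EntryMeasurable.fnCalc_mul hA h hid
    convert this using 4 with w x
    simp only [Polynomial.eval_mul, Polynomial.eval_C, Polynomial.eval_pow, Polynomial.eval_X,
      Complex.ofReal_mul, Complex.ofReal_pow, pow_succ]
    ring

lemma EntryMeasurable.fnCalc_of_continuous {g : ℝ → ℝ} (hg : Continuous g) :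
    EntryMeasurable fun w => fnCalc (hA w) (fun x => (g x : ℂ)) := by
  -- Weierstrass approximation on intervals that exhaust the line, with errors tending to zero,
  -- yields pointwise convergence everywhere.
  have h : ∀ k : ℕ, ∃ q : Polynomial ℝ, ∀ x ∈ Set.Icc (-(k : ℝ)) k,
      |q.eval x - g x| < 1 / ((k : ℝ) + 1) := fun k =>
    exists_polynomial_near_of_continuousOn _ _ g hg.continuousOn _ (by positivity)
  choose q hq using h
  refine EntryMeasurable.fnCalc_of_tendsto hA
    (fun k => EntryMeasurable.fnCalc_polynomial hA hAm (q k)) fun x => ?_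
  refine (Complex.continuous_ofReal.tendsto _).comp ?_
  rw [tendsto_iff_norm_sub_tendsto_zero]
  refine squeeze_zero' (Eventually.of_forall fun k => norm_nonneg _) ?_
    tendsto_one_div_add_atTop_nhds_zero_nat
  obtain ⟨N, hN⟩ := exists_nat_ge |x|
  filter_upwards [eventually_ge_atTop N] with k hk
  refine (hq k x ?_).le
  have : |x| ≤ k := hN.trans (by exact_mod_cast hk)
  exact ⟨(abs_le.1 this).1, (abs_le.1 this).2⟩

lemma EntryMeasurable.fnCalc_indicator_Icc (a b : ℝ) :
    EntryMeasurable fun w => fnCalc (hA w) ((Set.Icc a b).indicator 1) := by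
  -- Truncated ramps `1 - k dist(x, [a, b])`: equal to one on the interval and eventually zero at
  -- each point outside it.
  set f : ℕ → ℝ → ℝ := fun k x => max 0 (1 - k * (max (a - x) 0 + max (x - b) 0)) with hf
  have hfc : ∀ k, Continuous (f k) := fun k => by simp only [hf]; fun_prop
  refine EntryMeasurable.fnCalc_of_tendsto hA
    (fun k => EntryMeasurable.fnCalc_of_continuous hA hAm (hfc k)) fun x => ?_
  by_cases hx : x ∈ Set.Icc a b
  · have : ∀ k, f k x = 1 := fun k => by
      simp [hf, hx.1, hx.2]
    simp [this, hx]
  · have hpos : 0 < max (a - x) 0 + max (x - b) 0 := by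
      rcases lt_or_ge x a with h | h
      · have := le_max_left (a - x) 0
        have := le_max_right (x - b) 0
        linarith
      · have : b < x := not_le.1 fun h' => hx ⟨h, h'⟩
        have := le_max_left (x - b) 0
        have := le_max_right (a - x) 0
        linarith
    obtain ⟨N, hN⟩ := exists_nat_ge (1 / (max (a - x) 0 + max (x - b) 0))
    rw [Set.indicator_of_notMem hx]
    refine tendsto_const_nhds.congr' ?_
    filter_upwards [eventually_ge_atTop N] with k hk
    have h1 : (1 : ℝ) ≤ k * (max (a - x) 0 + max (x - b) 0) := by
      rw [← div_le_iff₀ hpos]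
      exact hN.trans (by exact_mod_cast hk)
    simp only [hf]
    rw [max_eq_left (by linarith), Complex.ofReal_zero]

lemma EntryMeasurable.fnCalc_exp (t : ℝ) :
    EntryMeasurable fun w => fnCalc (hA w) (fun x => Complex.exp (Complex.I * t * x)) := by
  have h1 := EntryMeasurable.fnCalc_of_continuous hA hAm (g := fun x => Real.cos (t * x))
    (by fun_prop)
  have h2 := EntryMeasurable.fnCalc_of_continuous hA hAm (g := fun x => Real.sin (t * x))
    (by fun_prop)
  have h3 : ∀ w, fnCalc (hA w) (fun x => Complex.exp (Complex.I * t * x)) =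
      fnCalc (hA w) (fun x => ((Real.cos (t * x) : ℝ) : ℂ)) +
        Complex.I • fnCalc (hA w) (fun x => ((Real.sin (t * x) : ℝ) : ℂ)) := by
    intro w
    rw [fnCalc_smul, fnCalc_add]
    refine fnCalc_congr _ fun k => ?_
    rw [mul_assoc, mul_comm Complex.I, Complex.exp_mul_I]
    push_cast
    ring
  simp only [h3]
  exact h1.add (EntryMeasurable.smul measurable_const h2)

end Measurability

/-! ### The random Hamiltonian and its correlations in an energy window -/

lemma entryMeasurable_ham {Ω : Type*} [MeasurableSpace Ω] {ω : ℤ → Ω → ℝ}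
    (hω : ∀ i, Measurable (ω i)) (p : Params) (L : ℕ) :
    EntryMeasurable fun w => ham p L fun k => ω k w := by
  unfold ham
  refine ((EntryMeasurable.const _).add (EntryMeasurable.smul measurable_const ?_)).add
    (EntryMeasurable.const _)
  exact EntryMeasurable.sum _ fun i => EntryMeasurable.smul
    (Complex.measurable_ofReal.comp (hω _)) (EntryMeasurable.const _)

/-- The evolution `e^{itH} χ_B(H)` within the energy window `B`. -/
noncomputable def winEvol (p : Params) (L : ℕ) (v : ℤ → ℝ) (B : Set ℝ) (t : ℝ) : Op L :=
  hamFn p L v (fun x => B.indicator 1 x * Complex.exp (Complex.I * t * x))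

lemma entryMeasurable_winEvol {Ω : Type*} [MeasurableSpace Ω] {ω : ℤ → Ω → ℝ}
    (hω : ∀ i, Measurable (ω i)) (p : Params) (L : ℕ) (a b t : ℝ) :
    EntryMeasurable fun w => winEvol p L (fun k => ω k w) (Set.Icc a b) t := by
  have hA := fun w => ham_isHermitian p L fun k => ω k w
  have hm := entryMeasurable_ham hω p L
  have h1 := EntryMeasurable.fnCalc_indicator_Icc hA hm a b
  have h2 := EntryMeasurable.fnCalc_exp hA hm t
  have h3 := EntryMeasurable.fnCalc_mul hA h1 h2
  intro i j
  exact h3 i j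

/-- `sup_t ‖𝒩ᵢ e^{itH} χ_B(H) 𝒩ⱼ‖₁`. -/
noncomputable def corr (p : Params) (L : ℕ) (v : ℤ → ℝ) (B : Set ℝ) (i j : Site L) : ℝ≥0∞ :=
  ⨆ t : ℝ, ENNReal.ofReal (traceNorm (numOp i * winEvol p L v B t * numOp j))

lemma continuous_traceNorm_winEvol (p : Params) (L : ℕ) (v : ℤ → ℝ) (B : Set ℝ) (i j : Site L) :
    Continuous fun t => traceNorm (numOp i * winEvol p L v B t * numOp j) := by
  have h : Continuous fun t => winEvol p L v B t := by
    refine continuous_matrix fun k l => continuous_iff_continuousAt.2 fun t => ?_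
    exact tendsto_fnCalc_apply (ham_isHermitian p L v)
      (f := fun t x => B.indicator 1 x * Complex.exp (Complex.I * (t : ℝ) * x))
      (fun x => Continuous.tendsto (by fun_prop) t) k l
  have h2 : Continuous fun t => numOp i * winEvol p L v B t * numOp j :=
    (continuous_const.matrix_mul h).matrix_mul continuous_const
  exact continuous_traceNorm.comp h2

/-- By continuity in `t` the supremum may be taken over rational times, hence is countable. -/
lemma measurable_corr {Ω : Type*} [MeasurableSpace Ω] {ω : ℤ → Ω → ℝ}
    (hω : ∀ i, Measurable (ω i)) (p : Params) (L : ℕ) (a b : ℝ) (i j : Site L) :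
    Measurable fun w => corr p L (fun k => ω k w) (Set.Icc a b) i j := by
  have h : ∀ w, corr p L (fun k => ω k w) (Set.Icc a b) i j = ⨆ q : ℚ, ENNReal.ofReal
      (traceNorm (numOp i * winEvol p L (fun k => ω k w) (Set.Icc a b) q * numOp j)) := by
    intro w
    refine le_antisymm (iSup_le fun t => ?_) (iSup_le fun q => le_iSup_of_le (q : ℝ) le_rfl)
    have hc := ENNReal.continuous_ofReal.comp
      (continuous_traceNorm_winEvol p L (fun k => ω k w) (Set.Icc a b) i j)
    refine Rat.denseRange_cast.induction_on t (isClosed_le hc continuous_const) fun q => ?_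
    exact le_iSup (fun q : ℚ => ENNReal.ofReal
      (traceNorm (numOp i * winEvol p L (fun k => ω k w) (Set.Icc a b) q * numOp j))) q
  simp only [h]
  refine Measurable.iSup fun q => ENNReal.measurable_ofReal.comp (EntryMeasurable.traceNorm ?_)
  exact ((EntryMeasurable.const _).mul (entryMeasurable_winEvol hω p L a b q)).mul
    (EntryMeasurable.const _)

lemma mem_borelClass_winEvol (a b t : ℝ) :
    (fun x : ℝ => (Set.Icc a b).indicator (1 : ℝ → ℂ) x * Complex.exp (Complex.I * t * x)) ∈
      borelClass (Set.Icc a b) := by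
  refine ⟨(measurable_const.indicator measurableSet_Icc).mul (by fun_prop), fun x => ?_⟩
  have h : ‖Complex.exp (Complex.I * t * x)‖ = 1 := by
    rw [mul_assoc, ← Complex.ofReal_mul, Complex.norm_exp_I_mul_ofReal]
  by_cases hx : x ∈ Set.Icc a b <;> simp [hx, h]

/-- Property DL is used only for the functions `χ_I(x) e^{itx}`. Their supremum is measurable, so
that expectations of sums can be split, whereas nothing is claimed about measurability of the
supremum over all Borel functions. -/
lemma corr_le (p : Params) (L : ℕ) (v : ℤ → ℝ) (a b : ℝ) (i j : Site L) :
    corr p L v (Set.Icc a b) i j ≤ ⨆ g ∈ borelClass (Set.Icc a b),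
      ENNReal.ofReal (traceNorm (numOp i * hamFn p L v g * numOp j)) :=
  iSup_le fun t => le_iSup₂_of_le _ (mem_borelClass_winEvol a b t) le_rfl

lemma PropertyDL.lintegral_corr_le {p : Params} {Ω : Type*} [MeasurableSpace Ω] {P : Measure Ω}
    {ω : ℤ → Ω → ℝ} {Θ₁ C m : ℝ} (h : PropertyDL p P ω Θ₁ C m) (L : ℕ) (i j : Site L) :
    ∫⁻ w, corr p L (fun k => ω k w) (Set.Icc p.Θ₀ Θ₁) i j ∂P
      ≤ ENNReal.ofReal (|C| * Real.exp (-m * |((i.1 - j.1 : ℤ) : ℝ)|)) := by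
  refine (lintegral_mono fun w => corr_le p L _ _ _ i j).trans ((h.bound L i j).trans ?_)
  exact ENNReal.ofReal_le_ofReal (mul_le_mul_of_nonneg_right (le_abs_self C) (Real.exp_nonneg _))

end XXZ

namespace XXZ

open scoped Matrix.Norms.L2Operator

/-! ### Spin-down projections -/

section DownProj

variable {L : ℕ}

lemma norm_diagonal_le_one {f : Config L → ℂ} (hf : ∀ s, ‖f s‖ ≤ 1) :
    ‖(diagonal f : Op L)‖ ≤ 1 := by
  rw [Matrix.l2_opNorm_diagonal]
  exact (pi_norm_le_iff_of_nonneg zero_le_one).2 hf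

lemma siteOp_pauliZ (i : Site L) :
    siteOp i pauliZ = diagonal fun s : Config L => if s i = 1 then (-1 : ℂ) else 1 := by
  ext s s'
  rw [siteOp, Matrix.of_apply, Matrix.diagonal_apply]
  by_cases h : s = s'
  · subst h
    have : ∀ a : Fin 2, pauliZ a a = if a = 1 then -1 else 1 := by
      intro a; fin_cases a <;> simp [pauliZ]
    simp [this]
  · rw [if_neg h]
    split_ifs with h1
    · have : s i ≠ s' i := fun h2 => h <| funext fun k => by
        by_cases hk : k = i
        · rw [hk, h2]
        · exact h1 k hk
      generalize s i = a at this
      generalize s' i = b at this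
      fin_cases a <;> fin_cases b <;> simp_all [pauliZ]
    · rfl

lemma numOp_eq_diagonal (i : Site L) :
    numOp i = diagonal fun s : Config L => if s i = 1 then (1 : ℂ) else 0 := by
  rw [numOp, siteOp_pauliZ, ← Matrix.diagonal_one, Matrix.diagonal_sub, ← Matrix.diagonal_smul]
  congr 1
  ext s
  rw [Pi.smul_apply]
  split_ifs <;> norm_num

open scoped Classical in
/-- The projection onto the configurations with a spin down in `S`. -/
noncomputable def downProj (L : ℕ) (S : Set ℤ) : Op L :=
  diagonal fun s => if ∃ i : Site L, i.1 ∈ S ∧ s i = 1 then 1 else 0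

open scoped Classical in
lemma one_sub_downProj (S : Set ℤ) : 1 - downProj L S =
    diagonal fun s => if ∃ i : Site L, i.1 ∈ S ∧ s i = 1 then (0 : ℂ) else 1 := by
  rw [downProj, ← Matrix.diagonal_one, Matrix.diagonal_sub]
  congr 1
  ext s
  split_ifs <;> simp

lemma norm_downProj_le (S : Set ℤ) : ‖downProj L S‖ ≤ 1 :=
  norm_diagonal_le_one fun s => by split_ifs <;> simp

lemma norm_one_sub_downProj_le (S : Set ℤ) : ‖1 - downProj L S‖ ≤ 1 := by
  rw [one_sub_downProj]
  exact norm_diagonal_le_one fun s => by split_ifs <;> simp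

lemma downProj_conjTranspose (S : Set ℤ) : (downProj L S)ᴴ = downProj L S := by
  rw [downProj, Matrix.diagonal_conjTranspose]
  congr 1
  ext s
  simp only [Pi.star_apply]
  split_ifs <;> simp

lemma downProj_mul_comm (S T : Set ℤ) :
    downProj L S * downProj L T = downProj L T * downProj L S := by
  simp only [downProj, Matrix.diagonal_mul_diagonal, mul_comm]

lemma downProj_mul_self (S : Set ℤ) : downProj L S * downProj L S = downProj L S := by
  simp only [downProj, Matrix.diagonal_mul_diagonal]
  congr 1
  ext s
  split_ifs <;> simp

/-- All spins up on the larger set implies all spins up on the smaller one. -/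
lemma one_sub_downProj_mul_of_subset {S T : Set ℤ} (h : S ⊆ T) :
    (1 - downProj L S) * (1 - downProj L T) = 1 - downProj L T := by
  simp only [one_sub_downProj, Matrix.diagonal_mul_diagonal]
  congr 1
  ext s
  by_cases h1 : ∃ i : Site L, i.1 ∈ S ∧ s i = 1
  · have h2 : ∃ i : Site L, i.1 ∈ T ∧ s i = 1 := by
      obtain ⟨i, hi, h3⟩ := h1
      exact ⟨i, h hi, h3⟩
    simp [h1, h2]
  · simp [h1]

/-- The projection onto the all-spins-up vector. -/
noncomputable def vacProj (L : ℕ) : Op L := 1 - downProj L Set.univ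

lemma vacProj_eq_diagonal :
    vacProj L = diagonal fun s : Config L => if s = 0 then (1 : ℂ) else 0 := by
  rw [vacProj, one_sub_downProj]
  congr 1
  ext s
  by_cases hs : s = 0
  · simp [hs]
  · have : ∃ i : Site L, i.1 ∈ Set.univ ∧ s i = 1 := by
      by_contra h
      push Not at h
      exact hs <| funext fun i => by
        have := h i (Set.mem_univ _)
        simp only [Pi.zero_apply]
        omega
    rw [if_pos this, if_neg hs]

lemma one_sub_downProj_mul_compl (S : Set ℤ) :
    (1 - downProj L S) * (1 - downProj L Sᶜ) = vacProj L := by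
  simp only [vacProj, one_sub_downProj, Matrix.diagonal_mul_diagonal]
  congr 1
  ext s
  by_cases h : ∃ i : Site L, i.1 ∈ Set.univ ∧ s i = 1
  · rw [if_pos h]
    obtain ⟨i, -, hi⟩ := h
    by_cases hS : i.1 ∈ S
    · rw [if_pos ⟨i, hS, hi⟩, zero_mul]
    · rw [if_pos (c := ∃ i : Site L, i.1 ∈ Sᶜ ∧ s i = 1) ⟨i, hS, hi⟩, mul_zero]
  · rw [if_neg h, if_neg, if_neg, mul_one]
    · rintro ⟨i, -, hi⟩; exact h ⟨i, Set.mem_univ _, hi⟩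
    · rintro ⟨i, -, hi⟩; exact h ⟨i, Set.mem_univ _, hi⟩

open scoped Classical in
/-- The sites of the chain that lie in `S`. -/
noncomputable def sitesIn (L : ℕ) (S : Set ℤ) : Finset (Site L) := Finset.univ.filter fun i => i.1 ∈ S

@[simp] lemma mem_sitesIn {S : Set ℤ} {i : Site L} : i ∈ sitesIn L S ↔ i.1 ∈ S := by
  simp [sitesIn]

open scoped Classical in
-- `W` divides by the number of down spins in `S`, with `0⁻¹ = 0` when there are none. This converts
-- region projections into sums of site operators, the objects that Property DL bounds, without cost
-- in norm.
lemma exists_downProj_eq_mul_sum (S : Set ℤ) : ∃ W : Op L, ‖W‖ ≤ 1 ∧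
    downProj L S = W * ∑ i ∈ sitesIn L S, numOp i ∧
    downProj L S = (∑ i ∈ sitesIn L S, numOp i) * W := by
  have hsum : (∑ i ∈ sitesIn L S, numOp i : Op L) =
      diagonal fun s : Config L => (((sitesIn L S).filter fun i => s i = 1).card : ℂ) := by
    simp only [numOp_eq_diagonal]
    ext s s'
    rw [Matrix.sum_apply]
    by_cases h : s = s'
    · subst h
      simp [Matrix.diagonal_apply_eq]
    · simp [Matrix.diagonal_apply_ne _ h]
  have key : ∀ s : Config L, (((sitesIn L S).filter fun i => s i = 1).card : ℂ)⁻¹ *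
      (((sitesIn L S).filter fun i => s i = 1).card : ℂ) =
      (if ∃ i : Site L, i.1 ∈ S ∧ s i = 1 then 1 else 0) := by
    intro s
    split_ifs with h
    · obtain ⟨i, hi, hs⟩ := h
      refine inv_mul_cancel₀ ?_
      exact_mod_cast (Finset.card_pos.2 ⟨i, by simp [hi, hs]⟩).ne'
    · have : (sitesIn L S).filter (fun i => s i = 1) = ∅ := by
        ext i
        simp only [Finset.mem_filter, mem_sitesIn, Finset.notMem_empty, iff_false]
        exact fun h1 => h ⟨i, h1⟩
      simp [this]
  refine ⟨diagonal fun s => (((sitesIn L S).filter fun i => s i = 1).card : ℂ)⁻¹,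
    norm_diagonal_le_one fun s => ?_, ?_, ?_⟩
  · rw [norm_inv, Complex.norm_natCast]
    exact Nat.cast_inv_le_one _
  · rw [hsum, Matrix.diagonal_mul_diagonal, downProj]
    congr 1
    ext s
    rw [key]
  · rw [hsum, Matrix.diagonal_mul_diagonal, downProj]
    congr 1
    ext s
    rw [mul_comm, key]

lemma traceNorm_mul_downProj_le (M : Op L) (S : Set ℤ) :
    traceNorm (M * downProj L S) ≤ ∑ i ∈ sitesIn L S, traceNorm (M * numOp i) := by
  obtain ⟨W, hW, -, h⟩ := exists_downProj_eq_mul_sum (L := L) S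
  rw [h, ← Matrix.mul_assoc, Matrix.mul_sum]
  refine (traceNorm_mul_le_mul_norm _ _).trans ?_
  exact (mul_le_of_le_one_right (traceNorm_nonneg _) hW).trans (traceNorm_sum_le _ _)

lemma traceNorm_downProj_mul_le (M : Op L) (S : Set ℤ) :
    traceNorm (downProj L S * M) ≤ ∑ i ∈ sitesIn L S, traceNorm (numOp i * M) := by
  obtain ⟨W, hW, h, -⟩ := exists_downProj_eq_mul_sum (L := L) S
  rw [h, Matrix.mul_assoc, Matrix.sum_mul]
  refine (traceNorm_mul_le_norm_mul _ _).trans ?_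
  exact (mul_le_of_le_one_left (traceNorm_nonneg _) hW).trans (traceNorm_sum_le _ _)

lemma traceNorm_downProj_mul_downProj_le (M : Op L) (S T : Set ℤ) :
    traceNorm (downProj L S * M * downProj L T) ≤
      ∑ i ∈ sitesIn L S, ∑ j ∈ sitesIn L T, traceNorm (numOp i * M * numOp j) := by
  rw [Matrix.mul_assoc]
  refine (traceNorm_downProj_mul_le _ _).trans (Finset.sum_le_sum fun i _ => ?_)
  rw [← Matrix.mul_assoc]
  exact traceNorm_mul_downProj_le _ _

end DownProj

/-! ### Centered local observables -/

section Local

variable {L : ℕ}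

/-- An operator supported in the interval `[lo, hi]` whose diagonal part on the local all-spins-up
state vanishes. -/
structure IsCentered (A : Op L) (lo hi : ℤ) : Prop where
  comm : ∀ T : Set ℤ, (∀ i ∈ T, i < lo ∨ hi < i) → downProj L T * A = A * downProj L T
  up_up : ∀ S : Set ℤ, Set.Icc lo hi ⊆ S → (1 - downProj L S) * A * (1 - downProj L S) = 0

/-- The expectation of a local observable in the local all-spins-up state. -/
def LocalObs.vacExp (X : LocalObs L) : ℂ := X.core 0 0

/-- The local observable with its vacuum expectation subtracted. -/
noncomputable def LocalObs.centered (X : LocalObs L) : Op L := X.op - X.vacExp • 1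

lemma LocalObs.op_eq (X : LocalObs L) : X.op = X.centered + X.vacExp • 1 := by
  rw [LocalObs.centered, sub_add_cancel]

lemma LocalObs.op_vac (X : LocalObs L) : X.op 0 0 = X.vacExp := by
  simp [LocalObs.op, LocalObs.vacExp]
  rfl

lemma LocalObs.norm_nonneg (X : LocalObs L) : 0 ≤ X.norm := by
  rw [LocalObs.norm, opNorm_eq_norm]; exact _root_.norm_nonneg _

lemma LocalObs.norm_centered_le (X : LocalObs L) : ‖X.centered‖ ≤ 2 * X.norm := by
  have h1 : ‖X.vacExp‖ ≤ X.norm := by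
    rw [← X.op_vac]; exact norm_apply_le_norm _ _ _
  have h2 : ‖X.vacExp • (1 : Op L)‖ ≤ X.norm := by
    rw [norm_smul]
    exact (mul_le_of_le_one_right (_root_.norm_nonneg _) norm_one_matrix_le).trans h1
  calc ‖X.centered‖ ≤ ‖X.op‖ + ‖X.vacExp • (1 : Op L)‖ := norm_sub_le _ _
    _ ≤ X.norm + X.norm := add_le_add le_rfl h2
    _ = 2 * X.norm := by ring

/-- Matrix elements of a local observable vanish unless the configurations agree off the support,
whence the commutation. Between configurations that are up on the support only the entry `core 0 0`
on the diagonal can survive, and this is what was subtracted. -/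
lemma LocalObs.isCentered (X : LocalObs L) : IsCentered X.centered X.lo X.hi := by
  classical
  refine ⟨fun T hT => ?_, fun S hS => ?_⟩
  · suffices h : downProj L T * X.op = X.op * downProj L T by
      rw [LocalObs.centered, Matrix.mul_sub, Matrix.sub_mul, h, Matrix.mul_smul, Matrix.smul_mul,
        Matrix.mul_one, Matrix.one_mul]
    ext s s'
    rw [downProj, Matrix.diagonal_mul, Matrix.mul_diagonal, LocalObs.op, Matrix.of_apply]
    split_ifs with h1 h2 h3 h3 <;> simp only [mul_one, mul_zero, zero_mul, one_mul]
    · exfalso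
      obtain ⟨i, hi, hs⟩ := h1
      refine h3 ⟨i, hi, ?_⟩
      rw [← h2 i (by rcases hT _ hi with h | h <;> omega), hs]
    · exfalso
      obtain ⟨i, hi, hs⟩ := ‹∃ i : Site L, i.1 ∈ T ∧ s' i = 1›
      refine h1 ⟨i, hi, ?_⟩
      rw [‹∀ k : Site L, ¬ (X.lo ≤ k.1 ∧ k.1 ≤ X.hi) → s k = s' k› i
        (by rcases hT _ hi with h | h <;> omega), hs]
  · ext s s'
    rw [one_sub_downProj, Matrix.mul_diagonal, Matrix.diagonal_mul, Matrix.zero_apply]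
    split_ifs with h1 h2 h2 <;> simp only [mul_one, mul_zero, zero_mul, one_mul]
    have hup : ∀ s : Config L, (¬ ∃ i : Site L, i.1 ∈ S ∧ s i = 1) →
        ∀ i : Site L, X.lo ≤ i.1 ∧ i.1 ≤ X.hi → s i = 0 := by
      intro s hs i hi
      have : ¬ s i = 1 := fun h => hs ⟨i, hS hi, h⟩
      omega
    rw [LocalObs.centered, Matrix.sub_apply, Matrix.smul_apply, Matrix.one_apply, LocalObs.op,
      Matrix.of_apply]
    by_cases h3 : s = s'
    · subst h3
      have : (fun i : {i : Site L // X.lo ≤ i.1 ∧ i.1 ≤ X.hi} => s i.1) = 0 :=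
        funext fun i => hup s h1 i.1 i.2
      simp [this, LocalObs.vacExp]
    · rw [if_neg h3, if_neg]
      · simp
      · intro h4
        refine h3 (funext fun k => ?_)
        by_cases hk : X.lo ≤ k.1 ∧ k.1 ≤ X.hi
        · rw [hup s h1 k hk, hup s' h2 k hk]
        · exact h4 k hk

/-! ### Decoupling of distant centered observables -/

variable {A B Q U : Op L} {lo hi lo' hi' : ℤ}

/-- If all spins off `T` are up and the state has no vacuum component, some spin in `T` is down. `A`
preserves this, because its support misses `T`; being centered and applied to spins that are up on
`S`, it also produces a down spin in `S`. -/
lemma IsCentered.mul_one_sub_downProj (hA : IsCentered A lo hi) {S T : Set ℤ}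
    (hS : Set.Icc lo hi ⊆ S) (hST : ∀ i ∈ T, i ∉ S) {M : Op L} (hM : vacProj L * M = 0) :
    A * (1 - downProj L Tᶜ) * M =
      downProj L S * downProj L T * (A * (1 - downProj L Tᶜ) * M) := by
  have h1 : (1 - downProj L Tᶜ) * M = downProj L T * ((1 - downProj L Tᶜ) * M) := by
    have h2 : (1 - downProj L T) * ((1 - downProj L Tᶜ) * M) = 0 := by
      rw [← Matrix.mul_assoc, one_sub_downProj_mul_compl, hM]
    rw [Matrix.sub_mul, Matrix.one_mul, sub_eq_zero] at h2
    exact h2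
  have h3 : A * (1 - downProj L Tᶜ) = downProj L S * (A * (1 - downProj L Tᶜ)) := by
    have h4 : (1 - downProj L S) * (A * (1 - downProj L Tᶜ)) = 0 := by
      -- `S ⊆ Tᶜ`, so the projection on spins up in `S` can be inserted for free to the right of
      -- `A`.
      rw [← one_sub_downProj_mul_of_subset (L := L) (S := S) (T := Tᶜ) fun i hi h => hST i h hi]
      calc (1 - downProj L S) * (A * ((1 - downProj L S) * (1 - downProj L Tᶜ)))
          = ((1 - downProj L S) * A * (1 - downProj L S)) * (1 - downProj L Tᶜ) := by
            simp only [Matrix.mul_assoc]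
        _ = 0 := by rw [hA.up_up S hS, Matrix.zero_mul]
    rw [Matrix.sub_mul, Matrix.one_mul, sub_eq_zero] at h4
    exact h4
  have h5 : downProj L T * A = A * downProj L T := hA.comm T fun i hi => by
    by_contra h
    push Not at h
    exact hST i hi (hS ⟨h.1, h.2⟩)
  calc A * (1 - downProj L Tᶜ) * M = downProj L S * (A * ((1 - downProj L Tᶜ) * M)) := by
        conv_lhs => rw [h3]
        simp only [Matrix.mul_assoc]
    _ = downProj L S * (A * (downProj L T * ((1 - downProj L Tᶜ) * M))) := by rw [← h1]
    _ = downProj L S * ((A * downProj L T) * ((1 - downProj L Tᶜ) * M)) := by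
        simp only [Matrix.mul_assoc]
    _ = _ := by rw [← h5]; simp only [Matrix.mul_assoc]

lemma IsCentered.conjTranspose (hA : IsCentered A lo hi) : IsCentered Aᴴ lo hi := by
  refine ⟨fun T hT => ?_, fun S hS => ?_⟩
  · have := congrArg Matrix.conjTranspose (hA.comm T hT)
    rw [Matrix.conjTranspose_mul, Matrix.conjTranspose_mul, downProj_conjTranspose] at this
    exact this.symm
  · have := congrArg Matrix.conjTranspose (hA.up_up S hS)
    simpa only [Matrix.conjTranspose_mul, Matrix.conjTranspose_sub, Matrix.conjTranspose_one,
      downProj_conjTranspose, Matrix.conjTranspose_zero, Matrix.mul_assoc] using this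

/-- The mirror image of `IsCentered.mul_one_sub_downProj`, obtained by taking adjoints. -/
lemma IsCentered.one_sub_downProj_mul (hA : IsCentered A lo hi) {S T : Set ℤ}
    (hS : Set.Icc lo hi ⊆ S) (hST : ∀ i ∈ T, i ∉ S) {M : Op L} (hM : M * vacProj L = 0) :
    M * (1 - downProj L Tᶜ) * A =
      M * (1 - downProj L Tᶜ) * A * (downProj L S * downProj L T) := by
  have hv : (vacProj L)ᴴ = vacProj L := by
    rw [vacProj, Matrix.conjTranspose_sub, Matrix.conjTranspose_one, downProj_conjTranspose]
  have h := hA.conjTranspose.mul_one_sub_downProj hS hST (M := Mᴴ)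
    (by rw [← hv, ← Matrix.conjTranspose_mul, hM, Matrix.conjTranspose_zero])
  have := congrArg Matrix.conjTranspose h
  simp only [Matrix.conjTranspose_mul, Matrix.conjTranspose_sub, Matrix.conjTranspose_one,
    downProj_conjTranspose, Matrix.conjTranspose_conjTranspose] at this
  rw [downProj_mul_comm T S] at this
  simpa only [Matrix.mul_assoc] using this

lemma norm_mul_le_of_le_one_right {M N : Op L} (hN : ‖N‖ ≤ 1) : ‖M * N‖ ≤ ‖M‖ :=
  (norm_mul_le _ _).trans (mul_le_of_le_one_right (norm_nonneg _) hN)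

lemma norm_mul_le_of_le_one_left {M N : Op L} (hM : ‖M‖ ≤ 1) : ‖M * N‖ ≤ ‖N‖ :=
  (norm_mul_le _ _).trans (mul_le_of_le_one_left (norm_nonneg _) hM)

/-- Two centered observables are decoupled by an evolution `U` that does not reach the vacuum, up
to errors measured by spin-down projections on distant regions. -/
lemma IsCentered.traceNorm_mul_le (hA : IsCentered A lo hi) (hB : IsCentered B lo' hi')
    (hQ : ‖Q‖ ≤ 1) (hQs : Qᴴ = Q) (hU : ‖U‖ ≤ 1) (hvU : vacProj L * U = 0)
    (hUv : U * vacProj L = 0) {S T S' T' : Set ℤ}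
    (hS : Set.Icc lo hi ⊆ S) (hST : ∀ i ∈ T, i ∉ S)
    (hS' : Set.Icc lo' hi' ⊆ S') (hST' : ∀ i ∈ T', i ∉ S') :
    traceNorm (Q * A * U * B * Q) ≤ ‖A‖ * ‖B‖ *
      (traceNorm (downProj L S * downProj L T * Q) + traceNorm (downProj L S' * downProj L T' * Q)
        + traceNorm (downProj L Tᶜ * U * downProj L T'ᶜ)) := by
  set n₁ := downProj L Tᶜ with hn₁
  set n₂ := downProj L T'ᶜ with hn₂
  have h1 := hA.mul_one_sub_downProj hS hST hvU
  have h2 := hB.one_sub_downProj_mul hS' hST' hUv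
  rw [← hn₁] at h1
  rw [← hn₂] at h2
  have hn₁' : ‖1 - n₁‖ ≤ 1 := norm_one_sub_downProj_le _
  have hn₂' : ‖1 - n₂‖ ≤ 1 := norm_one_sub_downProj_le _
  have hn₁'' : ‖n₁‖ ≤ 1 := norm_downProj_le _
  set K₁ := downProj L S * downProj L T
  set K₂ := downProj L S' * downProj L T'
  have hK₁ : traceNorm (Q * K₁) = traceNorm (K₁ * Q) := by
    rw [← traceNorm_conjTranspose (Q * K₁), Matrix.conjTranspose_mul, hQs,
      Matrix.conjTranspose_mul, downProj_conjTranspose, downProj_conjTranspose, downProj_mul_comm]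
  -- `U = (1 - n₁) U + n₁ U (1 - n₂) + n₁ U n₂`. The first two terms put a pair of distant down
  -- spins next to an outer `Q`; the last is a correlation of distant regions.
  have hsplit : Q * A * U * B * Q = Q * K₁ * (A * (1 - n₁) * U * B * Q) +
      (Q * A * n₁ * (U * (1 - n₂) * B)) * (K₂ * Q) + (Q * A) * (n₁ * U * n₂) * (B * Q) := by
    have e1 : Q * A * U * B * Q = Q * (A * (1 - n₁) * U) * (B * Q) +
        (Q * A * n₁) * (U * (1 - n₂) * B) * Q + (Q * A) * (n₁ * U * n₂) * (B * Q) := by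
      noncomm_ring
    rw [e1]
    conv_lhs => rw [h1, h2]
    simp only [Matrix.mul_assoc]
  have b1 : traceNorm (Q * K₁ * (A * (1 - n₁) * U * B * Q)) ≤
      ‖A‖ * ‖B‖ * traceNorm (K₁ * Q) := by
    refine (traceNorm_mul_le_mul_norm _ _).trans ?_
    rw [hK₁, mul_comm]
    refine mul_le_mul_of_nonneg_right ?_ (traceNorm_nonneg _)
    refine (norm_mul_le_of_le_one_right hQ).trans ((norm_mul_le _ _).trans ?_)
    gcongr
    exact (norm_mul_le_of_le_one_right hU).trans (norm_mul_le_of_le_one_right hn₁')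
  have b2 : traceNorm ((Q * A * n₁ * (U * (1 - n₂) * B)) * (K₂ * Q)) ≤
      ‖A‖ * ‖B‖ * traceNorm (K₂ * Q) := by
    refine (traceNorm_mul_le_norm_mul _ _).trans ?_
    refine mul_le_mul_of_nonneg_right ?_ (traceNorm_nonneg _)
    refine (norm_mul_le _ _).trans ?_
    refine mul_le_mul ((norm_mul_le_of_le_one_right hn₁'').trans (norm_mul_le_of_le_one_left hQ))
      ?_ (norm_nonneg _) (norm_nonneg _)
    rw [Matrix.mul_assoc]
    exact (norm_mul_le_of_le_one_left hU).trans (norm_mul_le_of_le_one_left hn₂')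
  have b3 : traceNorm ((Q * A) * (n₁ * U * n₂) * (B * Q)) ≤
      ‖A‖ * ‖B‖ * traceNorm (n₁ * U * n₂) := by
    refine (traceNorm_mul_mul_le _ _ _).trans ?_
    have ha : ‖Q * A‖ ≤ ‖A‖ := norm_mul_le_of_le_one_left hQ
    have hb : ‖B * Q‖ ≤ ‖B‖ := norm_mul_le_of_le_one_right hQ
    have := traceNorm_nonneg (n₁ * U * n₂)
    rw [mul_right_comm ‖A‖]
    exact mul_le_mul (mul_le_mul_of_nonneg_right ha this) hb (norm_nonneg _)
      (mul_nonneg (norm_nonneg _) this)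
  rw [hsplit, mul_add, mul_add]
  exact (traceNorm_add_le _ _).trans
    (add_le_add ((traceNorm_add_le _ _).trans (add_le_add b1 b2)) b3)

end Local

end XXZ

namespace XXZ

open scoped Matrix.Norms.L2Operator

/-! ### Quadratic forms -/

section QForm

variable {n : Type*} [Fintype n] [DecidableEq n]

/-- The real part of the quadratic form `⟨x, A x⟩`. -/
noncomputable def qform (A : Matrix n n ℂ) (x : n → ℂ) : ℝ := (star x ⬝ᵥ (A *ᵥ x)).re

lemma qform_add (A B : Matrix n n ℂ) (x : n → ℂ) : qform (A + B) x = qform A x + qform B x := by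
  rw [qform, Matrix.add_mulVec, dotProduct_add, Complex.add_re]; rfl

lemma qform_sub (A B : Matrix n n ℂ) (x : n → ℂ) : qform (A - B) x = qform A x - qform B x := by
  rw [qform, Matrix.sub_mulVec, dotProduct_sub, Complex.sub_re]; rfl

lemma qform_zero (x : n → ℂ) : qform 0 x = 0 := by
  rw [qform, Matrix.zero_mulVec, dotProduct_zero, Complex.zero_re]

lemma qform_smul (r : ℝ) (A : Matrix n n ℂ) (x : n → ℂ) :
    qform ((r : ℂ) • A) x = r * qform A x := by
  rw [qform, Matrix.smul_mulVec, dotProduct_smul, smul_eq_mul, Complex.re_ofReal_mul]; rfl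

lemma qform_sum {ι : Type*} (s : Finset ι) (f : ι → Matrix n n ℂ) (x : n → ℂ) :
    qform (∑ i ∈ s, f i) x = ∑ i ∈ s, qform (f i) x := by
  classical
  induction s using Finset.induction_on with
  | empty => simp [qform_zero]
  | insert a s ha ih => rw [Finset.sum_insert ha, Finset.sum_insert ha, qform_add, ih]

lemma qform_conjTranspose_mul_self_nonneg (B : Matrix n n ℂ) (x : n → ℂ) :
    0 ≤ qform (Bᴴ * B) x := by
  rw [qform, ← star_mulVec_dotProduct]
  exact re_star_dotProduct_self_nonneg _

lemma qform_diagonal (d : n → ℝ) (x : n → ℂ) :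
    qform (diagonal fun s => (d s : ℂ)) x = ∑ s, d s * ‖x s‖ ^ 2 := by
  rw [qform, dotProduct, Complex.re_sum]
  refine Finset.sum_congr rfl fun s _ => ?_
  rw [Matrix.mulVec_diagonal, Pi.star_apply, RCLike.star_def, mul_left_comm, Complex.conj_mul',
    ← Complex.ofReal_pow, ← Complex.ofReal_mul, Complex.ofReal_re]

end QForm

/-! ### The two-site interaction -/

section Bond

variable {L : ℕ}

lemma siteOp_mul_siteOp (i : Site L) (a b : Matrix (Fin 2) (Fin 2) ℂ) :
    siteOp i a * siteOp i b = siteOp i (a * b) := by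
  ext s s'
  rw [Matrix.mul_apply]
  by_cases h : ∀ k, k ≠ i → s k = s' k
  · have h1 : siteOp i (a * b) s s' = ∑ c : Fin 2, a (s i) c * b c (s' i) := by
      rw [siteOp, Matrix.of_apply, if_pos h, Matrix.mul_apply]
    rw [h1]
    symm
    refine Finset.sum_of_injOn (fun c => Function.update s i c) ?_ (fun _ _ => Finset.mem_univ _)
      ?_ ?_
    · intro c _ d _ hcd
      have := congrFun hcd i
      simpa using this
    · intro t _ ht
      rw [siteOp, Matrix.of_apply, if_neg, zero_mul]
      intro h2
      refine ht ⟨t i, by simp, ?_⟩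
      funext k
      by_cases hk : k = i
      · subst hk; simp
      · simp [hk, h2 k hk]
    · intro c _
      have h2 : siteOp i a s (Function.update s i c) = a (s i) c := by
        rw [siteOp, Matrix.of_apply, if_pos, Function.update_self]
        intro k hk
        rw [Function.update_of_ne hk]
      have h3 : siteOp i b (Function.update s i c) s' = b c (s' i) := by
        rw [siteOp, Matrix.of_apply, if_pos, Function.update_self]
        intro k hk
        rw [Function.update_of_ne hk, h k hk]
      rw [h2, h3]
  · have h0 : siteOp i (a * b) s s' = 0 := by rw [siteOp, Matrix.of_apply, if_neg h]
    rw [h0]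
    refine Finset.sum_eq_zero fun t _ => ?_
    by_cases h1 : ∀ k, k ≠ i → s k = t k
    · have h2 : ¬ ∀ k, k ≠ i → t k = s' k := fun h2 => h fun k hk => (h1 k hk).trans (h2 k hk)
      have h3 : siteOp i b t s' = 0 := by rw [siteOp, Matrix.of_apply, if_neg h2]
      rw [h3, mul_zero]
    · have h3 : siteOp i a s t = 0 := by rw [siteOp, Matrix.of_apply, if_neg h1]
      rw [h3, zero_mul]

lemma siteOp_comm {i j : Site L} (hij : i ≠ j) (a b : Matrix (Fin 2) (Fin 2) ℂ) :
    siteOp i a * siteOp j b = siteOp j b * siteOp i a := by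
  ext s s'
  rw [siteOp_mul_apply hij, siteOp_mul_apply hij.symm]
  have : (∀ k, k ≠ i → k ≠ j → s k = s' k) ↔ ∀ k, k ≠ j → k ≠ i → s k = s' k :=
    ⟨fun h k h1 h2 => h k h2 h1, fun h k h1 h2 => h k h2 h1⟩
  simp only [this, mul_comm]

lemma siteOp_one (i : Site L) : siteOp i 1 = 1 := by
  ext s s'
  rw [siteOp, Matrix.of_apply, Matrix.one_apply, Matrix.one_apply]
  by_cases h : s = s'
  · simp [h]
  · rw [if_neg h]
    split_ifs with h1 h2
    · exact absurd (funext fun k => if hk : k = i then hk ▸ h2 else h1 k hk) h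
    · rfl
    · rfl

lemma siteOp_smul (i : Site L) (c : ℂ) (a : Matrix (Fin 2) (Fin 2) ℂ) :
    siteOp i (c • a) = c • siteOp i a := by
  ext s s'
  simp only [siteOp, Matrix.of_apply, Matrix.smul_apply]
  split_ifs <;> simp

lemma siteOp_mul_mul_mul {i j : Site L} (hij : i ≠ j) (a b c d : Matrix (Fin 2) (Fin 2) ℂ) :
    siteOp i a * siteOp j b * (siteOp i c * siteOp j d) =
      siteOp i (a * c) * siteOp j (b * d) := by
  rw [← siteOp_mul_siteOp, ← siteOp_mul_siteOp]
  calc siteOp i a * siteOp j b * (siteOp i c * siteOp j d)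
      = siteOp i a * (siteOp j b * siteOp i c) * siteOp j d := by simp only [Matrix.mul_assoc]
    _ = siteOp i a * (siteOp i c * siteOp j b) * siteOp j d := by rw [siteOp_comm hij.symm]
    _ = _ := by simp only [Matrix.mul_assoc]

lemma siteOp_smul_mul_smul (i j : Site L) (c d : ℂ) (a b : Matrix (Fin 2) (Fin 2) ℂ) :
    siteOp i (c • a) * siteOp j (d • b) = (c * d) • (siteOp i a * siteOp j b) := by
  rw [siteOp_smul, siteOp_smul, Matrix.smul_mul, Matrix.mul_smul, smul_smul]

/-- `1 - σᶻσᶻ - σˣσˣ - σʸσʸ`, four times the projection onto the singlet. -/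
noncomputable def singletOp (i j : Site L) : Op L :=
  1 - siteOp i pauliZ * siteOp j pauliZ -
    (siteOp i pauliX * siteOp j pauliX + siteOp i pauliY * siteOp j pauliY)

lemma singletOp_mul_self {i j : Site L} (hij : i ≠ j) :
    singletOp i j * singletOp i j = (4 : ℂ) • singletOp i j := by
  have zz : pauliZ * pauliZ = 1 := by ext a b; fin_cases a <;> fin_cases b <;> simp [pauliZ]
  have xx : pauliX * pauliX = 1 := by ext a b; fin_cases a <;> fin_cases b <;> simp [pauliX]
  have yy : pauliY * pauliY = 1 := by ext a b; fin_cases a <;> fin_cases b <;> simp [pauliY]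
  have xy : pauliX * pauliY = Complex.I • pauliZ := by
    ext a b; fin_cases a <;> fin_cases b <;> simp [pauliX, pauliY, pauliZ]
  have yx : pauliY * pauliX = (-Complex.I) • pauliZ := by
    ext a b; fin_cases a <;> fin_cases b <;> simp [pauliX, pauliY, pauliZ]
  have zx : pauliZ * pauliX = Complex.I • pauliY := by
    ext a b; fin_cases a <;> fin_cases b <;> simp [pauliX, pauliY, pauliZ]
  have xz : pauliX * pauliZ = (-Complex.I) • pauliY := by
    ext a b; fin_cases a <;> fin_cases b <;> simp [pauliX, pauliY, pauliZ]
  have yz : pauliY * pauliZ = Complex.I • pauliX := by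
    ext a b; fin_cases a <;> fin_cases b <;> simp [pauliX, pauliY, pauliZ]
  have zy : pauliZ * pauliY = (-Complex.I) • pauliX := by
    ext a b; fin_cases a <;> fin_cases b <;> simp [pauliX, pauliY, pauliZ]
  have hI : Complex.I * Complex.I = -1 := Complex.I_mul_I
  have hI' : -Complex.I * -Complex.I = -1 := by simp
  have hZZ := siteOp_mul_mul_mul hij pauliZ pauliZ pauliZ pauliZ
  have hXX := siteOp_mul_mul_mul hij pauliX pauliX pauliX pauliX
  have hYY := siteOp_mul_mul_mul hij pauliY pauliY pauliY pauliY
  have hXY := siteOp_mul_mul_mul hij pauliX pauliX pauliY pauliY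
  have hYX := siteOp_mul_mul_mul hij pauliY pauliY pauliX pauliX
  have hXZ := siteOp_mul_mul_mul hij pauliX pauliX pauliZ pauliZ
  have hZX := siteOp_mul_mul_mul hij pauliZ pauliZ pauliX pauliX
  have hYZ := siteOp_mul_mul_mul hij pauliY pauliY pauliZ pauliZ
  have hZY := siteOp_mul_mul_mul hij pauliZ pauliZ pauliY pauliY
  rw [zz, siteOp_one, siteOp_one, Matrix.one_mul] at hZZ
  rw [xx, siteOp_one, siteOp_one, Matrix.one_mul] at hXX
  rw [yy, siteOp_one, siteOp_one, Matrix.one_mul] at hYY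
  rw [xy, siteOp_smul_mul_smul, hI] at hXY
  rw [yx, siteOp_smul_mul_smul, hI'] at hYX
  rw [xz, siteOp_smul_mul_smul, hI'] at hXZ
  rw [zx, siteOp_smul_mul_smul, hI] at hZX
  rw [yz, siteOp_smul_mul_smul, hI] at hYZ
  rw [zy, siteOp_smul_mul_smul, hI'] at hZY
  rw [singletOp]
  set X := siteOp i pauliX * siteOp j pauliX
  set Y := siteOp i pauliY * siteOp j pauliY
  set Z := siteOp i pauliZ * siteOp j pauliZ
  have e : (1 - Z - (X + Y)) * (1 - Z - (X + Y)) = 1 - (Z + Z) - (X + X) - (Y + Y) +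
      (Z * Z + X * X + Y * Y) + (Z * X + X * Z) + (Z * Y + Y * Z) + (X * Y + Y * X) := by
    noncomm_ring
  rw [e, hZZ, hXX, hYY, hXY, hYX, hXZ, hZX, hYZ, hZY]
  module

lemma singletOp_isHermitian {i j : Site L} (hij : i ≠ j) : (singletOp i j).IsHermitian :=
  (Matrix.isHermitian_one.sub
    (siteOp_mul_isHermitian hij pauliZ_isHermitian pauliZ_isHermitian)).sub
    ((siteOp_mul_isHermitian hij pauliX_isHermitian pauliX_isHermitian).add
      (siteOp_mul_isHermitian hij pauliY_isHermitian pauliY_isHermitian))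

lemma qform_singletOp_nonneg {i j : Site L} (hij : i ≠ j) (x : Config L → ℂ) :
    0 ≤ qform (singletOp i j) x := by
  have h := qform_conjTranspose_mul_self_nonneg (singletOp i j) x
  rw [(singletOp_isHermitian hij).eq, singletOp_mul_self hij] at h
  have h2 := qform_smul 4 (singletOp i j) x
  push_cast at h2
  rw [h2] at h
  linarith

lemma pauliZ_mul_pauliZ_eq (i j : Site L) : (1 : Op L) - siteOp i pauliZ * siteOp j pauliZ =
    diagonal fun s : Config L => (((if s i = s j then 0 else 2 : ℝ)) : ℂ) := by
  rw [siteOp_pauliZ, siteOp_pauliZ, Matrix.diagonal_mul_diagonal, ← Matrix.diagonal_one,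
    Matrix.diagonal_sub]
  congr 1
  ext s
  generalize s i = a
  generalize s j = b
  fin_cases a <;> fin_cases b <;> norm_num

/-- Split `1/4 = Θ₀/4 + 1/(4Δ)`: the bond is an Ising wall energy plus a multiple of the singlet
projection, which is nonnegative and may be dropped in lower bounds. -/
lemma bondOp_eq (p : Params) (i j : Site L) : bondOp p.Δ i j =
    ((p.Θ₀ / 4 : ℝ) : ℂ) • ((1 : Op L) - siteOp i pauliZ * siteOp j pauliZ) +
      ((1 / (4 * p.Δ) : ℝ) : ℂ) • singletOp i j := by
  have hΔ : p.Δ ≠ 0 := (zero_lt_one.trans p.one_lt_Δ).ne'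
  have h : ((1 / 4 : ℝ) : ℂ) = ((p.Θ₀ / 4 : ℝ) : ℂ) + ((1 / (4 * p.Δ) : ℝ) : ℂ) := by
    rw [← Complex.ofReal_add, Params.Θ₀]
    congr 1
    field_simp
    ring
  rw [bondOp, singletOp, h]
  module

lemma qform_bondOp (p : Params) (i j : Site L) (x : Config L → ℂ) : qform (bondOp p.Δ i j) x =
    p.Θ₀ / 2 * (∑ s, (if s i = s j then 0 else 1) * ‖x s‖ ^ 2) +
      1 / (4 * p.Δ) * qform (singletOp i j) x := by
  rw [bondOp_eq, qform_add, qform_smul, qform_smul, pauliZ_mul_pauliZ_eq, qform_diagonal]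
  congr 1
  rw [Finset.mul_sum, Finset.mul_sum]
  refine Finset.sum_congr rfl fun s _ => ?_
  split_ifs <;> ring

lemma qform_numOp (i : Site L) (x : Config L → ℂ) :
    qform (numOp i) x = ∑ s, (if s i = 1 then 1 else 0) * ‖x s‖ ^ 2 := by
  rw [numOp_eq_diagonal, ← qform_diagonal]
  congr 2
  ext s
  split_ifs <;> simp

/-! ### The droplet bound `H ≥ Θ₀ (1 - O)` -/

lemma Params.Θ₀_pos (p : Params) : 0 < p.Θ₀ := by
  have h := p.one_lt_Δ
  rw [Params.Θ₀, sub_pos, div_lt_one (by linarith)]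
  exact h

lemma qform_ham (p : Params) (v : ℤ → ℝ) (x : Config L → ℂ) : qform (ham p L v) x =
    (∑ i : Site L, ∑ j : Site L, if j.1 = i.1 + 1 then qform (bondOp p.Δ i j) x else 0)
    + p.lam * ∑ i : Site L, v i.1 * qform (numOp i) x
    + p.β * (qform (numOp (leftEnd L)) x + qform (numOp (rightEnd L)) x) := by
  rw [ham, qform_add, qform_add, qform_smul, qform_smul, qform_add, qform_sum, qform_sum]
  simp only [qform_sum, qform_smul]
  congr 2
  refine Finset.sum_congr rfl fun i _ => Finset.sum_congr rfl fun j _ => ?_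
  split_ifs
  · rfl
  · exact qform_zero x

/-- A sum over consecutive bonds is bounded by the sum over all bonds of the chain. -/
lemma sum_range_le_sum_bonds {F : Site L → Site L → ℝ} (hF : ∀ i j, 0 ≤ F i j) {a : ℤ} {N : ℕ}
    (ha : -(L : ℤ) ≤ a) (hN : a + N ≤ L) {G : ℕ → ℝ}
    (hG : ∀ n < N, ∀ i j : Site L, i.1 = a + n → j.1 = a + n + 1 → G n ≤ F i j) :
    ∑ n ∈ Finset.range N, G n ≤
      ∑ i : Site L, ∑ j : Site L, if j.1 = i.1 + 1 then F i j else 0 := by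
  have hst : ∀ n : ℕ, ∃ i : Site L, n ≤ N → i.1 = a + n := by
    intro n
    by_cases hn : n ≤ N
    · exact ⟨⟨a + n, Finset.mem_Icc.2 ⟨by omega, by omega⟩⟩, fun _ => rfl⟩
    · exact ⟨leftEnd L, fun h => absurd h hn⟩
  choose st hst using hst
  rw [← Finset.sum_product']
  have hinj : Set.InjOn (fun n => (st n, st (n + 1))) (Finset.range N : Set ℕ) := by
    intro n hn k hk h
    simp only [Finset.coe_range, Set.mem_Iio] at hn hk
    have h1 := congrArg (fun q : Site L × Site L => q.1.1) h
    simp only [hst n hn.le, hst k hk.le] at h1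
    omega
  calc ∑ n ∈ Finset.range N, G n
      ≤ ∑ n ∈ Finset.range N, (fun q : Site L × Site L =>
          if q.2.1 = q.1.1 + 1 then F q.1 q.2 else 0) (st n, st (n + 1)) := by
        refine Finset.sum_le_sum fun n hn => ?_
        have hn' := Finset.mem_range.1 hn
        have h1 := hst n hn'.le
        have h2 := hst (n + 1) hn'
        push_cast at h2
        simp only
        rw [if_pos (by omega)]
        exact hG n hn' _ _ h1 (by omega)
    _ = ∑ q ∈ (Finset.range N).image fun n => (st n, st (n + 1)),
          if q.2.1 = q.1.1 + 1 then F q.1 q.2 else 0 :=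
        (Finset.sum_image (f := fun q : Site L × Site L =>
          if q.2.1 = q.1.1 + 1 then F q.1 q.2 else 0) hinj).symm
    _ ≤ _ := Finset.sum_le_sum_of_subset_of_nonneg (Finset.subset_univ _) fun q _ _ => by
        split_ifs
        · exact hF _ _
        · exact le_rfl

/-- A configuration with a spin down has at least two domain walls, counting the ends. -/
lemma two_le_walls {s : Config L} (hs : s ≠ 0) :
    2 ≤ (∑ i : Site L, ∑ j : Site L, if j.1 = i.1 + 1 then (if s i = s j then 0 else 1 : ℝ) else 0)
      + ((if s (leftEnd L) = 1 then 1 else 0) + (if s (rightEnd L) = 1 then 1 else 0)) := by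
  obtain ⟨k, hk⟩ : ∃ k, s k = 1 := by
    by_contra h
    push Not at h
    exact hs <| funext fun i => by
      have := h i
      simp only [Pi.zero_apply]
      omega
  -- `g n` reads the spin at `-L + n`; the existential form makes it a function on all of `ℕ`, so
  -- that telescoping bounds for sequences apply.
  set g : ℕ → ℝ := fun n => if ∃ i : Site L, i.1 = -(L : ℤ) + n ∧ s i = 1 then 1 else 0 with hg
  have hg' : ∀ (n : ℕ) (i : Site L), i.1 = -(L : ℤ) + n → g n = if s i = 1 then 1 else 0 := by
    intro n i hi
    have : (∃ i : Site L, i.1 = -(L : ℤ) + n ∧ s i = 1) ↔ s i = 1 := by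
      constructor
      · rintro ⟨i', h1, h2⟩
        have : i' = i := Subtype.ext (h1.trans hi.symm)
        rwa [this] at h2
      · exact fun h => ⟨i, hi, h⟩
    simp only [hg, this]
  have hk2 := Finset.mem_Icc.1 k.2
  obtain ⟨K, hK⟩ : ∃ K : ℕ, (K : ℤ) = k.1 + L := ⟨(k.1 + L).toNat, by omega⟩
  have hgK : g K = 1 := by rw [hg' K k (by omega), if_pos hk]
  have hg0 : g 0 = if s (leftEnd L) = 1 then 1 else 0 := hg' 0 _ (by simp [leftEnd])
  have hg1 : g (2 * L) = if s (rightEnd L) = 1 then 1 else 0 :=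
    hg' _ _ (by simp only [rightEnd]; push_cast; ring)
  have hb := sum_range_le_sum_bonds (L := L) (F := fun i j => if s i = s j then 0 else 1)
    (fun i j => by split_ifs <;> simp) (a := -(L : ℤ)) (N := 2 * L) le_rfl (by push_cast; omega)
    (G := fun n => dist (g n) (g (n + 1))) (fun n hn i j hi hj => by
      rw [hg' n i hi, hg' (n + 1) j (by push_cast; omega)]
      generalize s i = a
      generalize s j = b
      fin_cases a <;> fin_cases b <;> simp)
  have hK2 : K ≤ 2 * L := by omega
  -- The variation of `g` is at least its rise from the left end to the down spin at `K` plus its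
  -- fall to the right end, that is `(1 - g 0) + (1 - g (2L))`; the end terms make up the difference
  -- to `2`.
  have h1 := dist_le_Ico_sum_dist g (Nat.zero_le K)
  have h2 := dist_le_Ico_sum_dist g hK2
  have h3 := Finset.sum_Ico_consecutive (fun n => dist (g n) (g (n + 1))) (Nat.zero_le K) hK2
  rw [← Finset.range_eq_Ico] at h3
  rw [hgK, Real.dist_eq] at h1 h2
  have h4 := neg_abs_le (g 0 - 1)
  have h5 := le_abs_self (1 - g (2 * L))
  rw [hg0] at h1 h4
  rw [hg1] at h2 h5
  rw [← Finset.range_eq_Ico] at h1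
  rw [← Finset.range_eq_Ico] at h3
  linarith

lemma qform_one_sub_vacProj (x : Config L → ℂ) :
    qform (1 - vacProj L) x = ∑ s, (if s = 0 then 0 else 1) * ‖x s‖ ^ 2 := by
  rw [vacProj_eq_diagonal, ← Matrix.diagonal_one, Matrix.diagonal_sub, ← qform_diagonal]
  congr 2
  ext s
  split_ifs <;> simp

lemma bond_sites_ne {i j : Site L} (h : j.1 = i.1 + 1) : i ≠ j := by
  rintro rfl; omega

/-- The singlet part and the field are nonnegative and are dropped. Each wall costs `Θ₀/2`, `β ≥
Θ₀/2` lets a down spin at an end count as a wall, and every configuration other than the vacuum has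
two walls. -/
lemma mul_qform_one_sub_vacProj_le (p : Params) {v : ℤ → ℝ} (hv : ∀ i, 0 ≤ v i)
    (x : Config L → ℂ) : p.Θ₀ * qform (1 - vacProj L) x ≤ qform (ham p L v) x := by
  have hΘ := p.Θ₀_pos
  have hΔ : 0 < p.Δ := zero_lt_one.trans p.one_lt_Δ
  have hN : ∀ i : Site L, 0 ≤ qform (numOp i) x := fun i => by
    rw [qform_numOp]
    exact Finset.sum_nonneg fun s _ => by split_ifs <;> positivity
  have hbond : (∑ i : Site L, ∑ j : Site L, if j.1 = i.1 + 1 then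
      p.Θ₀ / 2 * (∑ s, (if s i = s j then 0 else 1) * ‖x s‖ ^ 2) else 0) ≤
      ∑ i : Site L, ∑ j : Site L, if j.1 = i.1 + 1 then qform (bondOp p.Δ i j) x else 0 := by
    refine Finset.sum_le_sum fun i _ => Finset.sum_le_sum fun j _ => ?_
    split_ifs with h
    · rw [qform_bondOp]
      have := qform_singletOp_nonneg (bond_sites_ne h) x
      have : 0 ≤ 1 / (4 * p.Δ) * qform (singletOp i j) x := by positivity
      linarith
    · exact le_rfl
  have hpot : 0 ≤ p.lam * ∑ i : Site L, v i.1 * qform (numOp i) x :=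
    mul_nonneg p.lam_pos.le (Finset.sum_nonneg fun i _ => mul_nonneg (hv _) (hN i))
  have hbdry : p.Θ₀ / 2 * (qform (numOp (leftEnd L)) x + qform (numOp (rightEnd L)) x) ≤
      p.β * (qform (numOp (leftEnd L)) x + qform (numOp (rightEnd L)) x) := by
    refine mul_le_mul_of_nonneg_right ?_ (add_nonneg (hN _) (hN _))
    have := p.le_β
    rw [Params.Θ₀]
    linarith
  rw [qform_ham]
  have hmain : p.Θ₀ * qform (1 - vacProj L) x ≤ (∑ i : Site L, ∑ j : Site L,
      if j.1 = i.1 + 1 then p.Θ₀ / 2 * (∑ s, (if s i = s j then 0 else 1) * ‖x s‖ ^ 2) else 0)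
      + p.Θ₀ / 2 * (qform (numOp (leftEnd L)) x + qform (numOp (rightEnd L)) x) := by
    have e1 : (∑ i : Site L, ∑ j : Site L, if j.1 = i.1 + 1 then
        p.Θ₀ / 2 * (∑ s : Config L, (if s i = s j then 0 else 1) * ‖x s‖ ^ 2) else 0) =
        p.Θ₀ / 2 * ∑ s : Config L, (∑ i : Site L, ∑ j : Site L, if j.1 = i.1 + 1 then
          (if s i = s j then 0 else 1 : ℝ) else 0) * ‖x s‖ ^ 2 := by
      simp only [Finset.sum_mul, Finset.mul_sum]
      rw [Finset.sum_comm]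
      rw [Finset.sum_comm (s := (Finset.univ : Finset (Config L)))]
      rw [Finset.sum_comm]
      refine Finset.sum_congr rfl fun i _ => ?_
      rw [Finset.sum_comm (s := (Finset.univ : Finset (Config L)))]
      refine Finset.sum_congr rfl fun j _ => ?_
      split_ifs
      · rfl
      · simp
    rw [e1, qform_numOp, qform_numOp, qform_one_sub_vacProj, ← Finset.sum_add_distrib, ← mul_add,
      ← Finset.sum_add_distrib, Finset.mul_sum, Finset.mul_sum]
    refine Finset.sum_le_sum fun s _ => ?_
    by_cases hs : s = 0
    · subst hs
      simp
    · have h2 := two_le_walls hs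
      rw [if_neg hs, one_mul, ← add_mul, ← add_mul, ← mul_assoc]
      refine mul_le_mul_of_nonneg_right ?_ (by positivity)
      nlinarith
  linarith

lemma ham_mul_vacProj (p : Params) (v : ℤ → ℝ) : ham p L v * vacProj L = 0 := by
  have hN : ∀ i : Site L, numOp i * vacProj L = 0 := fun i => by
    rw [numOp_eq_diagonal, vacProj_eq_diagonal, Matrix.diagonal_mul_diagonal,
      ← Matrix.diagonal_zero]
    congr 1
    ext s
    by_cases h : s = 0 <;> simp [h]
  have hB : ∀ i j : Site L, i ≠ j → bondOp p.Δ i j * vacProj L = 0 := by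
    intro i j hij
    have h1 : (1 - siteOp i pauliZ * siteOp j pauliZ) * vacProj L = 0 := by
      rw [pauliZ_mul_pauliZ_eq, vacProj_eq_diagonal, Matrix.diagonal_mul_diagonal,
        ← Matrix.diagonal_zero]
      congr 1
      ext s
      by_cases h : s = 0 <;> simp [h]
    -- On two up spins `σˣσˣ` and `σʸσʸ` both give two down spins, with opposite signs.
    have h2 : (siteOp i pauliX * siteOp j pauliX + siteOp i pauliY * siteOp j pauliY) *
        vacProj L = 0 := by
      ext s s'
      rw [vacProj_eq_diagonal, Matrix.mul_diagonal, Matrix.zero_apply]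
      by_cases hs : s' = 0
      · subst hs
        rw [Matrix.add_apply, siteOp_mul_apply hij, siteOp_mul_apply hij, if_pos rfl, mul_one]
        split_ifs
        · generalize s i = a
          generalize s j = b
          fin_cases a <;> fin_cases b <;> simp [pauliX, pauliY]
        · simp
      · simp [hs]
    rw [bondOp, Matrix.sub_mul, Matrix.smul_mul, Matrix.smul_mul, h1, h2]
    simp
  rw [ham, Matrix.add_mul, Matrix.add_mul, Matrix.smul_mul, Matrix.smul_mul, Matrix.add_mul, hN,
    hN, Matrix.sum_mul, Matrix.sum_mul]
  simp only [Matrix.smul_mul, hN]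
  simp only [smul_zero, Finset.sum_const_zero, add_zero]
  refine Finset.sum_eq_zero fun i _ => ?_
  rw [Matrix.sum_mul]
  refine Finset.sum_eq_zero fun j _ => ?_
  split_ifs with h
  · exact hB i j (bond_sites_ne h)
  · exact Matrix.zero_mul _

lemma vacProj_isHermitian : (vacProj L).IsHermitian := by
  rw [Matrix.IsHermitian, vacProj, Matrix.conjTranspose_sub, Matrix.conjTranspose_one,
    downProj_conjTranspose]

lemma hasGap_ham (p : Params) {v : ℤ → ℝ} (hv : ∀ i, 0 ≤ v i) :
    HasGap (ham p L v) (vacProj L) p.Θ₀ where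
  pos := p.Θ₀_pos
  isHermitian := vacProj_isHermitian
  mul_self := one_sub_downProj_mul_of_subset subset_rfl
  mul_eq_zero := ham_mul_vacProj p v
  le := mul_qform_one_sub_vacProj_le p hv

end Bond

end XXZ

namespace XXZ

open scoped Matrix.Norms.L2Operator

/-! ### Spectral projections of the Hamiltonian -/

section Spectral

variable {L : ℕ} (p : Params) (v : ℤ → ℝ) {B : Set ℝ}

lemma norm_indicator_one_le (B : Set ℝ) (x : ℝ) : ‖B.indicator (1 : ℝ → ℂ) x‖ ≤ 1 := by
  by_cases hx : x ∈ B <;> simp [hx]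

lemma norm_exp_I_mul_mul (t x : ℝ) : ‖Complex.exp (Complex.I * t * x)‖ = 1 := by
  rw [mul_assoc, ← Complex.ofReal_mul, Complex.norm_exp_I_mul_ofReal]

lemma hamFn_mul (g h : ℝ → ℂ) :
    hamFn p L v g * hamFn p L v h = hamFn p L v (fun x => g x * h x) := fnCalc_mul _ g h

lemma hamFn_conjTranspose (g : ℝ → ℂ) :
    (hamFn p L v g)ᴴ = hamFn p L v (fun x => star (g x)) := fnCalc_conjTranspose _ g

lemma norm_hamFn_le {g : ℝ → ℂ} (hg : ∀ x, ‖g x‖ ≤ 1) : ‖hamFn p L v g‖ ≤ 1 :=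
  norm_fnCalc_le _ hg

lemma hamFn_mul_vacProj (g : ℝ → ℂ) : hamFn p L v g * vacProj L = g 0 • vacProj L :=
  fnCalc_mul_of_mul_eq_smul _ (E := 0) (by simpa using ham_mul_vacProj p v) g

lemma vacProj_mul_hamFn (g : ℝ → ℂ) : vacProj L * hamFn p L v g = g 0 • vacProj L := by
  have h := congrArg Matrix.conjTranspose (hamFn_mul_vacProj (L := L) p v fun x => star (g x))
  rw [Matrix.conjTranspose_mul, hamFn_conjTranspose, Matrix.conjTranspose_smul,
    vacProj_isHermitian.eq] at h
  simpa only [star_star] using h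

lemma specProj_mul_self : specProj p L v B * specProj p L v B = specProj p L v B := by
  rw [specProj, hamFn_mul]
  congr 1
  ext x
  by_cases hx : x ∈ B <;> simp [hx]

lemma specProj_conjTranspose : (specProj p L v B)ᴴ = specProj p L v B := by
  rw [specProj, hamFn_conjTranspose]
  congr 1
  ext x
  by_cases hx : x ∈ B <;> simp [hx]

lemma norm_specProj_le : ‖specProj p L v B‖ ≤ 1 :=
  norm_hamFn_le p v (norm_indicator_one_le B)

lemma winEvol_zero : winEvol p L v B 0 = specProj p L v B := by
  rw [winEvol, specProj]
  congr 1
  ext x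
  simp

lemma norm_winEvol_le (t : ℝ) : ‖winEvol p L v B t‖ ≤ 1 :=
  norm_hamFn_le p v fun x => by
    rw [norm_mul, norm_exp_I_mul_mul, mul_one]
    exact norm_indicator_one_le B x

lemma zero_notMem_droplet (Θ₁ : ℝ) : (0 : ℝ) ∉ Set.Icc p.Θ₀ Θ₁ :=
  fun h => absurd h.1 (not_le.2 p.Θ₀_pos)

lemma winEvol_mul_vacProj (Θ₁ t : ℝ) : winEvol p L v (Set.Icc p.Θ₀ Θ₁) t * vacProj L = 0 := by
  rw [winEvol, hamFn_mul_vacProj, Set.indicator_of_notMem (zero_notMem_droplet p Θ₁), zero_mul,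
    zero_smul]

lemma vacProj_mul_winEvol (Θ₁ t : ℝ) : vacProj L * winEvol p L v (Set.Icc p.Θ₀ Θ₁) t = 0 := by
  rw [winEvol, vacProj_mul_hamFn, Set.indicator_of_notMem (zero_notMem_droplet p Θ₁), zero_mul,
    zero_smul]

variable {v}

lemma specProj_singleton_zero (hv : ∀ i, 0 ≤ v i) : specProj p L v {0} = vacProj L :=
  (hasGap_ham p hv).fnCalc_indicator_zero (ham_isHermitian p L v)

/-- By the gap the spectrum lies in `{0} ∪ [Θ₀, ∞)`, so enlarging the window down to zero adds just
the vacuum. -/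
lemma specProj_Icc_zero (hv : ∀ i, 0 ≤ v i) {Θ₁ : ℝ} (hΘ : p.Θ₀ < Θ₁) :
    specProj p L v (Set.Icc 0 Θ₁) = specProj p L v (Set.Icc p.Θ₀ Θ₁) + vacProj L := by
  rw [← specProj_singleton_zero p hv, specProj, specProj, specProj, hamFn, hamFn, hamFn,
    fnCalc_add]
  refine fnCalc_congr _ fun k => ?_
  have hΘ₀ := p.Θ₀_pos
  rcases (hasGap_ham p hv).eigenvalues_eq_zero_or_le (ham_isHermitian p L v) k with h | h
  · rw [h, Set.indicator_of_mem (by constructor <;> linarith),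
      Set.indicator_of_notMem (zero_notMem_droplet p Θ₁), Set.indicator_of_mem (by simp), zero_add]
  · have h0 : (ham_isHermitian p L v).eigenvalues k ≠ 0 := by linarith
    rw [Set.indicator_of_notMem (s := {0}) (by simpa using h0), add_zero]
    by_cases h1 : (ham_isHermitian p L v).eigenvalues k ≤ Θ₁
    · rw [Set.indicator_of_mem (s := Set.Icc 0 Θ₁) ⟨by linarith, h1⟩,
        Set.indicator_of_mem (s := Set.Icc p.Θ₀ Θ₁) ⟨h, h1⟩]
    · rw [Set.indicator_of_notMem fun h2 => h1 h2.2, Set.indicator_of_notMem fun h2 => h1 h2.2]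

end Spectral

/-! ### Pointwise error bounds -/

section Errors

variable {L : ℕ} (p : Params) (Θ₁ m : ℝ) (v : ℤ → ℝ)

/-- The total correlation between the sites `i ≤ a` and the sites `j ≥ b`. -/
noncomputable def corrSum (L : ℕ) (a b : ℤ) : ℝ≥0∞ :=
  ∑ i ∈ sitesIn L (Set.Iic a), ∑ j ∈ sitesIn L (Set.Ici b),
    (corr p L v (Set.Icc p.Θ₀ Θ₁) i j + corr p L v (Set.Icc p.Θ₀ Θ₁) j i)

/-- A majorant of the trace norm of `P_I` restricted to states with spins down both in
`(-∞, a]` and in `[b, ∞)`. -/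
noncomputable def pairErr (L : ℕ) (a b : ℤ) : ℝ≥0∞ :=
  corrSum p Θ₁ v L a b + ∑ k ∈ sitesIn L (Set.Ioo a b),
    (ENNReal.ofReal (Real.exp (m * (b - a) / 2)) * corrSum p Θ₁ v L a b +
      ENNReal.ofReal (Real.exp (m * (b - a) / 2))⁻¹ * corr p L v (Set.Icc p.Θ₀ Θ₁) k k)

/-- The total error in the decoupling of `(-∞, a]` and `[b, ∞)`. -/
noncomputable def totalErr (L : ℕ) (a b : ℤ) : ℝ≥0∞ :=
  pairErr p Θ₁ m v L a (a + (b - a) / 3 + 1) + pairErr p Θ₁ m v L (b - (b - a) / 3 - 1) b +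
    corrSum p Θ₁ v L (a + (b - a) / 3) (b - (b - a) / 3)

variable {p Θ₁ m v}

lemma ofReal_traceNorm_le_corr (i j : Site L) (t : ℝ) :
    ENNReal.ofReal (traceNorm (numOp i * winEvol p L v (Set.Icc p.Θ₀ Θ₁) t * numOp j)) ≤
      corr p L v (Set.Icc p.Θ₀ Θ₁) i j :=
  le_iSup (fun t : ℝ =>
    ENNReal.ofReal (traceNorm (numOp i * winEvol p L v (Set.Icc p.Θ₀ Θ₁) t * numOp j))) t

lemma ofReal_sum_traceNorm {ι : Type*} (s : Finset ι) (f : ι → Op L) :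
    ENNReal.ofReal (∑ i ∈ s, traceNorm (f i)) = ∑ i ∈ s, ENNReal.ofReal (traceNorm (f i)) :=
  ENNReal.ofReal_sum_of_nonneg fun _ _ => traceNorm_nonneg _

lemma ofReal_traceNorm_downProj_winEvol_le (S T : Set ℤ) (t : ℝ) :
    ENNReal.ofReal (traceNorm (downProj L S * winEvol p L v (Set.Icc p.Θ₀ Θ₁) t * downProj L T)) ≤
      ∑ i ∈ sitesIn L S, ∑ j ∈ sitesIn L T, corr p L v (Set.Icc p.Θ₀ Θ₁) i j := by
  refine (ENNReal.ofReal_le_ofReal (traceNorm_downProj_mul_downProj_le _ S T)).trans ?_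
  rw [ENNReal.ofReal_sum_of_nonneg fun i _ => Finset.sum_nonneg fun j _ => traceNorm_nonneg _]
  refine Finset.sum_le_sum fun i _ => ?_
  rw [ofReal_sum_traceNorm]
  exact Finset.sum_le_sum fun j _ => ofReal_traceNorm_le_corr i j t

lemma ofReal_traceNorm_left_right_le (a b : ℤ) (t : ℝ) :
    ENNReal.ofReal (traceNorm (downProj L (Set.Iic a) * winEvol p L v (Set.Icc p.Θ₀ Θ₁) t *
      downProj L (Set.Ici b))) ≤ corrSum p Θ₁ v L a b :=
  (ofReal_traceNorm_downProj_winEvol_le _ _ t).trans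
    (Finset.sum_le_sum fun _ _ => Finset.sum_le_sum fun _ _ => le_self_add)

lemma ofReal_traceNorm_right_left_le (a b : ℤ) (t : ℝ) :
    ENNReal.ofReal (traceNorm (downProj L (Set.Ici b) * winEvol p L v (Set.Icc p.Θ₀ Θ₁) t *
      downProj L (Set.Iic a))) ≤ corrSum p Θ₁ v L a b := by
  refine (ofReal_traceNorm_downProj_winEvol_le _ _ t).trans ?_
  rw [Finset.sum_comm]
  exact Finset.sum_le_sum fun _ _ => Finset.sum_le_sum fun _ _ => le_add_self

lemma numOp_conjTranspose (i : Site L) : (numOp i)ᴴ = numOp i := numOp_isHermitian i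

/-- The squared Hilbert–Schmidt norm of `D E R` is `tr (D E R) = tr (D R E)`, by cyclicity and
commutation of `D` and `E`. The two regions now stand on opposite sides of `R`, as in Property DL.
-/
lemma re_trace_pair_le (S T : Set ℤ) : ((downProj L S * downProj L T *
    specProj p L v (Set.Icc p.Θ₀ Θ₁))ᴴ * (downProj L S * downProj L T *
    specProj p L v (Set.Icc p.Θ₀ Θ₁))).trace.re ≤
    traceNorm (downProj L S * specProj p L v (Set.Icc p.Θ₀ Θ₁) * downProj L T) := by
  have hP := specProj_conjTranspose (L := L) p v (B := Set.Icc p.Θ₀ Θ₁)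
  have hPP := specProj_mul_self (L := L) p v (B := Set.Icc p.Θ₀ Θ₁)
  set R := specProj p L v (Set.Icc p.Θ₀ Θ₁)
  have hS := downProj_mul_self (L := L) S
  have hT := downProj_mul_self (L := L) T
  have hST := downProj_mul_comm (L := L) S T
  have hc1 := downProj_conjTranspose (L := L) S
  have hc2 := downProj_conjTranspose (L := L) T
  set D := downProj L S
  set E := downProj L T
  have h1 : E * D * (D * E) = E * D := by
    calc E * D * (D * E) = E * (D * D) * E := by simp only [Matrix.mul_assoc]
      _ = E * (D * E) := by rw [hS, Matrix.mul_assoc]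
      _ = (E * E) * D := by rw [hST, Matrix.mul_assoc]
      _ = E * D := by rw [hT]
  have h2 : ((D * E * R)ᴴ * (D * E * R)).trace = (D * R * E).trace := by
    rw [Matrix.conjTranspose_mul, Matrix.conjTranspose_mul, hP, hc1, hc2]
    calc (R * (E * D) * (D * E * R)).trace = (R * (E * D * (D * E) * R)).trace := by
          simp only [Matrix.mul_assoc]
      _ = (E * D * R * R).trace := by rw [Matrix.trace_mul_comm, h1]
      _ = (E * (D * R)).trace := by rw [Matrix.mul_assoc, hPP, Matrix.mul_assoc]
      _ = (D * R * E).trace := Matrix.trace_mul_comm _ _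
  rw [h2]
  exact (Complex.re_le_norm _).trans (norm_trace_le_traceNorm _)

lemma re_trace_site_le (k : Site L) : ((specProj p L v (Set.Icc p.Θ₀ Θ₁) * numOp k)ᴴ *
    (specProj p L v (Set.Icc p.Θ₀ Θ₁) * numOp k)).trace.re ≤
    traceNorm (numOp k * specProj p L v (Set.Icc p.Θ₀ Θ₁) * numOp k) := by
  have hP := specProj_conjTranspose (L := L) p v (B := Set.Icc p.Θ₀ Θ₁)
  have hPP := specProj_mul_self (L := L) p v (B := Set.Icc p.Θ₀ Θ₁)
  set R := specProj p L v (Set.Icc p.Θ₀ Θ₁)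
  have : (R * numOp k)ᴴ * (R * numOp k) = numOp k * R * numOp k := by
    rw [Matrix.conjTranspose_mul, hP, numOp_conjTranspose]
    calc numOp k * R * (R * numOp k) = numOp k * (R * R) * numOp k := by
          simp only [Matrix.mul_assoc]
      _ = _ := by rw [hPP]
  rw [this]
  exact (Complex.re_le_norm _).trans (norm_trace_le_traceNorm _)

lemma traceNorm_mul_le_of_le_one_left {A : Op L} (hA : ‖A‖ ≤ 1) (M : Op L) :
    traceNorm (A * M) ≤ traceNorm M :=
  (traceNorm_mul_le_norm_mul _ _).trans (mul_le_of_le_one_left (traceNorm_nonneg _) hA)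

lemma ofReal_traceNorm_downProj_specProj_le (S : Set ℤ) (k : Site L) :
    ENNReal.ofReal (traceNorm (downProj L S * specProj p L v (Set.Icc p.Θ₀ Θ₁) * numOp k)) ≤
      ∑ i ∈ sitesIn L S, corr p L v (Set.Icc p.Θ₀ Θ₁) i k := by
  rw [Matrix.mul_assoc]
  refine (ENNReal.ofReal_le_ofReal (traceNorm_downProj_mul_le _ S)).trans ?_
  rw [ofReal_sum_traceNorm]
  refine Finset.sum_le_sum fun i _ => ?_
  rw [← Matrix.mul_assoc, ← winEvol_zero]
  exact ofReal_traceNorm_le_corr i k 0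

/-- In `D E R` both spin-down projections are on the same side of `R`, so Property DL does not apply
directly. As `R` avoids the vacuum, some site `k` on its right is down: for `k ≤ a` keep `E`, for `k
≥ b` keep `D`, and for `k` in between use the Hilbert–Schmidt norms. -/
lemma ofReal_traceNorm_pair_le {a b : ℤ} :
    ENNReal.ofReal (traceNorm (downProj L (Set.Iic a) * downProj L (Set.Ici b) *
      specProj p L v (Set.Icc p.Θ₀ Θ₁))) ≤ pairErr p Θ₁ m v L a b := by
  classical
  set R := specProj p L v (Set.Icc p.Θ₀ Θ₁) with hR
  have hRv : R * downProj L Set.univ = R := by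
    have h := winEvol_mul_vacProj (L := L) p v Θ₁ 0
    rw [winEvol_zero, vacProj, Matrix.mul_sub, Matrix.mul_one, sub_eq_zero] at h
    exact h.symm
  have hPP : R * R = R := specProj_mul_self (L := L) p v
  have hcomm := downProj_mul_comm (L := L) (Set.Iic a) (Set.Ici b)
  have hDle := norm_downProj_le (L := L) (Set.Iic a)
  have hEle := norm_downProj_le (L := L) (Set.Ici b)
  set D := downProj L (Set.Iic a) with hD
  set E := downProj L (Set.Ici b) with hE
  have h0 : traceNorm (D * E * R) ≤ ∑ k ∈ sitesIn L Set.univ, traceNorm (D * E * R * numOp k) := by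
    have := traceNorm_mul_downProj_le (D * E * R) Set.univ
    rwa [Matrix.mul_assoc, hRv] at this
  refine (ENNReal.ofReal_le_ofReal h0).trans ?_
  rw [ofReal_sum_traceNorm]
  set f : Site L → ℝ≥0∞ := fun k => ENNReal.ofReal (traceNorm (D * E * R * numOp k)) with hf
  have hleft : ∀ k, f k ≤ ∑ j ∈ sitesIn L (Set.Ici b), corr p L v (Set.Icc p.Θ₀ Θ₁) j k := by
    intro k
    refine le_trans (ENNReal.ofReal_le_ofReal ?_) (ofReal_traceNorm_downProj_specProj_le _ k)
    have e : D * E * R * numOp k = D * (E * R * numOp k) := by simp only [Matrix.mul_assoc]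
    rw [e]
    exact traceNorm_mul_le_of_le_one_left hDle _
  have hright : ∀ k, f k ≤ ∑ i ∈ sitesIn L (Set.Iic a), corr p L v (Set.Icc p.Θ₀ Θ₁) i k := by
    intro k
    refine le_trans (ENNReal.ofReal_le_ofReal ?_) (ofReal_traceNorm_downProj_specProj_le _ k)
    have e : D * E * R * numOp k = E * (D * R * numOp k) := by
      rw [hcomm]; simp only [Matrix.mul_assoc]
    rw [e]
    exact traceNorm_mul_le_of_le_one_left hEle _
  -- `D E R 𝒩ₖ = (D E R)(R 𝒩ₖ)`. The first factor has small Hilbert–Schmidt norm and the second a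
  -- bounded one in expectation; the weight `e^{m(b-a)/2}` balances the two.
  have hmid : ∀ k, f k ≤ ENNReal.ofReal (Real.exp (m * (b - a) / 2)) * corrSum p Θ₁ v L a b +
      ENNReal.ofReal (Real.exp (m * (b - a) / 2))⁻¹ * corr p L v (Set.Icc p.Θ₀ Θ₁) k k := by
    intro k
    have hs : 0 < Real.exp (m * (b - a) / 2) := Real.exp_pos _
    have h1 := traceNorm_mul_le_hilbertSchmidt hs (D * E * R) (R * numOp k)
    have h2 := re_trace_pair_le (p := p) (Θ₁ := Θ₁) (v := v) (L := L) (Set.Iic a) (Set.Ici b)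
    have h3 := re_trace_site_le (p := p) (Θ₁ := Θ₁) (v := v) k
    rw [← hR, ← hD, ← hE] at h2
    rw [← hR] at h3
    have e : D * E * R * (R * numOp k) = D * E * R * numOp k := by
      calc D * E * R * (R * numOp k) = D * E * (R * R) * numOp k := by
            simp only [Matrix.mul_assoc]
        _ = _ := by rw [hPP]
    rw [e] at h1
    have h4 : traceNorm (D * E * R * numOp k) ≤ Real.exp (m * (b - a) / 2) *
        traceNorm (D * R * E) + (Real.exp (m * (b - a) / 2))⁻¹ *
          traceNorm (numOp k * R * numOp k) :=
      h1.trans (add_le_add (mul_le_mul_of_nonneg_left h2 hs.le)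
        (mul_le_mul_of_nonneg_left h3 (inv_nonneg.2 hs.le)))
    refine (ENNReal.ofReal_le_ofReal h4).trans ?_
    refine ENNReal.ofReal_add_le.trans ?_
    rw [ENNReal.ofReal_mul hs.le, ENNReal.ofReal_mul (inv_nonneg.2 hs.le)]
    have h5 := ofReal_traceNorm_left_right_le (p := p) (Θ₁ := Θ₁) (v := v) (L := L) a b 0
    have h6 := ofReal_traceNorm_le_corr (p := p) (Θ₁ := Θ₁) (v := v) k k 0
    rw [winEvol_zero] at h5 h6
    exact add_le_add (mul_le_mul_right h5 _) (mul_le_mul_right h6 _)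
  have hcover : sitesIn L Set.univ ⊆
      (sitesIn L (Set.Iic a) ∪ sitesIn L (Set.Ici b)) ∪ sitesIn L (Set.Ioo a b) := by
    intro k _
    simp only [Finset.mem_union, mem_sitesIn, Set.mem_Iic, Set.mem_Ici, Set.mem_Ioo]
    omega
  have hunion : ∀ s t : Finset (Site L), ∑ k ∈ s ∪ t, f k ≤ ∑ k ∈ s, f k + ∑ k ∈ t, f k := by
    intro s t
    rw [← Finset.sum_union_inter]
    exact le_self_add
  calc ∑ k ∈ sitesIn L Set.univ, f k
      ≤ ∑ k ∈ (sitesIn L (Set.Iic a) ∪ sitesIn L (Set.Ici b)) ∪ sitesIn L (Set.Ioo a b), f k :=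
        Finset.sum_le_sum_of_subset hcover
    _ ≤ (∑ k ∈ sitesIn L (Set.Iic a), f k + ∑ k ∈ sitesIn L (Set.Ici b), f k) +
          ∑ k ∈ sitesIn L (Set.Ioo a b), f k :=
        (hunion _ _).trans (add_le_add (hunion _ _) le_rfl)
    _ ≤ _ := by
        refine add_le_add ?_ (Finset.sum_le_sum fun k _ => hmid k)
        have e : corrSum p Θ₁ v L a b =
            ∑ k ∈ sitesIn L (Set.Iic a), (∑ j ∈ sitesIn L (Set.Ici b),
              corr p L v (Set.Icc p.Θ₀ Θ₁) j k) +
            ∑ k ∈ sitesIn L (Set.Ici b), (∑ i ∈ sitesIn L (Set.Iic a),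
              corr p L v (Set.Icc p.Θ₀ Θ₁) i k) := by
          rw [corrSum, Finset.sum_comm (s := sitesIn L (Set.Ici b)), ← Finset.sum_add_distrib]
          refine Finset.sum_congr rfl fun i _ => ?_
          rw [← Finset.sum_add_distrib]
          exact Finset.sum_congr rfl fun j _ => add_comm _ _
        rw [e]
        exact add_le_add (Finset.sum_le_sum fun k _ => hleft k)
          (Finset.sum_le_sum fun k _ => hright k)

lemma downProj_mul_vacProj (S : Set ℤ) : downProj L S * vacProj L = 0 := by
  have h := one_sub_downProj_mul_of_subset (L := L) (Set.subset_univ S)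
  rw [← vacProj, Matrix.sub_mul, Matrix.one_mul, sub_eq_self] at h
  exact h

/-- Centered observables with supports to the left of `a` and to the right of `b` are decoupled
within the energy window, up to `totalErr`. -/
lemma IsCentered.ofReal_traceNorm_le (hv : ∀ i, 0 ≤ v i) (hΘ : p.Θ₀ < Θ₁) {A B : Op L}
    {lo hi lo' hi' : ℤ} (hA : IsCentered A lo hi) (hB : IsCentered B lo' hi') (h : hi < lo')
    (t : ℝ) :
    ENNReal.ofReal (traceNorm (specProj p L v (Set.Icc 0 Θ₁) * A *
      winEvol p L v (Set.Icc p.Θ₀ Θ₁) t * B * specProj p L v (Set.Icc 0 Θ₁))) ≤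
      ENNReal.ofReal (‖A‖ * ‖B‖) * totalErr p Θ₁ m v L hi lo' ∧
    ENNReal.ofReal (traceNorm (specProj p L v (Set.Icc 0 Θ₁) * B *
      winEvol p L v (Set.Icc p.Θ₀ Θ₁) t * A * specProj p L v (Set.Icc 0 Θ₁))) ≤
      ENNReal.ofReal (‖A‖ * ‖B‖) * totalErr p Θ₁ m v L hi lo' := by
  -- The gap is cut into thirds: up to `hi + q` counts as near `A`, from `lo' - q` on as near `B`.
  -- The shifts by one make `T` and `T'` the exact complements of these regions and keep them off
  -- the supports even for `q = 0`.
  set q := (lo' - hi) / 3 with hq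
  have hQ := norm_specProj_le (L := L) p v (B := Set.Icc 0 Θ₁)
  have hQs := specProj_conjTranspose (L := L) p v (B := Set.Icc 0 Θ₁)
  have hU := norm_winEvol_le (L := L) p v (B := Set.Icc p.Θ₀ Θ₁) t
  have hvU := vacProj_mul_winEvol (L := L) p v Θ₁ t
  have hUv := winEvol_mul_vacProj (L := L) p v Θ₁ t
  have hS : Set.Icc lo hi ⊆ Set.Iic hi := fun i hi => hi.2
  have hS' : Set.Icc lo' hi' ⊆ Set.Ici lo' := fun i hi => hi.1
  have hST : ∀ i ∈ Set.Ici (hi + q + 1), i ∉ Set.Iic hi := by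
    intro i h1 h2
    simp only [Set.mem_Ici, Set.mem_Iic] at h1 h2
    omega
  have hST' : ∀ i ∈ Set.Iic (lo' - q - 1), i ∉ Set.Ici lo' := by
    intro i h1 h2
    simp only [Set.mem_Ici, Set.mem_Iic] at h1 h2
    omega
  have hc1 : (Set.Ici (hi + q + 1))ᶜ = Set.Iic (hi + q) := by
    ext i; simp only [Set.mem_compl_iff, Set.mem_Ici, Set.mem_Iic]; omega
  have hc2 : (Set.Iic (lo' - q - 1))ᶜ = Set.Ici (lo' - q) := by
    ext i; simp only [Set.mem_compl_iff, Set.mem_Ici, Set.mem_Iic]; omega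
  -- A spin-down projection annihilates the vacuum, so beside it the windows `[0, Θ₁]` and `[Θ₀,
  -- Θ₁]` agree.
  have hpair : ∀ S T : Set ℤ, downProj L S * downProj L T * specProj p L v (Set.Icc 0 Θ₁) =
      downProj L S * downProj L T * specProj p L v (Set.Icc p.Θ₀ Θ₁) := by
    intro S T
    rw [specProj_Icc_zero p hv hΘ, Matrix.mul_add, Matrix.mul_assoc _ _ (vacProj L),
      downProj_mul_vacProj, Matrix.mul_zero, add_zero]
  have p1 := ofReal_traceNorm_pair_le (p := p) (Θ₁ := Θ₁) (m := m) (v := v) (L := L) (a := hi)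
    (b := hi + q + 1)
  have p2 := ofReal_traceNorm_pair_le (p := p) (Θ₁ := Θ₁) (m := m) (v := v) (L := L)
    (a := lo' - q - 1) (b := lo')
  have h1 := hA.traceNorm_mul_le hB hQ hQs hU hvU hUv hS hST hS' hST'
  have h2 := hB.traceNorm_mul_le hA hQ hQs hU hvU hUv hS' hST' hS hST
  rw [hpair, hpair, downProj_mul_comm (Set.Ici lo'), hc1, hc2] at h1 h2
  have hAB : 0 ≤ ‖A‖ * ‖B‖ := by positivity
  constructor
  · refine (ENNReal.ofReal_le_ofReal h1).trans ?_
    rw [ENNReal.ofReal_mul hAB]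
    refine mul_le_mul_right ?_ _
    refine ENNReal.ofReal_add_le.trans (add_le_add (ENNReal.ofReal_add_le.trans
      (add_le_add p1 p2)) (ofReal_traceNorm_left_right_le _ _ t))
  · refine (ENNReal.ofReal_le_ofReal h2).trans ?_
    rw [mul_comm ‖B‖, ENNReal.ofReal_mul hAB]
    refine mul_le_mul_right ?_ _
    refine ENNReal.ofReal_add_le.trans (add_le_add (ENNReal.ofReal_add_le.trans
      ?_) (ofReal_traceNorm_right_left_le _ _ t))
    rw [add_comm]
    exact add_le_add p1 p2

end Errors

end XXZ

namespace XXZ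

/-! ### Expectations of the error bounds -/

section Expectations

lemma sum_exp_neg_mul_le {ι : Type*} (s : Finset ι) {f : ι → ℕ} (hf : Set.InjOn f s) {m : ℝ}
    (hm : 0 < m) : ∑ i ∈ s, Real.exp (-m * f i) ≤ (1 - Real.exp (-m))⁻¹ := by
  have h1 : Real.exp (-m) < 1 := by
    rw [Real.exp_lt_one_iff]; linarith
  have h2 : ∀ k : ℕ, Real.exp (-m * k) = Real.exp (-m) ^ k := fun k => by
    rw [← Real.exp_nat_mul, mul_comm]
  rw [← tsum_geometric_of_lt_one (Real.exp_nonneg _) h1]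
  simp only [h2]
  rw [← Finset.sum_image (f := fun k => Real.exp (-m) ^ k) hf]
  exact (summable_geometric_of_lt_one (Real.exp_nonneg _) h1).sum_le_tsum _
    fun k _ => by positivity

variable {L : ℕ} {m : ℝ}

lemma sum_Iic_exp_le (hm : 0 < m) (a : ℤ) :
    ∑ i ∈ sitesIn L (Set.Iic a), Real.exp (-m * ((a - i.1 : ℤ) : ℝ)) ≤
      (1 - Real.exp (-m))⁻¹ := by
  refine le_of_eq_of_le (Finset.sum_congr rfl fun i hi => ?_)
    (sum_exp_neg_mul_le (sitesIn L (Set.Iic a)) (f := fun i => (a - i.1).toNat) ?_ hm)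
  · have h : i.1 ≤ a := mem_sitesIn.1 hi
    congr 2
    have : ((a - i.1).toNat : ℤ) = a - i.1 := Int.toNat_of_nonneg (by omega)
    exact_mod_cast this.symm
  · intro i hi j hj h
    have h1 : i.1 ≤ a := mem_sitesIn.1 hi
    have h2 : j.1 ≤ a := mem_sitesIn.1 hj
    simp only at h
    exact Subtype.ext (by omega)

lemma sum_Ici_exp_le (hm : 0 < m) (b : ℤ) :
    ∑ j ∈ sitesIn L (Set.Ici b), Real.exp (-m * ((j.1 - b : ℤ) : ℝ)) ≤
      (1 - Real.exp (-m))⁻¹ := by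
  refine le_of_eq_of_le (Finset.sum_congr rfl fun i hi => ?_)
    (sum_exp_neg_mul_le (sitesIn L (Set.Ici b)) (f := fun i => (i.1 - b).toNat) ?_ hm)
  · have h : b ≤ i.1 := mem_sitesIn.1 hi
    congr 2
    have : ((i.1 - b).toNat : ℤ) = i.1 - b := Int.toNat_of_nonneg (by omega)
    exact_mod_cast this.symm
  · intro i hi j hj h
    have h1 : b ≤ i.1 := mem_sitesIn.1 hi
    have h2 : b ≤ j.1 := mem_sitesIn.1 hj
    simp only at h
    exact Subtype.ext (by omega)

/-- For `i ≤ a < b ≤ j` the distance splits as `(a - i) + (b - a) + (j - b)`, leaving two geometric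
series that are bounded uniformly in `L`. -/
lemma sum_sum_exp_le (hm : 0 < m) {a b : ℤ} (hab : a < b) :
    ∑ i ∈ sitesIn L (Set.Iic a), ∑ j ∈ sitesIn L (Set.Ici b),
      Real.exp (-m * |((i.1 - j.1 : ℤ) : ℝ)|) ≤
      ((1 - Real.exp (-m))⁻¹) ^ 2 * Real.exp (-m * ((b - a : ℤ) : ℝ)) := by
  have h1 := sum_Iic_exp_le (L := L) hm a
  have h2 := sum_Ici_exp_le (L := L) hm b
  have hD : 0 ≤ (1 - Real.exp (-m))⁻¹ :=
    (Finset.sum_nonneg fun i _ => (Real.exp_nonneg _)).trans h1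
  have e : ∑ i ∈ sitesIn L (Set.Iic a), ∑ j ∈ sitesIn L (Set.Ici b),
      Real.exp (-m * |((i.1 - j.1 : ℤ) : ℝ)|) =
      (∑ i ∈ sitesIn L (Set.Iic a), Real.exp (-m * ((a - i.1 : ℤ) : ℝ))) *
        (∑ j ∈ sitesIn L (Set.Ici b), Real.exp (-m * ((j.1 - b : ℤ) : ℝ))) *
        Real.exp (-m * ((b - a : ℤ) : ℝ)) := by
    rw [Finset.sum_mul_sum, Finset.sum_mul]
    refine Finset.sum_congr rfl fun i hi => ?_
    rw [Finset.sum_mul]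
    refine Finset.sum_congr rfl fun j hj => ?_
    have hi' : i.1 ≤ a := mem_sitesIn.1 hi
    have hj' : b ≤ j.1 := mem_sitesIn.1 hj
    have hneg : ((i.1 - j.1 : ℤ) : ℝ) ≤ 0 := by exact_mod_cast (by omega : i.1 - j.1 ≤ 0)
    rw [← Real.exp_add, ← Real.exp_add, abs_of_nonpos hneg]
    congr 1
    push_cast
    ring
  rw [e, pow_two]
  refine mul_le_mul_of_nonneg_right (mul_le_mul h1 h2 ?_ hD) (Real.exp_nonneg _)
  exact Finset.sum_nonneg fun i _ => Real.exp_nonneg _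

/-! ### Expected errors under droplet localization -/

variable {Ω : Type*} [MeasurableSpace Ω] {P : Measure Ω} {ω : ℤ → Ω → ℝ} {p : Params} {Θ₁ C : ℝ}

lemma measurable_corrSum (hω : ∀ i, Measurable (ω i)) (a b : ℤ) :
    Measurable fun w => corrSum p Θ₁ (fun k => ω k w) L a b := by
  unfold corrSum
  exact Finset.measurable_sum _ fun i _ => Finset.measurable_sum _ fun j _ =>
    (measurable_corr hω p L _ _ i j).add (measurable_corr hω p L _ _ j i)

lemma measurable_pairErr (hω : ∀ i, Measurable (ω i)) (a b : ℤ) :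
    Measurable fun w => pairErr p Θ₁ m (fun k => ω k w) L a b := by
  unfold pairErr
  exact (measurable_corrSum hω a b).add (Finset.measurable_sum _ fun k _ =>
    ((measurable_corrSum hω a b).const_mul _).add ((measurable_corr hω p L _ _ k k).const_mul _))

lemma measurable_totalErr (hω : ∀ i, Measurable (ω i)) (a b : ℤ) :
    Measurable fun w => totalErr p Θ₁ m (fun k => ω k w) L a b := by
  unfold totalErr
  exact ((measurable_pairErr hω _ _).add (measurable_pairErr hω _ _)).add
    (measurable_corrSum hω _ _)

/-- The prefactor in the expectation of `corrSum`. -/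
noncomputable def corrConst (C m : ℝ) : ℝ := 2 * |C| * ((1 - Real.exp (-m))⁻¹) ^ 2

lemma corrConst_nonneg : 0 ≤ corrConst C m := by unfold corrConst; positivity

lemma lintegral_corrSum_le (hω : ∀ i, Measurable (ω i)) (hDL : PropertyDL p P ω Θ₁ C m) {a b : ℤ}
    (hab : a < b) : ∫⁻ w, corrSum p Θ₁ (fun k => ω k w) L a b ∂P ≤
      ENNReal.ofReal (corrConst C m * Real.exp (-m * ((b - a : ℤ) : ℝ))) := by
  have hmeas := fun i j : Site L => measurable_corr hω p L p.Θ₀ Θ₁ i j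
  have h1 : ∫⁻ w, corrSum p Θ₁ (fun k => ω k w) L a b ∂P =
      ∑ i ∈ sitesIn L (Set.Iic a), ∑ j ∈ sitesIn L (Set.Ici b),
        (∫⁻ w, corr p L (fun k => ω k w) (Set.Icc p.Θ₀ Θ₁) i j ∂P +
          ∫⁻ w, corr p L (fun k => ω k w) (Set.Icc p.Θ₀ Θ₁) j i ∂P) := by
    unfold corrSum
    rw [lintegral_finsetSum _ fun i _ => Finset.measurable_sum _ fun j _ =>
      (hmeas i j).fun_add (hmeas j i)]
    refine Finset.sum_congr rfl fun i _ => ?_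
    rw [lintegral_finsetSum _ fun j _ => (hmeas i j).fun_add (hmeas j i)]
    exact Finset.sum_congr rfl fun j _ => lintegral_add_left (hmeas i j) _
  have h2 : ∀ i j : Site L, (∫⁻ w, corr p L (fun k => ω k w) (Set.Icc p.Θ₀ Θ₁) i j ∂P +
      ∫⁻ w, corr p L (fun k => ω k w) (Set.Icc p.Θ₀ Θ₁) j i ∂P) ≤
      ENNReal.ofReal (2 * |C| * Real.exp (-m * |((i.1 - j.1 : ℤ) : ℝ)|)) := by
    intro i j
    have h3 := hDL.lintegral_corr_le L i j
    have h4 := hDL.lintegral_corr_le L j i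
    have e : |((j.1 - i.1 : ℤ) : ℝ)| = |((i.1 - j.1 : ℤ) : ℝ)| := by
      push_cast; exact abs_sub_comm _ _
    rw [e] at h4
    refine (add_le_add h3 h4).trans_eq ?_
    rw [← ENNReal.ofReal_add (by positivity) (by positivity)]
    congr 1
    ring
  rw [h1]
  refine (Finset.sum_le_sum fun i _ => Finset.sum_le_sum fun j _ => h2 i j).trans ?_
  have h3 : ∀ i : Site L, ∑ j ∈ sitesIn L (Set.Ici b),
      ENNReal.ofReal (2 * |C| * Real.exp (-m * |((i.1 - j.1 : ℤ) : ℝ)|)) =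
      ENNReal.ofReal (∑ j ∈ sitesIn L (Set.Ici b),
        2 * |C| * Real.exp (-m * |((i.1 - j.1 : ℤ) : ℝ)|)) := fun i =>
    (ENNReal.ofReal_sum_of_nonneg fun j _ => by positivity).symm
  simp only [h3]
  rw [← ENNReal.ofReal_sum_of_nonneg fun i _ => Finset.sum_nonneg fun j _ =>
    mul_nonneg (mul_nonneg zero_le_two (abs_nonneg C)) (Real.exp_nonneg _)]
  refine ENNReal.ofReal_le_ofReal ?_
  simp only [← Finset.mul_sum]
  rw [corrConst, mul_assoc (2 * |C|)]
  exact mul_le_mul_of_nonneg_left (sum_sum_exp_le hDL.m_pos hab)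
    (mul_nonneg zero_le_two (abs_nonneg C))

lemma card_sitesIn_Ioo_le {a b : ℤ} (hab : a < b) :
    ((sitesIn L (Set.Ioo a b)).card : ℝ) ≤ ((b - a : ℤ) : ℝ) := by
  have h : (sitesIn L (Set.Ioo a b)).card ≤ (Finset.Ioo a b).card :=
    Finset.card_le_card_of_injOn (fun i => i.1)
      (fun i hi => Finset.mem_coe.2 (Finset.mem_Ioo.2 (mem_sitesIn.1 hi)))
      (fun i _ j _ h => Subtype.ext h)
  rw [Int.card_Ioo] at h
  have : ((sitesIn L (Set.Ioo a b)).card : ℤ) ≤ b - a := by omega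
  exact_mod_cast this

/-- The prefactor in the expectation of `pairErr`. -/
noncomputable def pairConst (C m : ℝ) : ℝ := corrConst C m + 8 / m * (corrConst C m + |C|)

lemma pairConst_nonneg (hm : 0 < m) : 0 ≤ pairConst C m := by
  have := corrConst_nonneg (C := C) (m := m)
  unfold pairConst; positivity

/-- Absorbs the number of intermediate sites: `u e^{-u} ≤ 1` at `u = m r / 8` reduces the rate from
`1/2` to `3/8`. -/
lemma mul_exp_neg_half_le (hm : 0 < m) (r : ℝ) :
    r * Real.exp (-m * r / 2) ≤ 8 / m * Real.exp (-(3 / 8) * m * r) := by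
  have h1 : Real.exp (-m * r / 2) = Real.exp (-(m * r / 8)) * Real.exp (-(3 / 8) * m * r) := by
    rw [← Real.exp_add]; congr 1; ring
  have h2 : m * r / 8 ≤ Real.exp (m * r / 8) := by linarith [Real.add_one_le_exp (m * r / 8)]
  have h3 : m * r / 8 * Real.exp (-(m * r / 8)) ≤ 1 := by
    rw [Real.exp_neg, ← div_eq_mul_inv, div_le_one (Real.exp_pos _)]
    exact h2
  have h4 : r * Real.exp (-(m * r / 8)) ≤ 8 / m := by
    calc r * Real.exp (-(m * r / 8)) = 8 / m * (m * r / 8 * Real.exp (-(m * r / 8))) := by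
          field_simp
      _ ≤ 8 / m * 1 := by gcongr
      _ = 8 / m := mul_one _
  rw [h1, ← mul_assoc]
  exact mul_le_mul_of_nonneg_right h4 (Real.exp_nonneg _)

lemma lintegral_pairErr_le (hω : ∀ i, Measurable (ω i)) (hDL : PropertyDL p P ω Θ₁ C m) {a b : ℤ}
    (hab : a < b) : ∫⁻ w, pairErr p Θ₁ m (fun k => ω k w) L a b ∂P ≤
      ENNReal.ofReal (pairConst C m * Real.exp (-(3 / 8) * m * ((b - a : ℤ) : ℝ))) := by
  have hm := hDL.m_pos
  have hX := corrConst_nonneg (C := C) (m := m)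
  have hcs := measurable_corrSum (L := L) (p := p) (Θ₁ := Θ₁) hω a b
  have hck := fun k : Site L => measurable_corr hω p L p.Θ₀ Θ₁ k k
  have hE := lintegral_corrSum_le (L := L) hω hDL hab
  have hk := fun k : Site L => hDL.lintegral_corr_le L k k
  set X := corrConst C m with hXdef
  set r : ℝ := ((b - a : ℤ) : ℝ) with hr
  have hr0 : 0 ≤ r := by
    have : (0 : ℤ) ≤ b - a := by omega
    rw [hr]
    exact_mod_cast this
  -- With this weight, `s e^{-mr}` and `s⁻¹` both equal `e^{-mr/2}`.
  set s := Real.exp (m * (b - a) / 2) with hs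
  have hspos : 0 < s := Real.exp_pos _
  have hs1 : s * Real.exp (-m * r) = Real.exp (-m * r / 2) := by
    rw [hs, ← Real.exp_add]; congr 1; rw [hr]; push_cast; ring
  have hs2 : s⁻¹ = Real.exp (-m * r / 2) := by
    rw [hs, ← Real.exp_neg]; congr 1; rw [hr]; push_cast; ring
  have hterm : ∀ k : Site L, ∫⁻ w, (ENNReal.ofReal s * corrSum p Θ₁ (fun k => ω k w) L a b +
      ENNReal.ofReal s⁻¹ * corr p L (fun k => ω k w) (Set.Icc p.Θ₀ Θ₁) k k) ∂P ≤
      ENNReal.ofReal (Real.exp (-m * r / 2) * (X + |C|)) := by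
    intro k
    rw [lintegral_add_left (hcs.const_mul _), lintegral_const_mul _ hcs,
      lintegral_const_mul _ (hck k)]
    have h1 := hk k
    rw [sub_self, Int.cast_zero, abs_zero, mul_zero, Real.exp_zero, mul_one] at h1
    refine (add_le_add (mul_le_mul_right hE _) (mul_le_mul_right h1 _)).trans_eq ?_
    rw [← ENNReal.ofReal_mul hspos.le, ← ENNReal.ofReal_mul (inv_nonneg.2 hspos.le),
      ← ENNReal.ofReal_add (by positivity) (by positivity)]
    congr 1
    rw [hs2, ← hs1]
    ring
  unfold pairErr
  rw [lintegral_add_left hcs, lintegral_finsetSum _ fun k _ =>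
    (hcs.const_mul _).fun_add ((hck k).const_mul _)]
  refine (add_le_add hE (Finset.sum_le_sum fun k _ => hterm k)).trans ?_
  rw [Finset.sum_const, nsmul_eq_mul, ← ENNReal.ofReal_natCast, ← ENNReal.ofReal_mul (by positivity),
    ← ENNReal.ofReal_add (by positivity) (by positivity)]
  refine ENNReal.ofReal_le_ofReal ?_
  have h1 : Real.exp (-m * r) ≤ Real.exp (-(3 / 8) * m * r) := by
    refine Real.exp_le_exp.2 ?_
    nlinarith [mul_nonneg hm.le hr0]
  have h2 := mul_exp_neg_half_le hm r
  have h3 := card_sitesIn_Ioo_le (L := L) hab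
  have hXC : 0 ≤ X + |C| := by positivity
  calc X * Real.exp (-m * r) + ((sitesIn L (Set.Ioo a b)).card : ℝ) *
        (Real.exp (-m * r / 2) * (X + |C|))
      ≤ X * Real.exp (-(3 / 8) * m * r) + r * (Real.exp (-m * r / 2) * (X + |C|)) := by gcongr
    _ = X * Real.exp (-(3 / 8) * m * r) + (r * Real.exp (-m * r / 2)) * (X + |C|) := by ring
    _ ≤ X * Real.exp (-(3 / 8) * m * r) +
          (8 / m * Real.exp (-(3 / 8) * m * r)) * (X + |C|) := by gcongr
    _ = pairConst C m * Real.exp (-(3 / 8) * m * r) := by rw [pairConst, ← hXdef]; ring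

/-- The prefactor in the expectation of `totalErr`. -/
noncomputable def totalConst (C m : ℝ) : ℝ := 2 * pairConst C m + corrConst C m

lemma totalConst_nonneg (hm : 0 < m) : 0 ≤ totalConst C m := by
  have := corrConst_nonneg (C := C) (m := m)
  have := pairConst_nonneg (C := C) hm
  unfold totalConst; positivity

/-- Each piece bridges at least a third of `b - a`; since `(3/8) / 3 = 1/8`, the pair errors fix the
final rate. -/
lemma lintegral_totalErr_le (hω : ∀ i, Measurable (ω i)) (hDL : PropertyDL p P ω Θ₁ C m) {a b : ℤ}
    (hab : a < b) {d : ℝ} (hd : d ≤ ((b - a : ℤ) : ℝ)) :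
    ∫⁻ w, totalErr p Θ₁ m (fun k => ω k w) L a b ∂P ≤
      ENNReal.ofReal (totalConst C m * Real.exp (-(1 / 8) * m * d)) := by
  have hm := hDL.m_pos
  have hX := corrConst_nonneg (C := C) (m := m)
  have hY := pairConst_nonneg (C := C) hm
  set q := (b - a) / 3 with hq
  have hq1 : ((b - a : ℤ) : ℝ) ≤ 3 * ((q + 1 : ℤ) : ℝ) := by
    have : b - a ≤ 3 * (q + 1) := by omega
    exact_mod_cast this
  have hq2 : ((b - a : ℤ) : ℝ) ≤ 3 * ((b - a - 2 * q : ℤ) : ℝ) := by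
    have : b - a ≤ 3 * (b - a - 2 * q) := by omega
    exact_mod_cast this
  have hr0 : (0 : ℝ) ≤ ((b - a : ℤ) : ℝ) := by exact_mod_cast (by omega : (0 : ℤ) ≤ b - a)
  have h1 := lintegral_pairErr_le (L := L) hω hDL (a := a) (b := a + q + 1) (by omega)
  have h2 := lintegral_pairErr_le (L := L) hω hDL (a := b - q - 1) (b := b) (by omega)
  have h3 := lintegral_corrSum_le (L := L) hω hDL (a := a + q) (b := b - q) (by omega)
  rw [show a + q + 1 - a = q + 1 by ring] at h1
  rw [show b - (b - q - 1) = q + 1 by ring] at h2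
  rw [show b - q - (a + q) = b - a - 2 * q by ring] at h3
  unfold totalErr
  rw [lintegral_add_left ((measurable_pairErr hω _ _).fun_add (measurable_pairErr hω _ _)),
    lintegral_add_left (measurable_pairErr hω _ _)]
  refine (add_le_add (add_le_add h1 h2) h3).trans ?_
  rw [← ENNReal.ofReal_add (by positivity) (by positivity),
    ← ENNReal.ofReal_add (by positivity) (by positivity)]
  refine ENNReal.ofReal_le_ofReal ?_
  have e1 : Real.exp (-(3 / 8) * m * ((q + 1 : ℤ) : ℝ)) ≤ Real.exp (-(1 / 8) * m * d) := by
    refine Real.exp_le_exp.2 ?_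
    have := mul_le_mul_of_nonneg_left (hd.trans hq1) hm.le
    linarith
  have e2 : Real.exp (-m * ((b - a - 2 * q : ℤ) : ℝ)) ≤ Real.exp (-(1 / 8) * m * d) := by
    refine Real.exp_le_exp.2 ?_
    have h4 := mul_le_mul_of_nonneg_left hq2 hm.le
    have h5 := mul_le_mul_of_nonneg_left hd hm.le
    have h6 := mul_nonneg hm.le hr0
    linarith
  calc pairConst C m * Real.exp (-(3 / 8) * m * ((q + 1 : ℤ) : ℝ)) +
        pairConst C m * Real.exp (-(3 / 8) * m * ((q + 1 : ℤ) : ℝ)) +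
        corrConst C m * Real.exp (-m * ((b - a - 2 * q : ℤ) : ℝ))
      ≤ pairConst C m * Real.exp (-(1 / 8) * m * d) +
        pairConst C m * Real.exp (-(1 / 8) * m * d) +
        corrConst C m * Real.exp (-(1 / 8) * m * d) := by gcongr
    _ = totalConst C m * Real.exp (-(1 / 8) * m * d) := by rw [totalConst]; ring

end Expectations

end XXZ

namespace XXZ

open scoped Matrix.Norms.L2Operator

/-! ### Commutator algebra -/

/-- Multiples of an element acting as a two-sided unit on `S` and `T` drop out of the commutator.
With `e` a window projection this permits passing to centered observables. -/
lemma lie_add_smul_add_smul {R : Type*} [Ring R] [Algebra ℂ R] {e S T : R} (c d : ℂ)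
    (h1 : e * S = S) (h2 : S * e = S) (h3 : e * T = T) (h4 : T * e = T) :
    ⁅S + c • e, T + d • e⁆ = ⁅S, T⁆ := by
  simp only [Ring.lie_def, add_mul, mul_add, smul_mul_assoc, mul_smul_comm, h1, h2, h3, h4]
  simp only [smul_add, smul_smul, mul_comm d c]
  abel

/-- The splitting of an orthogonal projection `Q = P + O`. -/
structure IsSplit {n : Type*} [Fintype n] [DecidableEq n] (Q P O : Matrix n n ℂ) : Prop where
  eq : Q = P + O
  mul_PP : P * P = P
  mul_OO : O * O = O
  mul_PO : P * O = 0
  mul_OP : O * P = 0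
  norm_Q : ‖Q‖ ≤ 1
  norm_P : ‖P‖ ≤ 1
  norm_O : ‖O‖ ≤ 1

section Split

variable {n : Type*} [Fintype n] [DecidableEq n] {Q P O A B C : Matrix n n ℂ}

lemma IsSplit.mul_QQ (h : IsSplit Q P O) : Q * Q = Q := by
  rw [h.eq, add_mul, mul_add, mul_add, h.mul_PP, h.mul_OO, h.mul_PO, h.mul_OP]
  abel

lemma IsSplit.mul_QP (h : IsSplit Q P O) : Q * P = P := by
  rw [h.eq, add_mul, h.mul_PP, h.mul_OP, add_zero]

lemma IsSplit.mul_PQ (h : IsSplit Q P O) : P * Q = P := by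
  rw [h.eq, mul_add, h.mul_PP, h.mul_PO, add_zero]

lemma IsSplit.mul_QO (h : IsSplit Q P O) : Q * O = O := by
  rw [h.eq, add_mul, h.mul_OO, h.mul_PO, zero_add]

lemma IsSplit.mul_OQ (h : IsSplit Q P O) : O * Q = O := by
  rw [h.eq, mul_add, h.mul_OO, h.mul_OP, zero_add]

lemma IsSplit.window_mul_window (h : IsSplit Q P O) (hA : O * A * O = 0) (hB : O * B * O = 0) :
    (Q * A * Q) * (Q * B * Q) = Q * A * P * B * Q + P * A * O * B * P := by
  have e1 : Q * A * O = P * A * O := by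
    rw [h.eq, add_mul, add_mul, hA, add_zero]
  have e2 : O * B * Q = O * B * P := by
    rw [h.eq, mul_add, hB, add_zero]
  calc (Q * A * Q) * (Q * B * Q) = Q * A * (Q * Q) * B * Q := by simp only [mul_assoc]
    _ = Q * A * (P + O) * B * Q := by rw [h.mul_QQ]; conv_lhs => rw [mul_assoc Q A Q]; rw [h.eq]
                                      rw [h.eq, mul_assoc (P + O) A (P + O)]
    _ = Q * A * P * B * Q + (Q * A * O) * (B * Q) := by
        simp only [mul_add, add_mul, mul_assoc]
    _ = Q * A * P * B * Q + P * A * (O * B * Q) := by rw [e1]; simp only [mul_assoc]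
    _ = _ := by rw [e2]; simp only [mul_assoc]

/-- The middle `Q` is `P + O`. The `O` part cannot return to the vacuum on either outer side, since
`O A O = O B O = 0`, so its outer projections reduce to `P`: this is where the counterterm comes
from. -/
lemma IsSplit.lie_window (h : IsSplit Q P O) (hA : O * A * O = 0) (hB : O * B * O = 0) :
    ⁅Q * A * Q, Q * B * Q⁆ = (Q * A * P * B * Q - Q * B * P * A * Q) +
      P * (A * O * B - B * O * A) * P := by
  rw [Ring.lie_def, h.window_mul_window hA hB, h.window_mul_window hB hA, mul_sub, sub_mul]
  simp only [mul_assoc]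
  abel

lemma IsSplit.traceNorm_lie_window_sub_le (h : IsSplit Q P O) (hA : O * A * O = 0)
    (hB : O * B * O = 0) :
    traceNorm (⁅Q * A * Q, Q * B * Q⁆ - P * (A * O * B - B * O * A) * P) ≤
      traceNorm (Q * A * P * B * Q) + traceNorm (Q * B * P * A * Q) := by
  rw [h.lie_window hA hB, add_sub_cancel_right]
  exact traceNorm_sub_le _ _

/-- In the window without the vacuum the middle projection is already `P`, so no counterterm arises;
the outer projections `P` are compressions of `Q`. -/
lemma IsSplit.traceNorm_lie_small_window_le (h : IsSplit Q P O) :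
    traceNorm ⁅P * A * P, P * B * P⁆ ≤
      traceNorm (Q * A * P * B * Q) + traceNorm (Q * B * P * A * Q) := by
  have e : ∀ A B : Matrix n n ℂ, (P * A * P) * (P * B * P) = P * (Q * A * P * B * Q) * P := by
    intro A B
    calc (P * A * P) * (P * B * P) = P * A * (P * P) * B * P := by simp only [mul_assoc]
      _ = (P * Q) * A * P * B * (Q * P) := by rw [h.mul_PP, h.mul_PQ, h.mul_QP]
      _ = _ := by simp only [mul_assoc]
  rw [Ring.lie_def, e A B, e B A]
  refine (traceNorm_sub_le _ _).trans (add_le_add ?_ ?_) <;>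
  exact traceNorm_mul_mul_le_of_le_one h.norm_P h.norm_P _

lemma norm_mul_mul_le_of_le_one {A C : Matrix n n ℂ} (hA : ‖A‖ ≤ 1) (hC : ‖C‖ ≤ 1)
    (B : Matrix n n ℂ) : ‖A * B * C‖ ≤ ‖B‖ :=
  (norm_mul_le _ _).trans ((mul_le_of_le_one_right (norm_nonneg _) hC).trans
    ((norm_mul_le _ _).trans (mul_le_of_le_one_left (norm_nonneg _) hA)))

lemma traceNorm_lie_le (A B : Matrix n n ℂ) : traceNorm ⁅A, B⁆ ≤ 2 * ‖B‖ * traceNorm A := by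
  rw [Ring.lie_def]
  have h1 := traceNorm_mul_le_mul_norm A B
  have h2 := traceNorm_mul_le_norm_mul B A
  have h3 := traceNorm_sub_le (A * B) (B * A)
  linarith

/-- Absorbing `Q` into its neighbours `P` and `O` exhibits the decoupled factor `Q B P C Q`,
although the counterterm of `A` and `B` is itself not small. -/
lemma IsSplit.traceNorm_counterterm_mul_le (h : IsSplit Q P O) :
    traceNorm (P * A * O * B * P * (Q * C * Q)) ≤ ‖A‖ * traceNorm (Q * B * P * C * Q) := by
  have e : P * A * O * B * P * (Q * C * Q) = (P * A * O) * (Q * B * P * C * Q) := by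
    calc P * A * O * B * P * (Q * C * Q) = P * A * O * B * (P * Q) * C * Q := by
          simp only [mul_assoc]
      _ = P * A * (O * Q) * B * P * C * Q := by rw [h.mul_PQ, h.mul_OQ]
      _ = _ := by simp only [mul_assoc]
  rw [e]
  exact (traceNorm_mul_le_norm_mul _ _).trans (mul_le_mul_of_nonneg_right
    (norm_mul_mul_le_of_le_one h.norm_P h.norm_O A) (traceNorm_nonneg _))

lemma IsSplit.traceNorm_mul_counterterm_le (h : IsSplit Q P O) :
    traceNorm ((Q * C * Q) * (P * A * O * B * P)) ≤ ‖B‖ * traceNorm (Q * C * P * A * Q) := by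
  have e : (Q * C * Q) * (P * A * O * B * P) = (Q * C * P * A * Q) * (O * B * P) := by
    calc (Q * C * Q) * (P * A * O * B * P) = Q * C * (Q * P) * A * O * B * P := by
          simp only [mul_assoc]
      _ = Q * C * P * A * (Q * O) * B * P := by rw [h.mul_QP, h.mul_QO]
      _ = _ := by simp only [mul_assoc]
  rw [e, mul_comm ‖B‖]
  exact (traceNorm_mul_le_mul_norm _ _).trans (mul_le_mul_of_nonneg_left
    (norm_mul_mul_le_of_le_one h.norm_O h.norm_P B) (traceNorm_nonneg _))

lemma IsSplit.traceNorm_lie_lie_le (h : IsSplit Q P O) (hA : O * A * O = 0)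
    (hB : O * B * O = 0) :
    traceNorm ⁅⁅Q * A * Q, Q * B * Q⁆, Q * C * Q⁆ ≤
      2 * ‖C‖ * (traceNorm (Q * A * P * B * Q) + traceNorm (Q * B * P * A * Q)) +
      ‖A‖ * (traceNorm (Q * B * P * C * Q) + traceNorm (Q * C * P * B * Q)) +
      ‖B‖ * (traceNorm (Q * A * P * C * Q) + traceNorm (Q * C * P * A * Q)) := by
  set E := Q * A * P * B * Q - Q * B * P * A * Q with hE
  have e : ⁅⁅Q * A * Q, Q * B * Q⁆, Q * C * Q⁆ = ⁅E, Q * C * Q⁆ +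
      ((P * A * O * B * P * (Q * C * Q) - P * B * O * A * P * (Q * C * Q)) -
        ((Q * C * Q) * (P * A * O * B * P) - (Q * C * Q) * (P * B * O * A * P))) := by
    have e1 : P * (A * O * B - B * O * A) * P = P * A * O * B * P - P * B * O * A * P := by
      rw [mul_sub, sub_mul]; simp only [mul_assoc]
    rw [h.lie_window hA hB, ← hE, e1, Ring.lie_def, Ring.lie_def]
    simp only [add_mul, mul_add, sub_mul, mul_sub]
    abel
  have b1 : traceNorm ⁅E, Q * C * Q⁆ ≤
      2 * ‖C‖ * (traceNorm (Q * A * P * B * Q) + traceNorm (Q * B * P * A * Q)) := by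
    refine (traceNorm_lie_le _ _).trans ?_
    refine mul_le_mul (mul_le_mul_of_nonneg_left
      (norm_mul_mul_le_of_le_one h.norm_Q h.norm_Q C) zero_le_two) (traceNorm_sub_le _ _)
      (traceNorm_nonneg _) (by positivity)
  have b2 := h.traceNorm_counterterm_mul_le (A := A) (B := B) (C := C)
  have b3 := h.traceNorm_counterterm_mul_le (A := B) (B := A) (C := C)
  have b4 := h.traceNorm_mul_counterterm_le (A := A) (B := B) (C := C)
  have b5 := h.traceNorm_mul_counterterm_le (A := B) (B := A) (C := C)
  rw [e]
  have t1 := traceNorm_add_le ⁅E, Q * C * Q⁆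
    ((P * A * O * B * P * (Q * C * Q) - P * B * O * A * P * (Q * C * Q)) -
        ((Q * C * Q) * (P * A * O * B * P) - (Q * C * Q) * (P * B * O * A * P)))
  have t2 := traceNorm_sub_le
    (P * A * O * B * P * (Q * C * Q) - P * B * O * A * P * (Q * C * Q))
    ((Q * C * Q) * (P * A * O * B * P) - (Q * C * Q) * (P * B * O * A * P))
  have t3 := traceNorm_sub_le (P * A * O * B * P * (Q * C * Q)) (P * B * O * A * P * (Q * C * Q))
  have t4 := traceNorm_sub_le ((Q * C * Q) * (P * A * O * B * P))
    ((Q * C * Q) * (P * B * O * A * P))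
  rw [mul_add ‖A‖, mul_add ‖B‖]
  linarith

end Split

/-! ### Heisenberg evolution -/

section Evol

variable {L : ℕ} {p : Params} {v : ℤ → ℝ} {Θ₁ m : ℝ}

lemma isSplit_specProj (hv : ∀ i, 0 ≤ v i) (hΘ : p.Θ₀ < Θ₁) :
    IsSplit (specProj p L v (Set.Icc 0 Θ₁)) (specProj p L v (Set.Icc p.Θ₀ Θ₁)) (vacProj L) where
  eq := specProj_Icc_zero p hv hΘ
  mul_PP := specProj_mul_self p v
  mul_OO := one_sub_downProj_mul_of_subset subset_rfl
  mul_PO := by rw [← winEvol_zero]; exact winEvol_mul_vacProj p v Θ₁ 0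
  mul_OP := by rw [← winEvol_zero]; exact vacProj_mul_winEvol p v Θ₁ 0
  norm_Q := norm_specProj_le p v
  norm_P := norm_specProj_le p v
  norm_O := norm_one_sub_downProj_le _

lemma hamFn_comm (g h : ℝ → ℂ) : hamFn p L v g * hamFn p L v h = hamFn p L v h * hamFn p L v g := by
  simp only [hamFn_mul, mul_comm]

lemma hamFn_exp_mul_hamFn_exp_neg (t : ℝ) :
    hamFn p L v (fun x => Complex.exp (Complex.I * t * x)) *
      hamFn p L v (fun x => Complex.exp (-(Complex.I * t * x))) = 1 := by
  rw [hamFn_mul, ← fnCalc_one (ham_isHermitian p L v), hamFn]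
  congr 1
  ext x
  rw [← Complex.exp_add, add_neg_cancel, Complex.exp_zero]

lemma evol_add (t : ℝ) (A B : Op L) : evol p L v t (A + B) = evol p L v t A + evol p L v t B := by
  rw [evol, Matrix.mul_add, Matrix.add_mul]; rfl

lemma evol_smul (t : ℝ) (c : ℂ) (A : Op L) : evol p L v t (c • A) = c • evol p L v t A := by
  rw [evol, Matrix.mul_smul, Matrix.smul_mul]; rfl

lemma evol_one (t : ℝ) : evol p L v t 1 = 1 := by
  rw [evol, Matrix.mul_one, hamFn_exp_mul_hamFn_exp_neg]

lemma evol_zero (A : Op L) : evol p L v 0 A = A := by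
  have h : ∀ g : ℝ → ℂ, (∀ x, g x = 1) → hamFn p L v g = 1 := by
    intro g hg
    rw [← fnCalc_one (ham_isHermitian p L v), hamFn]
    exact fnCalc_congr _ fun k => hg _
  rw [evol, h _ fun x => by simp, h _ fun x => by simp, Matrix.one_mul, Matrix.mul_one]

/-- The evolution commutes with the restriction to an energy window. -/
lemma evol_window (t : ℝ) (B : Set ℝ) (A : Op L) :
    evol p L v t (window p L v B A) = window p L v B (evol p L v t A) := by
  rw [evol, evol, window, window, specProj]
  set V := hamFn p L v (fun x => Complex.exp (Complex.I * t * x)) with hV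
  set V' := hamFn p L v (fun x => Complex.exp (-(Complex.I * t * x))) with hV'
  set R := hamFn p L v (B.indicator 1) with hR
  have h1 : V * R = R * V := hamFn_comm _ _
  have h2 : R * V' = V' * R := hamFn_comm _ _
  calc V * (R * A * R) * V' = (V * R) * A * (R * V') := by simp only [Matrix.mul_assoc]
    _ = R * (V * A * V') * R := by rw [h1, h2]; simp only [Matrix.mul_assoc]

lemma norm_hamFn_exp_le (t : ℝ) : ‖hamFn p L v (fun x => Complex.exp (Complex.I * t * x))‖ ≤ 1 :=
  norm_hamFn_le p v fun x => (norm_exp_I_mul_mul t x).le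

lemma norm_hamFn_exp_neg_le (t : ℝ) :
    ‖hamFn p L v (fun x => Complex.exp (-(Complex.I * t * x)))‖ ≤ 1 :=
  norm_hamFn_le p v fun x => by
    have := norm_exp_I_mul_mul (-t) x
    push_cast at this
    rw [show -(Complex.I * t * x) = Complex.I * -t * x by ring, this]

lemma norm_evol_le (t : ℝ) (A : Op L) : ‖evol p L v t A‖ ≤ ‖A‖ :=
  norm_mul_mul_le_of_le_one (norm_hamFn_exp_le t) (norm_hamFn_exp_neg_le t) A

lemma vacProj_mul_evol_mul_vacProj (t : ℝ) {A : Op L} (hA : vacProj L * A * vacProj L = 0) :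
    vacProj L * evol p L v t A * vacProj L = 0 := by
  rw [evol]
  set V := hamFn p L v (fun x => Complex.exp (Complex.I * t * x)) with hV
  set V' := hamFn p L v (fun x => Complex.exp (-(Complex.I * t * x))) with hV'
  have h1 : vacProj L * V = vacProj L := by rw [hV, vacProj_mul_hamFn]; simp
  have h2 : V' * vacProj L = vacProj L := by rw [hV', hamFn_mul_vacProj]; simp
  calc vacProj L * (V * A * V') * vacProj L = (vacProj L * V) * A * (V' * vacProj L) := by
        simp only [Matrix.mul_assoc]
    _ = 0 := by rw [h1, h2, hA]

lemma IsCentered.vacProj_mul_mul {A : Op L} {lo hi : ℤ} (hA : IsCentered A lo hi) :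
    vacProj L * A * vacProj L = 0 :=
  hA.up_up Set.univ (Set.subset_univ _)

/-- The product of two evolved operators through the energy window depends on the difference of
the times only. -/
lemma traceNorm_evol_mul_evol_le (B I : Set ℝ) (t s : ℝ) (A A' : Op L) :
    traceNorm (specProj p L v B * evol p L v t A * specProj p L v I * evol p L v s A' *
      specProj p L v B) ≤
    traceNorm (specProj p L v B * A * winEvol p L v I (s - t) * A' * specProj p L v B) := by
  rw [evol, evol, specProj, specProj]
  set V := hamFn p L v (fun x => Complex.exp (Complex.I * t * x)) with hV
  set V' := hamFn p L v (fun x => Complex.exp (-(Complex.I * t * x))) with hV'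
  set W := hamFn p L v (fun x => Complex.exp (Complex.I * s * x)) with hW
  set W' := hamFn p L v (fun x => Complex.exp (-(Complex.I * s * x))) with hW'
  set R := hamFn p L v (B.indicator 1) with hR
  set S := hamFn p L v (I.indicator 1) with hS
  have h1 : R * V = V * R := hamFn_comm _ _
  have h2 : W' * R = R * W' := hamFn_comm _ _
  have h3 : V' * S * W = winEvol p L v I (s - t) := by
    rw [hV', hS, hW, hamFn_mul, hamFn_mul, winEvol]
    congr 1
    ext x
    rw [mul_comm (Complex.exp _) (I.indicator 1 x), mul_assoc, ← Complex.exp_add]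
    congr 2
    push_cast
    ring
  have e : R * (V * A * V') * S * (W * A' * W') * R =
      V * (R * A * winEvol p L v I (s - t) * A' * R) * W' := by
    calc R * (V * A * V') * S * (W * A' * W') * R
        = (R * V) * A * (V' * S * W) * A' * (W' * R) := by simp only [Matrix.mul_assoc]
      _ = _ := by rw [h1, h2, h3]; simp only [Matrix.mul_assoc]
  rw [e]
  exact traceNorm_mul_mul_le_of_le_one (norm_hamFn_exp_le t) (norm_hamFn_exp_neg_le s) _

end Evol

/-! ### Pointwise bounds for local observables -/

section Pointwise

variable {L : ℕ} {p : Params} {v : ℤ → ℝ} {Θ₁ m : ℝ}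

lemma LocalObs.dist_le (X Y : LocalObs L) {i j : ℤ} (hi : i ∈ Set.Icc X.lo X.hi)
    (hj : j ∈ Set.Icc Y.lo Y.hi) : X.dist Y ≤ (i - j).natAbs :=
  Nat.sInf_le ⟨i, hi, j, hj, rfl⟩

/-- Two overlapping intervals share the larger of their left ends, and then the distance is zero. -/
lemma LocalObs.hi_lt_lo_or (X Y : LocalObs L) (h : 0 < X.dist Y) :
    X.hi < Y.lo ∨ Y.hi < X.lo := by
  by_contra hc
  push Not at hc
  have h1 := X.lo_le_hi
  have h2 := Y.lo_le_hi
  have := X.dist_le Y (i := max X.lo Y.lo) (j := max X.lo Y.lo) ⟨by omega, by omega⟩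
    ⟨by omega, by omega⟩
  simp at this
  omega

variable (p v Θ₁ m) in
/-- The error in the decoupling of two local observables. -/
noncomputable def obsErr (X Y : LocalObs L) : ℝ≥0∞ :=
  if X.hi < Y.lo then totalErr p Θ₁ m v L X.hi Y.lo else totalErr p Θ₁ m v L Y.hi X.lo

lemma ofReal_traceNorm_evol_le (hv : ∀ i, 0 ≤ v i) (hΘ : p.Θ₀ < Θ₁) (X Y : LocalObs L)
    (h : 0 < X.dist Y) (t s : ℝ) :
    ENNReal.ofReal (traceNorm (specProj p L v (Set.Icc 0 Θ₁) * evol p L v t X.centered *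
        specProj p L v (Set.Icc p.Θ₀ Θ₁) * evol p L v s Y.centered *
        specProj p L v (Set.Icc 0 Θ₁)) +
      traceNorm (specProj p L v (Set.Icc 0 Θ₁) * evol p L v s Y.centered *
        specProj p L v (Set.Icc p.Θ₀ Θ₁) * evol p L v t X.centered *
        specProj p L v (Set.Icc 0 Θ₁))) ≤
      ENNReal.ofReal (8 * X.norm * Y.norm) * obsErr p v Θ₁ m X Y := by
  have hX := X.norm_centered_le
  have hY := Y.norm_centered_le
  have hX0 := X.norm_nonneg
  have hY0 := Y.norm_nonneg
  have hn : ‖X.centered‖ * ‖Y.centered‖ ≤ 4 * X.norm * Y.norm :=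
    (mul_le_mul hX hY (norm_nonneg _) (mul_nonneg zero_le_two hX0)).trans_eq (by ring)
  have key : ∀ r : ℝ, ENNReal.ofReal (traceNorm (specProj p L v (Set.Icc 0 Θ₁) * X.centered *
      winEvol p L v (Set.Icc p.Θ₀ Θ₁) r * Y.centered * specProj p L v (Set.Icc 0 Θ₁))) ≤
        -- Both orders of the product are bounded by the same error. Centering at most doubles each
        -- norm, hence a factor `4` per order and `8` for the sum.
        ENNReal.ofReal (‖X.centered‖ * ‖Y.centered‖) * obsErr p v Θ₁ m X Y ∧
      ENNReal.ofReal (traceNorm (specProj p L v (Set.Icc 0 Θ₁) * Y.centered *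
      winEvol p L v (Set.Icc p.Θ₀ Θ₁) r * X.centered * specProj p L v (Set.Icc 0 Θ₁))) ≤
        ENNReal.ofReal (‖X.centered‖ * ‖Y.centered‖) * obsErr p v Θ₁ m X Y := by
    intro r
    by_cases hlt : X.hi < Y.lo
    · rw [obsErr, if_pos hlt]
      exact X.isCentered.ofReal_traceNorm_le hv hΘ Y.isCentered hlt r
    · rw [obsErr, if_neg hlt, mul_comm ‖X.centered‖]
      have hlt' := (X.hi_lt_lo_or Y h).resolve_left hlt
      exact (Y.isCentered.ofReal_traceNorm_le hv hΘ X.isCentered hlt' r).symm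
  have k1 := (ENNReal.ofReal_le_ofReal (traceNorm_evol_mul_evol_le (p := p) (v := v)
    (Set.Icc 0 Θ₁) (Set.Icc p.Θ₀ Θ₁) t s X.centered Y.centered)).trans (key (s - t)).1
  have k2 := (ENNReal.ofReal_le_ofReal (traceNorm_evol_mul_evol_le (p := p) (v := v)
    (Set.Icc 0 Θ₁) (Set.Icc p.Θ₀ Θ₁) s t Y.centered X.centered)).trans (key (t - s)).2
  refine (ENNReal.ofReal_add_le.trans (add_le_add k1 k2)).trans ?_
  have hn0 : 0 ≤ ‖X.centered‖ * ‖Y.centered‖ := mul_nonneg (norm_nonneg _) (norm_nonneg _)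
  rw [← add_mul, ← ENNReal.ofReal_add hn0 hn0]
  refine mul_le_mul_left (ENNReal.ofReal_le_ofReal ?_) _
  linarith

lemma lie_evol_window_eq (B : Set ℝ) (X Y : LocalObs L) (t s : ℝ) :
    ⁅evol p L v t (window p L v B X.op), evol p L v s (window p L v B Y.op)⁆ =
      ⁅specProj p L v B * evol p L v t X.centered * specProj p L v B,
        specProj p L v B * evol p L v s Y.centered * specProj p L v B⁆ := by
  have hR := specProj_mul_self (L := L) p v (B := B)
  have h : ∀ (X : LocalObs L) (t : ℝ), evol p L v t (window p L v B X.op) =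
      specProj p L v B * evol p L v t X.centered * specProj p L v B +
        X.vacExp • specProj p L v B := by
    intro X t
    rw [evol_window, window, X.op_eq, evol_add, evol_smul, evol_one, Matrix.mul_add, Matrix.add_mul,
      Matrix.mul_smul, Matrix.smul_mul, Matrix.mul_one, hR]
  have h1 : ∀ A : Op L, specProj p L v B * (specProj p L v B * A * specProj p L v B) =
      specProj p L v B * A * specProj p L v B := by
    intro A; rw [← Matrix.mul_assoc, ← Matrix.mul_assoc, hR]
  have h2 : ∀ A : Op L, (specProj p L v B * A * specProj p L v B) * specProj p L v B =
      specProj p L v B * A * specProj p L v B := by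
    intro A; rw [Matrix.mul_assoc, hR]
  rw [h, h]
  exact lie_add_smul_add_smul _ _ (h1 _) (h2 _) (h1 _) (h2 _)

lemma ofReal_traceNorm_lie_le (hv : ∀ i, 0 ≤ v i) (hΘ : p.Θ₀ < Θ₁) (X Y : LocalObs L)
    (h : 0 < X.dist Y) (t : ℝ) :
    ENNReal.ofReal (traceNorm ⁅evol p L v t (window p L v (Set.Icc p.Θ₀ Θ₁) X.op),
      window p L v (Set.Icc p.Θ₀ Θ₁) Y.op⁆) ≤
      ENNReal.ofReal (8 * X.norm * Y.norm) * obsErr p v Θ₁ m X Y := by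
  have e := lie_evol_window_eq (p := p) (v := v) (Set.Icc p.Θ₀ Θ₁) X Y t 0
  rw [evol_zero] at e
  rw [e]
  exact (ENNReal.ofReal_le_ofReal
    (isSplit_specProj hv hΘ).traceNorm_lie_small_window_le).trans
    (ofReal_traceNorm_evol_le hv hΘ X Y h t 0)

lemma ofReal_traceNorm_lie_sub_counterterm_le (hv : ∀ i, 0 ≤ v i) (hΘ : p.Θ₀ < Θ₁)
    (X Y : LocalObs L) (h : 0 < X.dist Y) (t : ℝ) :
    ENNReal.ofReal (traceNorm (⁅evol p L v t (window p L v (Set.Icc 0 Θ₁) X.op),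
      window p L v (Set.Icc 0 Θ₁) Y.op⁆ - window p L v (Set.Icc p.Θ₀ Θ₁)
        (evol p L v t X.op * specProj p L v {0} * Y.op
          - Y.op * specProj p L v {0} * evol p L v t X.op))) ≤
      ENNReal.ofReal (8 * X.norm * Y.norm) * obsErr p v Θ₁ m X Y := by
  have hs := isSplit_specProj (L := L) hv hΘ
  have e := lie_evol_window_eq (p := p) (v := v) (Set.Icc 0 Θ₁) X Y t 0
  rw [evol_zero] at e
  -- The counterterm does not see the vacuum expectations either: the added multiples of the
  -- identity place `P_I` next to `P_0`, and `P_I P_0 = 0`.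
  have e2 : window p L v (Set.Icc p.Θ₀ Θ₁) (evol p L v t X.op * specProj p L v {0} * Y.op
        - Y.op * specProj p L v {0} * evol p L v t X.op) =
      specProj p L v (Set.Icc p.Θ₀ Θ₁) * (evol p L v t X.centered * vacProj L *
          evol p L v 0 Y.centered
        - evol p L v 0 Y.centered * vacProj L * evol p L v t X.centered) *
          specProj p L v (Set.Icc p.Θ₀ Θ₁) := by
    rw [specProj_singleton_zero p hv, evol_zero, window, X.op_eq, Y.op_eq, evol_add, evol_smul,
      evol_one]
    have k : ∀ (A B : Op L) (c d : ℂ), specProj p L v (Set.Icc p.Θ₀ Θ₁) *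
        ((A + c • 1) * vacProj L * (B + d • 1)) * specProj p L v (Set.Icc p.Θ₀ Θ₁) =
        specProj p L v (Set.Icc p.Θ₀ Θ₁) * (A * vacProj L * B) *
          specProj p L v (Set.Icc p.Θ₀ Θ₁) := by
      intro A B c d
      have hPO := hs.mul_PO
      have hOP := hs.mul_OP
      set R := specProj p L v (Set.Icc p.Θ₀ Θ₁)
      have k1 : R * ((A + c • 1) * vacProj L) = R * (A * vacProj L) := by
        rw [Matrix.add_mul, Matrix.mul_add, Matrix.smul_mul, Matrix.mul_smul, Matrix.one_mul, hPO,
          smul_zero, add_zero]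
      have k2 : vacProj L * (B + d • 1) * R = vacProj L * B * R := by
        rw [Matrix.mul_add, Matrix.add_mul, Matrix.mul_smul, Matrix.smul_mul, Matrix.mul_one, hOP,
          smul_zero, add_zero]
      calc R * ((A + c • 1) * vacProj L * (B + d • 1)) * R
          = R * ((A + c • 1) * vacProj L) * ((B + d • 1) * R) := by simp only [Matrix.mul_assoc]
        _ = R * A * (vacProj L * (B + d • 1) * R) := by rw [k1]; simp only [Matrix.mul_assoc]
        _ = _ := by rw [k2]; simp only [Matrix.mul_assoc]
    rw [Matrix.mul_sub, Matrix.sub_mul, k, k, Matrix.mul_sub, Matrix.sub_mul]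
  rw [e, e2]
  exact (ENNReal.ofReal_le_ofReal (hs.traceNorm_lie_window_sub_le
    (vacProj_mul_evol_mul_vacProj t X.isCentered.vacProj_mul_mul)
    (vacProj_mul_evol_mul_vacProj 0 Y.isCentered.vacProj_mul_mul))).trans
    (ofReal_traceNorm_evol_le hv hΘ X Y h t 0)

lemma ofReal_traceNorm_lie_lie_le (hv : ∀ i, 0 ≤ v i) (hΘ : p.Θ₀ < Θ₁) (X Y Z : LocalObs L)
    (hXY : 0 < X.dist Y) (hXZ : 0 < X.dist Z) (hYZ : 0 < Y.dist Z) (t s : ℝ) :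
    ENNReal.ofReal (traceNorm ⁅⁅evol p L v t (window p L v (Set.Icc 0 Θ₁) X.op),
      evol p L v s (window p L v (Set.Icc 0 Θ₁) Y.op)⁆, window p L v (Set.Icc 0 Θ₁) Z.op⁆) ≤
      ENNReal.ofReal (32 * X.norm * Y.norm * Z.norm) *
        (obsErr p v Θ₁ m X Y + obsErr p v Θ₁ m Y Z + obsErr p v Θ₁ m X Z) := by
  have hs := isSplit_specProj (L := L) hv hΘ
  have hR := hs.mul_QQ
  have e := lie_evol_window_eq (p := p) (v := v) (Set.Icc 0 Θ₁) X Y t s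
  have e2 : window p L v (Set.Icc 0 Θ₁) Z.op = specProj p L v (Set.Icc 0 Θ₁) *
      evol p L v 0 Z.centered * specProj p L v (Set.Icc 0 Θ₁) +
        Z.vacExp • specProj p L v (Set.Icc 0 Θ₁) := by
    rw [evol_zero, window, Z.op_eq, Matrix.mul_add, Matrix.add_mul,
      Matrix.mul_smul, Matrix.smul_mul, Matrix.mul_one, hR]
  have b := hs.traceNorm_lie_lie_le (A := evol p L v t X.centered) (B := evol p L v s Y.centered)
    (C := evol p L v 0 Z.centered)
    (vacProj_mul_evol_mul_vacProj (p := p) (v := v) t X.isCentered.vacProj_mul_mul)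
    (vacProj_mul_evol_mul_vacProj (p := p) (v := v) s Y.isCentered.vacProj_mul_mul)
  have nA := (norm_evol_le (p := p) (v := v) t X.centered).trans X.norm_centered_le
  have nB := (norm_evol_le (p := p) (v := v) s Y.centered).trans Y.norm_centered_le
  have nC := (norm_evol_le (p := p) (v := v) 0 Z.centered).trans Z.norm_centered_le
  have hX0 := X.norm_nonneg
  have hY0 := Y.norm_nonneg
  have hZ0 := Z.norm_nonneg
  have k1 := ofReal_traceNorm_evol_le (m := m) hv hΘ X Y hXY t s
  have k2 := ofReal_traceNorm_evol_le (m := m) hv hΘ Y Z hYZ s 0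
  have k3 := ofReal_traceNorm_evol_le (m := m) hv hΘ X Z hXZ t 0
  rw [e, e2]
  set Q := specProj p L v (Set.Icc 0 Θ₁)
  set R := specProj p L v (Set.Icc p.Θ₀ Θ₁)
  set A := evol p L v t X.centered
  set B := evol p L v s Y.centered
  set C := evol p L v 0 Z.centered
  have hQl : ∀ M : Op L, Q * (Q * M * Q) = Q * M * Q := fun M => by
    rw [← Matrix.mul_assoc, ← Matrix.mul_assoc, hR]
  have hQr : ∀ M : Op L, Q * M * Q * Q = Q * M * Q := fun M => by rw [Matrix.mul_assoc, hR]
  have e3 : ⁅⁅Q * A * Q, Q * B * Q⁆, Q * C * Q + Z.vacExp • Q⁆ =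
      ⁅⁅Q * A * Q, Q * B * Q⁆, Q * C * Q⁆ := by
    have := lie_add_smul_add_smul (e := Q) (S := ⁅Q * A * Q, Q * B * Q⁆) (T := Q * C * Q) 0 Z.vacExp
      (by rw [Ring.lie_def, mul_sub, ← mul_assoc Q (Q * A * Q), hQl, ← mul_assoc Q (Q * B * Q), hQl])
      (by rw [Ring.lie_def, sub_mul, mul_assoc (Q * A * Q) (Q * B * Q) Q, hQr,
        mul_assoc (Q * B * Q) (Q * A * Q) Q, hQr]) (hQl C) (hQr C)
    rwa [zero_smul, add_zero] at this
  rw [e3]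
  set n1 := traceNorm (Q * A * R * B * Q) + traceNorm (Q * B * R * A * Q) with hn1
  set n2 := traceNorm (Q * B * R * C * Q) + traceNorm (Q * C * R * B * Q) with hn2
  set n3 := traceNorm (Q * A * R * C * Q) + traceNorm (Q * C * R * A * Q) with hn3
  have hn1' : 0 ≤ n1 := add_nonneg (traceNorm_nonneg _) (traceNorm_nonneg _)
  have hn2' : 0 ≤ n2 := add_nonneg (traceNorm_nonneg _) (traceNorm_nonneg _)
  have hn3' : 0 ≤ n3 := add_nonneg (traceNorm_nonneg _) (traceNorm_nonneg _)
  -- Each observable enters once with norm at most twice its own; with the `8` of the two-observable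
  -- bound every one of the three terms gets the factor `4 · 8 = 32`.
  have b' : traceNorm ⁅⁅Q * A * Q, Q * B * Q⁆, Q * C * Q⁆ ≤
      4 * Z.norm * n1 + 4 * X.norm * n2 + 4 * Y.norm * n3 := by
    refine b.trans ?_
    have c1 : 2 * ‖C‖ * n1 ≤ 4 * Z.norm * n1 := by
      refine mul_le_mul_of_nonneg_right ?_ hn1'; linarith
    have c2 : ‖A‖ * n2 ≤ 4 * X.norm * n2 := by
      refine mul_le_mul_of_nonneg_right ?_ hn2'; linarith
    have c3 : ‖B‖ * n3 ≤ 4 * Y.norm * n3 := by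
      refine mul_le_mul_of_nonneg_right ?_ hn3'; linarith
    linarith
  refine (ENNReal.ofReal_le_ofReal b').trans (ENNReal.ofReal_add_le.trans ?_)
  clear b' nA nB nC
  generalize X.norm = x at *
  generalize Y.norm = y at *
  generalize Z.norm = z at *
  refine (add_le_add ENNReal.ofReal_add_le le_rfl).trans ?_
  rw [ENNReal.ofReal_mul (p := 4 * z) (by positivity),
    ENNReal.ofReal_mul (p := 4 * x) (by positivity),
    ENNReal.ofReal_mul (p := 4 * y) (by positivity), mul_add, mul_add]
  have fin : ∀ {a b c : ℝ} {n : ℝ} {E : ℝ≥0∞}, 0 ≤ a → ENNReal.ofReal n ≤ ENNReal.ofReal b * E →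
      a * b = c → ENNReal.ofReal a * ENNReal.ofReal n ≤ ENNReal.ofReal c * E := by
    intro a b c n E ha hn hc
    rw [← hc, ENNReal.ofReal_mul ha, mul_assoc]
    exact mul_le_mul_right hn _
  refine add_le_add (add_le_add (fin (mul_nonneg zero_le_four hZ0) k1 ?_)
    (fin (mul_nonneg zero_le_four hX0) k2 ?_)) (fin (mul_nonneg zero_le_four hY0) k3 ?_) <;> ring

end Pointwise

/-! ### Expectations for local observables -/

section Integrated

variable {L : ℕ} {p : Params} {Θ₁ C m : ℝ} {Ω : Type*} [MeasurableSpace Ω] {P : Measure Ω}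
  {ω : ℤ → Ω → ℝ}

/-- The support carries the whole single-site law and lies in `[0, 1]`; countably many sites share
one null set. Nonnegativity of the field is what the spectral gap needs. -/
lemma IsDisorder.ae_nonneg (hω : IsDisorder P ω) : ∀ᵐ w ∂P, ∀ i, 0 ≤ ω i w := by
  have h0 : ∀ᵐ x ∂(P.map (ω 0)), 0 ≤ x := by
    filter_upwards [Measure.support_mem_ae (μ := P.map (ω 0))] with x hx
    exact (hω.support_subset hx).1
  refine ae_all_iff.2 fun i => ?_
  rw [← (hω.identDistrib i).map_eq] at h0
  exact ae_of_ae_map (hω.measurable i).aemeasurable h0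

lemma measurable_obsErr (hω : ∀ i, Measurable (ω i)) (X Y : LocalObs L) :
    Measurable fun w => obsErr p (fun k => ω k w) Θ₁ m X Y := by
  unfold obsErr
  split_ifs <;> exact measurable_totalErr hω _ _

/-- The free `d` below the distance lets the three pairs of a double commutator share the minimum of
their distances. -/
lemma lintegral_obsErr_le (hω : ∀ i, Measurable (ω i)) (hDL : PropertyDL p P ω Θ₁ C m)
    (X Y : LocalObs L) (h : 0 < X.dist Y) {d : ℕ} (hd : d ≤ X.dist Y) :
    ∫⁻ w, obsErr p (fun k => ω k w) Θ₁ m X Y ∂P ≤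
      ENNReal.ofReal (totalConst C m * Real.exp (-(1 / 8) * m * d)) := by
  have h1 := X.lo_le_hi
  have h2 := Y.lo_le_hi
  by_cases hlt : X.hi < Y.lo
  · simp only [obsErr, if_pos hlt]
    refine lintegral_totalErr_le hω hDL hlt ?_
    have h3 := X.dist_le Y (i := X.hi) (j := Y.lo) ⟨h1, le_rfl⟩ ⟨le_rfl, h2⟩
    have : (d : ℤ) ≤ Y.lo - X.hi := by omega
    exact_mod_cast this
  · have hlt' := (X.hi_lt_lo_or Y h).resolve_left hlt
    simp only [obsErr, if_neg hlt]
    refine lintegral_totalErr_le hω hDL hlt' ?_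
    have h3 := X.dist_le Y (i := X.lo) (j := Y.hi) ⟨le_rfl, h1⟩ ⟨h2, le_rfl⟩
    have : (d : ℤ) ≤ X.lo - Y.hi := by omega
    exact_mod_cast this

/-- Only the majorant has to be measurable, not `f`. The factor `96` is generous here; it is `3 ·
32`, the value that the three-observable bound requires, so one constant serves all estimates. -/
lemma lintegral_le_of_ae_le_mul_obsErr (hω : IsDisorder P ω) (hDL : PropertyDL p P ω Θ₁ C m)
    (X Y : LocalObs L) (h : 0 < X.dist Y) {f : Ω → ℝ≥0∞}
    (hf : ∀ w, (∀ i, 0 ≤ ω i w) → f w ≤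
      ENNReal.ofReal (8 * X.norm * Y.norm) * obsErr p (fun k => ω k w) Θ₁ m X Y) :
    ∫⁻ w, f w ∂P ≤ ENNReal.ofReal (96 * totalConst C m * X.norm * Y.norm *
      Real.exp (-(1 / 8) * m * (X.dist Y : ℝ))) := by
  have hX0 := X.norm_nonneg
  have hY0 := Y.norm_nonneg
  have hT := totalConst_nonneg (C := C) hDL.m_pos
  refine (lintegral_mono_ae (hω.ae_nonneg.mono hf)).trans ?_
  rw [lintegral_const_mul _ (measurable_obsErr hω.measurable X Y)]
  refine (mul_le_mul_right (lintegral_obsErr_le hω.measurable hDL X Y h le_rfl) _).trans ?_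
  clear hf
  generalize X.norm = x at hX0 ⊢
  generalize Y.norm = y at hY0 ⊢
  rw [← ENNReal.ofReal_mul (by positivity)]
  refine ENNReal.ofReal_le_ofReal ?_
  have : 0 ≤ totalConst C m * x * y * Real.exp (-(1 / 8) * m * (X.dist Y : ℝ)) := by positivity
  linarith

lemma lintegral_le_of_ae_le_mul_obsErr₃ (hω : IsDisorder P ω) (hDL : PropertyDL p P ω Θ₁ C m)
    (X Y Z : LocalObs L) (hXY : 0 < X.dist Y) (hXZ : 0 < X.dist Z) (hYZ : 0 < Y.dist Z)
    {f : Ω → ℝ≥0∞} (hf : ∀ w, (∀ i, 0 ≤ ω i w) → f w ≤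
      ENNReal.ofReal (32 * X.norm * Y.norm * Z.norm) * (obsErr p (fun k => ω k w) Θ₁ m X Y +
        obsErr p (fun k => ω k w) Θ₁ m Y Z + obsErr p (fun k => ω k w) Θ₁ m X Z)) :
    ∫⁻ w, f w ∂P ≤ ENNReal.ofReal (96 * totalConst C m * X.norm * Y.norm * Z.norm *
      Real.exp (-(1 / 8) * m *
        ((min (X.dist Y) (min (X.dist Z) (Y.dist Z)) : ℕ) : ℝ))) := by
  have hX0 := X.norm_nonneg
  have hY0 := Y.norm_nonneg
  have hZ0 := Z.norm_nonneg
  have hT := totalConst_nonneg (C := C) hDL.m_pos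
  set d := min (X.dist Y) (min (X.dist Z) (Y.dist Z)) with hd
  have m1 := measurable_obsErr (p := p) (Θ₁ := Θ₁) (m := m) hω.measurable X Y
  have m2 := measurable_obsErr (p := p) (Θ₁ := Θ₁) (m := m) hω.measurable Y Z
  have m3 := measurable_obsErr (p := p) (Θ₁ := Θ₁) (m := m) hω.measurable X Z
  have i1 := lintegral_obsErr_le hω.measurable hDL X Y hXY (d := d) (by omega)
  have i2 := lintegral_obsErr_le hω.measurable hDL Y Z hYZ (d := d) (by omega)
  have i3 := lintegral_obsErr_le hω.measurable hDL X Z hXZ (d := d) (by omega)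
  refine (lintegral_mono_ae (hω.ae_nonneg.mono hf)).trans ?_
  rw [lintegral_const_mul _ ((m1.fun_add m2).fun_add m3), lintegral_add_left (m1.fun_add m2),
    lintegral_add_left m1]
  refine (mul_le_mul_right (add_le_add (add_le_add i1 i2) i3) _).trans ?_
  clear hf
  generalize X.norm = x at hX0 ⊢
  generalize Y.norm = y at hY0 ⊢
  generalize Z.norm = z at hZ0 ⊢
  rw [← ENNReal.ofReal_add (by positivity) (by positivity),
    ← ENNReal.ofReal_add (by positivity) (by positivity), ← ENNReal.ofReal_mul (by positivity)]
  refine ENNReal.ofReal_le_ofReal (le_of_eq ?_)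
  ring

end Integrated

end XXZ

namespace XXZ

open scoped Matrix.Norms.L2Operator

/-! ### Sums of one-site operators as local observables -/

section SumObs

variable {L : ℕ} {lo hi : ℤ}

lemma siteOp_conjTranspose (i : Site L) (a : Matrix (Fin 2) (Fin 2) ℂ) :
    (siteOp i a)ᴴ = siteOp i aᴴ := by
  ext s s'
  have h : (∀ k, k ≠ i → s' k = s k) ↔ (∀ k, k ≠ i → s k = s' k) :=
    ⟨fun h k hk => (h k hk).symm, fun h k hk => (h k hk).symm⟩
  simp only [siteOp, Matrix.conjTranspose_apply, Matrix.of_apply, h]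
  split_ifs <;> simp

/-- The sum over the sites of `[lo, hi]` of a one-site operator. -/
noncomputable def sumOp (L : ℕ) (lo hi : ℤ) (a : Matrix (Fin 2) (Fin 2) ℂ) : Op L :=
  ∑ k ∈ sitesIn L (Set.Icc lo hi), siteOp k a

/-- The sum over the sites of `[lo, hi]` of a one-site operator, as a local observable. -/
noncomputable def sumObs (h1 : -(L : ℤ) ≤ lo) (h2 : lo ≤ hi) (h3 : hi ≤ (L : ℤ))
    (a : Matrix (Fin 2) (Fin 2) ℂ) : LocalObs L where
  lo := lo
  hi := hi
  neg_L_le_lo := h1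
  lo_le_hi := h2
  hi_le_L := h3
  core := Matrix.of fun s s' => ∑ k, if ∀ j, j ≠ k → s j = s' j then a (s k) (s' k) else 0

lemma sumObs_op (h1 : -(L : ℤ) ≤ lo) (h2 : lo ≤ hi) (h3 : hi ≤ (L : ℤ))
    (a : Matrix (Fin 2) (Fin 2) ℂ) : (sumObs h1 h2 h3 a).op = sumOp L lo hi a := by
  classical
  ext s s'
  have hsub : ∀ f : Site L → ℂ, ∑ k ∈ sitesIn L (Set.Icc lo hi), f k =
      ∑ k : {i : Site L // lo ≤ i.1 ∧ i.1 ≤ hi}, f k.1 := fun f =>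
    Finset.sum_subtype _ (fun k => by simp) f
  rw [sumOp, Matrix.sum_apply, hsub]
  change (if ∀ k : Site L, ¬ (lo ≤ k.1 ∧ k.1 ≤ hi) → s k = s' k then
    ∑ k : {i : Site L // lo ≤ i.1 ∧ i.1 ≤ hi},
      (if ∀ j : {i : Site L // lo ≤ i.1 ∧ i.1 ≤ hi}, j ≠ k → s j.1 = s' j.1
        then a (s k.1) (s' k.1) else 0) else 0) = _
  by_cases h : ∀ k : Site L, ¬ (lo ≤ k.1 ∧ k.1 ≤ hi) → s k = s' k
  · rw [if_pos h]
    refine Finset.sum_congr rfl fun k _ => ?_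
    rw [siteOp, Matrix.of_apply]
    refine if_congr ⟨fun h4 j hj => ?_, fun h4 j hj => h4 j.1 fun h5 => hj (Subtype.ext h5)⟩ rfl rfl
    by_cases hj' : lo ≤ j.1 ∧ j.1 ≤ hi
    · exact h4 ⟨j, hj'⟩ fun h5 => hj (congrArg Subtype.val h5)
    · exact h j hj'
  · rw [if_neg h]
    symm
    refine Finset.sum_eq_zero fun k _ => ?_
    rw [siteOp, Matrix.of_apply, if_neg]
    intro h4
    refine h fun j hj => h4 j fun h5 => hj ?_
    rw [h5]
    exact k.2

lemma norm_siteOp_le (i : Site L) {a : Matrix (Fin 2) (Fin 2) ℂ} (ha : ∃ b : Fin 2 → ℂ,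
    aᴴ * a = diagonal b ∧ ∀ k, ‖b k‖ ≤ 1) : ‖siteOp i a‖ ≤ 1 := by
  obtain ⟨b, hb, hb1⟩ := ha
  have h1 : (siteOp i a)ᴴ * siteOp i a = diagonal fun s : Config L => b (s i) := by
    rw [siteOp_conjTranspose, siteOp_mul_siteOp, hb]
    ext s s'
    rw [siteOp, Matrix.of_apply, Matrix.diagonal_apply, Matrix.diagonal_apply]
    by_cases h : s = s'
    · simp [h]
    · rw [if_neg h]
      split_ifs with h2 h3
      · exact absurd (funext fun k => if hk : k = i then hk ▸ h3 else h2 k hk) h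
      · rfl
      · rfl
  have h2 : ‖siteOp i a‖ * ‖siteOp i a‖ ≤ 1 := by
    rw [← Matrix.l2_opNorm_conjTranspose_mul_self, h1]
    exact norm_diagonal_le_one fun s => hb1 _
  nlinarith [norm_nonneg (siteOp i a)]

/-- The operator `σ⁻` that flips a spin down. -/
def flipDown : Matrix (Fin 2) (Fin 2) ℂ := !![0, 0; 1, 0]

lemma norm_siteOp_flipDown_le (i : Site L) : ‖siteOp i flipDown‖ ≤ 1 := by
  refine norm_siteOp_le i ⟨![1, 0], ?_, fun k => by fin_cases k <;> simp⟩
  ext a b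
  fin_cases a <;> fin_cases b <;> simp [flipDown, Matrix.mul_apply]

lemma card_sitesIn_Icc (h1 : -(L : ℤ) ≤ lo) (h2 : lo ≤ hi) (h3 : hi ≤ (L : ℤ)) :
    ((sitesIn L (Set.Icc lo hi)).card : ℝ) = ((hi - lo + 1 : ℤ) : ℝ) := by
  have h : (sitesIn L (Set.Icc lo hi)).card = (Finset.Icc lo hi).card := by
    refine Finset.card_bij (fun i _ => i.1) (fun i hi => Finset.mem_Icc.2 (mem_sitesIn.1 hi))
      (fun i _ j _ h => Subtype.ext h) fun k hk => ?_
    have hk' := Finset.mem_Icc.1 hk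
    exact ⟨⟨k, Finset.mem_Icc.2 ⟨by omega, by omega⟩⟩, mem_sitesIn.2 hk', rfl⟩
  rw [h, Int.card_Icc]
  have : ((hi + 1 - lo).toNat : ℤ) = hi - lo + 1 := by omega
  exact_mod_cast this

lemma sumOp_conjTranspose (a : Matrix (Fin 2) (Fin 2) ℂ) :
    (sumOp L lo hi a)ᴴ = sumOp L lo hi aᴴ := by
  rw [sumOp, sumOp, Matrix.conjTranspose_sum]
  exact Finset.sum_congr rfl fun k _ => siteOp_conjTranspose k a

lemma norm_sumOp_flipDown_le (h1 : -(L : ℤ) ≤ lo) (h2 : lo ≤ hi) (h3 : hi ≤ (L : ℤ)) :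
    ‖sumOp L lo hi flipDown‖ ≤ ((hi - lo + 1 : ℤ) : ℝ) := by
  rw [← card_sitesIn_Icc h1 h2 h3, sumOp]
  refine (norm_sum_le _ _).trans ((Finset.sum_le_sum fun k _ => norm_siteOp_flipDown_le k).trans ?_)
  simp

end SumObs

/-! ### A low-energy state with a single spin down -/

section Droplet

variable {L : ℕ} {lo hi : ℤ}

/-- The configuration with a single spin down at `k`. -/
def oneDown (k : Site L) : Config L := Pi.single k 1

lemma oneDown_apply (k i : Site L) : oneDown k i = if i = k then 1 else 0 := by
  rw [oneDown, Pi.single_apply]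

lemma oneDown_injective : Function.Injective (oneDown : Site L → Config L) := by
  intro k l h
  by_contra hkl
  have := congrFun h k
  rw [oneDown_apply, oneDown_apply, if_pos rfl, if_neg hkl] at this
  exact absurd this (by decide)

/-- The equal-weight superposition of the states with one spin down in `[lo, hi]`. -/
noncomputable def flatVec (L : ℕ) (lo hi : ℤ) (s : Config L) : ℝ :=
  ∑ k ∈ sitesIn L (Set.Icc lo hi), if s = oneDown k then 1 else 0

lemma flatVec_oneDown {k : Site L} (hk : k.1 ∈ Set.Icc lo hi) :
    flatVec L lo hi (oneDown k) = 1 := by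
  rw [flatVec, Finset.sum_eq_single k]
  · simp
  · intro l _ hl
    rw [if_neg fun h => hl (oneDown_injective h).symm]
  · intro h
    exact absurd (mem_sitesIn.2 hk) h

lemma flatVec_nonneg (s : Config L) : 0 ≤ flatVec L lo hi s :=
  Finset.sum_nonneg fun k _ => by split_ifs <;> simp

lemma sum_mul_flatVec (d : Config L → ℝ) :
    ∑ s, d s * flatVec L lo hi s = ∑ k ∈ sitesIn L (Set.Icc lo hi), d (oneDown k) := by
  simp only [flatVec, Finset.mul_sum]
  rw [Finset.sum_comm]
  refine Finset.sum_congr rfl fun k _ => ?_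
  simp

lemma sum_mul_norm_flatVec_sq (d : Config L → ℝ) :
    ∑ s, d s * ‖((flatVec L lo hi s : ℝ) : ℂ)‖ ^ 2 =
      ∑ k ∈ sitesIn L (Set.Icc lo hi), d (oneDown k) := by
  have h : ∀ s, d s * ‖((flatVec L lo hi s : ℝ) : ℂ)‖ ^ 2 =
      d s * flatVec L lo hi s * flatVec L lo hi s := fun s => by
    rw [Complex.norm_real, Real.norm_eq_abs, sq_abs]; ring
  simp only [h]
  rw [sum_mul_flatVec]
  refine Finset.sum_congr rfl fun k hk => ?_
  rw [flatVec_oneDown (mem_sitesIn.1 hk), mul_one]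

lemma sumOp_flipDown_apply_zero (s : Config L) :
    sumOp L lo hi flipDown s 0 = ((flatVec L lo hi s : ℝ) : ℂ) := by
  rw [sumOp, Matrix.sum_apply, flatVec, Complex.ofReal_sum]
  refine Finset.sum_congr rfl fun k _ => ?_
  rw [siteOp, Matrix.of_apply]
  by_cases h : s = oneDown k
  · rw [if_pos h, if_pos]
    · rw [h, oneDown_apply, if_pos rfl]; simp [flipDown]
    · intro j hj
      rw [h, oneDown_apply, if_neg hj]; rfl
  · rw [if_neg h]
    split_ifs with h2
    · have h3 : s k = 0 := by
        by_contra h4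
        refine h (funext fun j => ?_)
        rw [oneDown_apply]
        split_ifs with h5
        · rw [h5]; omega
        · exact h2 j h5
      rw [h3]; simp [flipDown]
    · simp

/-- A state with a spin just flipped down has no vacuum component. This removes one of the two
counterterms in the converse, so they cannot cancel. -/
lemma vacProj_mul_sumOp_flipDown : vacProj L * sumOp L lo hi flipDown = 0 := by
  rw [sumOp, Matrix.mul_sum]
  refine Finset.sum_eq_zero fun k _ => ?_
  ext s s'
  rw [vacProj_eq_diagonal, Matrix.diagonal_mul, Matrix.zero_apply]
  split_ifs with h
  · rw [h, siteOp, Matrix.of_apply]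
    split_ifs
    · generalize s' k = b
      fin_cases b <;> simp [flipDown]
    · simp
  · simp

/-- The transversal coupling is entrywise nonnegative. -/
lemma transversal_apply {i j : Site L} (hij : i ≠ j) (s s' : Config L) :
    (siteOp i pauliX * siteOp j pauliX + siteOp i pauliY * siteOp j pauliY) s s' =
      (((if (∀ k, k ≠ i → k ≠ j → s k = s' k) ∧ s i ≠ s j ∧ s' i = s j ∧ s' j = s i
        then 2 else 0 : ℝ)) : ℂ) := by
  rw [Matrix.add_apply, siteOp_mul_apply hij, siteOp_mul_apply hij]
  by_cases h : ∀ k, k ≠ i → k ≠ j → s k = s' k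
  · rw [if_pos h, if_pos h, if_congr (and_iff_right h) rfl rfl]
    generalize s i = a
    generalize s j = b
    generalize s' i = c
    generalize s' j = d
    fin_cases a <;> fin_cases b <;> fin_cases c <;> fin_cases d <;>
      norm_num [pauliX, pauliY]
  · rw [if_neg h, if_neg h, if_neg fun h2 => h h2.1]
    simp

/-- The hop from `i` to `j` and its reverse each contribute a matrix element `2`; all other
contributions are nonnegative, so no exact evaluation is needed. -/
lemma four_le_qform_transversal {i j : Site L} (hij : i ≠ j) (hi' : i.1 ∈ Set.Icc lo hi)
    (hj' : j.1 ∈ Set.Icc lo hi) :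
    4 ≤ qform (siteOp i pauliX * siteOp j pauliX + siteOp i pauliY * siteOp j pauliY)
      (fun s => ((flatVec L lo hi s : ℝ) : ℂ)) := by
  set t : Config L → Config L → ℝ := fun s s' =>
    if (∀ k, k ≠ i → k ≠ j → s k = s' k) ∧ s i ≠ s j ∧ s' i = s j ∧ s' j = s i then 2 else 0
    with ht
  have ht0 : ∀ s s', 0 ≤ t s s' := fun s s' => by simp only [ht]; split_ifs <;> simp
  have hq : qform (siteOp i pauliX * siteOp j pauliX + siteOp i pauliY * siteOp j pauliY)
      (fun s => ((flatVec L lo hi s : ℝ) : ℂ)) =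
      ∑ s, (∑ s', t s s' * flatVec L lo hi s') * flatVec L lo hi s := by
    rw [qform, dotProduct, Complex.re_sum]
    refine Finset.sum_congr rfl fun s _ => ?_
    have h1 : ((siteOp i pauliX * siteOp j pauliX + siteOp i pauliY * siteOp j pauliY) *ᵥ
        fun s => ((flatVec L lo hi s : ℝ) : ℂ)) s =
        ((∑ s', t s s' * flatVec L lo hi s' : ℝ) : ℂ) := by
      rw [Matrix.mulVec, dotProduct, Complex.ofReal_sum]
      refine Finset.sum_congr rfl fun s' _ => ?_
      rw [transversal_apply hij, Complex.ofReal_mul]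
    rw [h1, Pi.star_apply, RCLike.star_def, Complex.conj_ofReal, ← Complex.ofReal_mul,
      Complex.ofReal_re, mul_comm]
  have htd : ∀ k l : Site L, (k = i ∧ l = j ∨ k = j ∧ l = i) → t (oneDown k) (oneDown l) = 2 := by
    rintro k l (⟨rfl, rfl⟩ | ⟨rfl, rfl⟩)
    · refine if_pos ⟨fun n h1 h2 => ?_, ?_, ?_, ?_⟩
      · rw [oneDown_apply, oneDown_apply, if_neg h1, if_neg h2]
      · rw [oneDown_apply, oneDown_apply, if_pos rfl, if_neg hij.symm]; decide
      · rw [oneDown_apply, oneDown_apply, if_neg hij, if_neg hij.symm]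
      · rw [oneDown_apply, oneDown_apply, if_pos rfl, if_pos rfl]
    · refine if_pos ⟨fun n h1 h2 => ?_, ?_, ?_, ?_⟩
      · rw [oneDown_apply, oneDown_apply, if_neg h1, if_neg h2]
      · rw [oneDown_apply, oneDown_apply, if_pos rfl, if_neg hij]; decide
      · rw [oneDown_apply, oneDown_apply, if_pos rfl, if_pos rfl]
      · rw [oneDown_apply, oneDown_apply, if_neg hij, if_neg hij.symm]
  rw [hq, sum_mul_flatVec]
  simp only [sum_mul_flatVec]
  have hmi : i ∈ sitesIn L (Set.Icc lo hi) := mem_sitesIn.2 hi'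
  have hmj : j ∈ sitesIn L (Set.Icc lo hi) := mem_sitesIn.2 hj'
  have hrow : ∀ k l : Site L, l ∈ sitesIn L (Set.Icc lo hi) →
      (k = i ∧ l = j ∨ k = j ∧ l = i) →
      2 ≤ ∑ l ∈ sitesIn L (Set.Icc lo hi), t (oneDown k) (oneDown l) := by
    intro k l hl hkl
    rw [← htd k l hkl]
    exact Finset.single_le_sum (f := fun l => t (oneDown k) (oneDown l))
      (fun l _ => ht0 _ _) hl
  calc (4 : ℝ) = 2 + 2 := by norm_num
    _ ≤ (∑ l ∈ sitesIn L (Set.Icc lo hi), t (oneDown i) (oneDown l)) +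
        ∑ l ∈ sitesIn L (Set.Icc lo hi), t (oneDown j) (oneDown l) :=
      add_le_add (hrow i j hmj (Or.inl ⟨rfl, rfl⟩)) (hrow j i hmi (Or.inr ⟨rfl, rfl⟩))
    _ = ∑ k ∈ ({i, j} : Finset (Site L)), ∑ l ∈ sitesIn L (Set.Icc lo hi),
        t (oneDown k) (oneDown l) := by rw [Finset.sum_pair hij]
    _ ≤ _ := by
      refine Finset.sum_le_sum_of_subset_of_nonneg ?_ fun k _ _ =>
        Finset.sum_nonneg fun l _ => ht0 _ _
      intro k hk
      rcases Finset.mem_insert.1 hk with rfl | hk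
      · exact hmi
      · rw [Finset.mem_singleton.1 hk]; exact hmj

lemma qform_transversal_nonneg {i j : Site L} (hij : i ≠ j) :
    0 ≤ qform (siteOp i pauliX * siteOp j pauliX + siteOp i pauliY * siteOp j pauliY)
      (fun s => ((flatVec L lo hi s : ℝ) : ℂ)) := by
  rw [qform, dotProduct, Complex.re_sum]
  refine Finset.sum_nonneg fun s _ => ?_
  rw [Pi.star_apply, RCLike.star_def, Complex.conj_ofReal, Complex.re_ofReal_mul]
  refine mul_nonneg (flatVec_nonneg s) ?_
  rw [Matrix.mulVec, dotProduct, Complex.re_sum]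
  refine Finset.sum_nonneg fun s' _ => ?_
  rw [transversal_apply hij, ← Complex.ofReal_mul, Complex.ofReal_re]
  refine mul_nonneg ?_ (flatVec_nonneg s')
  split_ifs <;> simp

/-- A single down spin breaks at most the bond on its left and the bond on its right. -/
lemma sum_bonds_walls_le (k : Site L) : (∑ i : Site L, ∑ j : Site L, if j.1 = i.1 + 1 then
    (if oneDown k i = oneDown k j then 0 else 1 : ℝ) else 0) ≤ 2 := by
  have h1 : ∀ i j : Site L, (if j.1 = i.1 + 1 then
      (if oneDown k i = oneDown k j then 0 else 1 : ℝ) else 0) ≤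
      (if i = k then (if j.1 = k.1 + 1 then 1 else 0) else 0) +
        (if j = k then (if i.1 = k.1 - 1 then 1 else 0) else 0) := by
    intro i j
    by_cases hj : j.1 = i.1 + 1
    · rw [if_pos hj, oneDown_apply, oneDown_apply]
      by_cases hik : i = k
      · subst hik
        rw [if_pos rfl, if_pos rfl, if_pos hj]
        have : (0 : ℝ) ≤ if j = i then (if i.1 = i.1 - 1 then 1 else 0) else 0 := by
          split_ifs <;> simp
        split_ifs at * <;> linarith
      · by_cases hjk : j = k
        · subst hjk
          rw [if_neg hik, if_neg hik, if_pos rfl, if_pos rfl,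
            if_pos (show i.1 = j.1 - 1 by omega)]
          split_ifs <;> simp
        · simp [hik, hjk]
    · rw [if_neg hj]
      refine add_nonneg ?_ ?_ <;> split_ifs <;> simp
  have h2 : ∀ c : ℤ, (∑ j : Site L, if j.1 = c then (1 : ℝ) else 0) ≤ 1 := by
    intro c
    rw [← Finset.sum_filter, Finset.sum_const, nsmul_eq_mul, mul_one]
    have : (Finset.univ.filter fun j : Site L => j.1 = c).card ≤ 1 :=
      Finset.card_le_one.2 fun i hi j hj => Subtype.ext
        ((Finset.mem_filter.1 hi).2.trans (Finset.mem_filter.1 hj).2.symm)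
    exact_mod_cast this
  refine (Finset.sum_le_sum fun i _ => Finset.sum_le_sum fun j _ => h1 i j).trans ?_
  simp only [Finset.sum_add_distrib]
  have e1 : (∑ i : Site L, ∑ j : Site L, if i = k then (if j.1 = k.1 + 1 then (1 : ℝ) else 0)
      else 0) = ∑ j : Site L, if j.1 = k.1 + 1 then (1 : ℝ) else 0 := by
    rw [Finset.sum_comm]
    simp
  have e2 : (∑ i : Site L, ∑ j : Site L, if j = k then (if i.1 = k.1 - 1 then (1 : ℝ) else 0)
      else 0) = ∑ i : Site L, if i.1 = k.1 - 1 then (1 : ℝ) else 0 := by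
    simp
  rw [e1, e2]
  linarith [h2 (k.1 + 1), h2 (k.1 - 1)]

/-- The energy of the flat superposition in a region where the field is at most `ε`. -/
lemma qform_ham_flatVec_le (p : Params) {v : ℤ → ℝ} {ε : ℝ} (h1 : -(L : ℤ) < lo) (h2 : lo ≤ hi)
    (h3 : hi < (L : ℤ)) (hv : ∀ k ∈ Set.Icc lo hi, v k ≤ ε) :
    qform (ham p L v) (fun s => ((flatVec L lo hi s : ℝ) : ℂ)) ≤
      (p.Θ₀ + p.lam * ε) * ((hi - lo + 1 : ℤ) : ℝ) + 1 / p.Δ := by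
  have hΔ : 0 < p.Δ := zero_lt_one.trans p.one_lt_Δ
  have hcard := card_sitesIn_Icc (L := L) h1.le h2 h3.le
  set φ : Config L → ℂ := fun s => ((flatVec L lo hi s : ℝ) : ℂ) with hφ
  set ℓ : ℝ := ((hi - lo + 1 : ℤ) : ℝ) with hℓ
  set W : Site L → Site L → ℝ := fun i j =>
    ∑ k ∈ sitesIn L (Set.Icc lo hi), if oneDown k i = oneDown k j then 0 else 1 with hW
  set T : Site L → Site L → ℝ := fun i j =>
    qform (siteOp i pauliX * siteOp j pauliX + siteOp i pauliY * siteOp j pauliY) φ with hT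
  have hnum : ∀ i : Site L, qform (numOp i) φ = if i.1 ∈ Set.Icc lo hi then 1 else 0 := by
    intro i
    rw [qform_numOp, sum_mul_norm_flatVec_sq]
    by_cases hi' : i.1 ∈ Set.Icc lo hi
    · rw [if_pos hi', Finset.sum_eq_single i]
      · rw [oneDown_apply, if_pos rfl, if_pos rfl]
      · intro k _ hk
        rw [oneDown_apply, if_neg hk.symm, if_neg (by decide)]
      · intro h
        exact absurd (mem_sitesIn.2 hi') h
    · rw [if_neg hi']
      refine Finset.sum_eq_zero fun k hk => ?_
      have hik : i ≠ k := by
        rintro rfl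
        exact hi' (mem_sitesIn.1 hk)
      rw [oneDown_apply, if_neg hik, if_neg (by decide)]
  have hbond : ∀ i j : Site L, qform (bondOp p.Δ i j) φ =
      (p.Θ₀ / 2 + 1 / (2 * p.Δ)) * W i j - 1 / (4 * p.Δ) * T i j := by
    intro i j
    have hs : qform (singletOp i j) φ = 2 * W i j - T i j := by
      rw [singletOp, qform_sub, pauliZ_mul_pauliZ_eq, qform_diagonal, sum_mul_norm_flatVec_sq, hW,
        Finset.mul_sum]
      congr 1
      refine Finset.sum_congr rfl fun k _ => ?_
      split_ifs <;> norm_num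
    rw [qform_bondOp, hs, sum_mul_norm_flatVec_sq]
    field_simp
    ring
  have hWs : (∑ i : Site L, ∑ j : Site L, if j.1 = i.1 + 1 then W i j else 0) ≤ 2 * ℓ := by
    have e : (∑ i : Site L, ∑ j : Site L, if j.1 = i.1 + 1 then W i j else 0) =
        ∑ k ∈ sitesIn L (Set.Icc lo hi), ∑ i : Site L, ∑ j : Site L, if j.1 = i.1 + 1 then
          (if oneDown k i = oneDown k j then 0 else 1 : ℝ) else 0 := by
      rw [Finset.sum_comm (s := sitesIn L (Set.Icc lo hi))]
      refine Finset.sum_congr rfl fun i _ => ?_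
      rw [Finset.sum_comm (s := sitesIn L (Set.Icc lo hi))]
      refine Finset.sum_congr rfl fun j _ => ?_
      split_ifs
      · rfl
      · simp
    rw [e, ← hcard]
    refine (Finset.sum_le_sum fun k _ => sum_bonds_walls_le k).trans_eq ?_
    rw [Finset.sum_const, nsmul_eq_mul, mul_comm]
  -- A block of `ℓ` sites contains `ℓ - 1` inner bonds.
  have hTs : 4 * (ℓ - 1) ≤ ∑ i : Site L, ∑ j : Site L, if j.1 = i.1 + 1 then T i j else 0 := by
    have hb := sum_range_le_sum_bonds (L := L) (F := fun i j => if i = j then 0 else T i j)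
      (fun i j => by
        by_cases h : i = j
        · simp [h]
        · simp only [if_neg h]; exact qform_transversal_nonneg h) (a := lo)
      (N := (hi - lo).toNat) (by omega) (by omega) (G := fun _ => 4) (fun n hn i j hi' hj' => by
        have hij : i ≠ j := by rintro rfl; omega
        simp only [if_neg hij]
        exact four_le_qform_transversal hij ⟨by omega, by omega⟩ ⟨by omega, by omega⟩)
    rw [Finset.sum_const, Finset.card_range, nsmul_eq_mul] at hb
    have hN : (((hi - lo).toNat : ℕ) : ℝ) = ℓ - 1 := by
      have : (((hi - lo).toNat : ℕ) : ℤ) = (hi - lo + 1) - 1 := by omega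
      rw [hℓ]
      exact_mod_cast this
    rw [hN, mul_comm] at hb
    refine hb.trans_eq (Finset.sum_congr rfl fun i _ => Finset.sum_congr rfl fun j _ => ?_)
    split_ifs with h4 h5
    · rw [h5] at h4; omega
    · rfl
    · rfl
  have hpot : ∑ i : Site L, v i.1 * qform (numOp i) φ ≤ ε * ℓ := by
    have e : ∑ i : Site L, v i.1 * qform (numOp i) φ =
        ∑ k ∈ sitesIn L (Set.Icc lo hi), v k.1 := by
      simp only [hnum, mul_ite, mul_one, mul_zero]
      rw [← Finset.sum_filter]
      congr 1
      ext i
      simp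
    rw [e, ← hcard]
    refine (Finset.sum_le_sum fun k hk => hv k.1 (mem_sitesIn.1 hk)).trans_eq ?_
    rw [Finset.sum_const, nsmul_eq_mul, mul_comm]
  have hends : qform (numOp (leftEnd L)) φ + qform (numOp (rightEnd L)) φ = 0 := by
    rw [hnum, hnum, if_neg, if_neg, add_zero]
    · intro h; have := h.2; simp only [rightEnd] at this; omega
    · intro h; have := h.1; simp only [leftEnd] at this; omega
  have hsplit : (∑ i : Site L, ∑ j : Site L, if j.1 = i.1 + 1 then qform (bondOp p.Δ i j) φ
      else 0) = (p.Θ₀ / 2 + 1 / (2 * p.Δ)) *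
        (∑ i : Site L, ∑ j : Site L, if j.1 = i.1 + 1 then W i j else 0) -
        1 / (4 * p.Δ) * ∑ i : Site L, ∑ j : Site L, if j.1 = i.1 + 1 then T i j else 0 := by
    simp only [Finset.mul_sum, ← Finset.sum_sub_distrib]
    refine Finset.sum_congr rfl fun i _ => Finset.sum_congr rfl fun j _ => ?_
    split_ifs
    · exact hbond i j
    · ring
  rw [qform_ham, hsplit, hends, mul_zero, add_zero]
  have hΘ := p.Θ₀_pos
  have b1 := mul_le_mul_of_nonneg_left hWs (by positivity : 0 ≤ p.Θ₀ / 2 + 1 / (2 * p.Δ))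
  have b2 := mul_le_mul_of_nonneg_left hTs (by positivity : 0 ≤ 1 / (4 * p.Δ))
  have b3 := mul_le_mul_of_nonneg_left hpot p.lam_pos.le
  -- The walls cost `ℓ` in total, because `Θ₀ + 1/Δ = 1`, and hopping gains `(ℓ - 1)/Δ`. The energy
  -- per unit of squared norm thus exceeds `Θ₀` only by the kinetic cost `1/(Δ ℓ)` and by the field.
  have e : (p.Θ₀ / 2 + 1 / (2 * p.Δ)) * (2 * ℓ) - 1 / (4 * p.Δ) * (4 * (ℓ - 1)) =
      p.Θ₀ * ℓ + 1 / p.Δ := by field_simp; ring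
  calc _ ≤ (p.Θ₀ / 2 + 1 / (2 * p.Δ)) * (2 * ℓ) - 1 / (4 * p.Δ) * (4 * (ℓ - 1)) +
        p.lam * (ε * ℓ) := by linarith
    _ = _ := by rw [e]; ring

/-- The flat superposition has a substantial component in the energy window. -/
lemma half_le_qform_specProj (p : Params) {v : ℤ → ℝ} {Θ₁ : ℝ} (hv0 : ∀ i, 0 ≤ v i)
    (hΘ : p.Θ₀ < Θ₁) (h1 : -(L : ℤ) < lo) (h2 : lo ≤ hi) (h3 : hi < (L : ℤ))
    (hv : ∀ k ∈ Set.Icc lo hi, v k ≤ (Θ₁ - p.Θ₀) / (4 * p.lam))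
    (hℓ : 4 / ((Θ₁ - p.Θ₀) * p.Δ) ≤ ((hi - lo + 1 : ℤ) : ℝ)) :
    ((hi - lo + 1 : ℤ) : ℝ) / 2 ≤ qform (specProj p L v (Set.Icc p.Θ₀ Θ₁))
      (fun s => ((flatVec L lo hi s : ℝ) : ℂ)) := by
  have hΔ : 0 < p.Δ := zero_lt_one.trans p.one_lt_Δ
  have hlam := p.lam_pos
  have hE := qform_ham_flatVec_le p h1 h2 h3 hv
  have hcard := card_sitesIn_Icc (L := L) h1.le h2 h3.le
  set φ : Config L → ℂ := fun s => ((flatVec L lo hi s : ℝ) : ℂ) with hφ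
  set ℓ : ℝ := ((hi - lo + 1 : ℤ) : ℝ)
  set w := Θ₁ - p.Θ₀ with hw
  have hw0 : 0 < w := sub_pos.2 hΘ
  have hO : qform (1 - vacProj L) φ = ℓ := by
    rw [qform_one_sub_vacProj, sum_mul_norm_flatVec_sq, ← hcard]
    have : ∀ k ∈ sitesIn L (Set.Icc lo hi), (if oneDown k = 0 then (0 : ℝ) else 1) = 1 := by
      intro k _
      rw [if_neg]
      intro h
      have := congrFun h k
      rw [oneDown_apply, if_pos rfl, Pi.zero_apply] at this
      exact absurd this (by decide)
    rw [Finset.sum_congr rfl this]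
    simp
  -- A Chebyshev bound in operator form: `g ≥ 0` on the spectrum says that the weight above `Θ₁` is
  -- at most `w⁻¹` times the excess of the energy over `Θ₀`.
  set g : ℝ → ℝ := fun x => (Set.Icc p.Θ₀ Θ₁).indicator 1 x - (1 - ({0} : Set ℝ).indicator 1 x) +
    w⁻¹ * (x - p.Θ₀ * (1 - ({0} : Set ℝ).indicator 1 x)) with hg
  have hgap := hasGap_ham (L := L) p hv0
  have hpos : ∀ k, 0 ≤ g ((ham_isHermitian p L v).eigenvalues k) := by
    intro k
    have hΘ₀ := p.Θ₀_pos
    rcases hgap.eigenvalues_eq_zero_or_le (ham_isHermitian p L v) k with h | h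
    · simp only [hg]
      rw [h, Set.indicator_of_notMem (zero_notMem_droplet p Θ₁), Set.indicator_of_mem (by simp)]
      simp
    · have h0 : (ham_isHermitian p L v).eigenvalues k ≠ 0 := by linarith
      simp only [hg]
      rw [Set.indicator_of_notMem (s := {0}) (by simpa using h0), sub_zero, mul_one]
      by_cases h5 : (ham_isHermitian p L v).eigenvalues k ≤ Θ₁
      · rw [Set.indicator_of_mem (s := Set.Icc p.Θ₀ Θ₁) ⟨h, h5⟩]
        have := mul_nonneg (inv_nonneg.2 hw0.le) (sub_nonneg.2 h)
        simp only [Pi.one_apply]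
        linarith
      · rw [Set.indicator_of_notMem fun h6 => h5 h6.2]
        have : 1 ≤ w⁻¹ * ((ham_isHermitian p L v).eigenvalues k - p.Θ₀) := by
          rw [← inv_mul_cancel₀ hw0.ne']
          exact mul_le_mul_of_nonneg_left (by linarith) (inv_nonneg.2 hw0.le)
        linarith
  have hfn : fnCalc (ham_isHermitian p L v) (fun x => (g x : ℂ)) =
      specProj p L v (Set.Icc p.Θ₀ Θ₁) - (1 - vacProj L) +
        ((w⁻¹ : ℝ) : ℂ) • (ham p L v - ((p.Θ₀ : ℝ) : ℂ) • (1 - vacProj L)) := by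
    have hsub : ∀ f h : ℝ → ℂ, fnCalc (ham_isHermitian p L v) f - fnCalc (ham_isHermitian p L v) h =
        fnCalc (ham_isHermitian p L v) (fun x => f x - h x) := by
      intro f h
      rw [sub_eq_add_neg, ← neg_one_smul ℂ (fnCalc _ h), fnCalc_smul, fnCalc_add]
      congr 1
      ext x
      ring
    conv_rhs => rw [← specProj_singleton_zero p hv0, ← fnCalc_id (ham_isHermitian p L v),
      ← fnCalc_one (ham_isHermitian p L v)]
    rw [specProj, specProj, hamFn, hamFn, hsub, hsub, fnCalc_smul, hsub, fnCalc_smul, fnCalc_add]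
    congr 1
    ext x
    simp only [hg]
    push_cast
    congr 1
    · congr 1
      · by_cases hx : x ∈ Set.Icc p.Θ₀ Θ₁ <;> simp [hx]
      · by_cases hx : x = 0 <;> simp [hx]
    · by_cases hx : x = 0 <;> simp [hx]
  have h0 : 0 ≤ qform (fnCalc (ham_isHermitian p L v) (fun x => (g x : ℂ))) φ :=
    re_star_dotProduct_fnCalc_nonneg (ham_isHermitian p L v) hpos φ
  rw [hfn, qform_add, qform_sub _ (1 - vacProj L), qform_smul, qform_sub _ (_ • _), qform_smul,
    hO] at h0
  have h4 : w⁻¹ * (qform (ham p L v) φ - p.Θ₀ * ℓ) ≤ ℓ / 2 := by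
    rw [inv_mul_le_iff₀ hw0]
    -- The field and the kinetic cost each use at most `w/4` of the excess energy, so at most half
    -- of the weight leaves the window.
    have h5 : p.lam * (w / (4 * p.lam)) = w / 4 := by field_simp
    have h6 : 1 / p.Δ ≤ w / 4 * ℓ := by
      rw [div_le_iff₀ (by positivity)] at hℓ
      rw [div_le_iff₀ hΔ]
      linarith
    rw [add_mul, h5] at hE
    linarith
  linarith

end Droplet

/-! ### The counterterms do not vanish -/

section Counterterm

variable {L : ℕ} {lo hi lo' hi' : ℤ}

lemma vacProj_mul_mul_vacProj (M : Op L) : vacProj L * M * vacProj L = M 0 0 • vacProj L := by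
  rw [vacProj_eq_diagonal]
  ext s s'
  rw [Matrix.mul_diagonal, Matrix.diagonal_mul, Matrix.smul_apply, Matrix.diagonal_apply]
  by_cases hs : s = 0
  · by_cases hs' : s' = 0
    · simp [hs, hs']
    · simp [hs, hs', Ne.symm hs']
  · by_cases h : s = s'
    · simp [hs, ← h]
    · simp [hs, h]

lemma trace_vacProj : (vacProj L).trace = 1 := by
  rw [vacProj_eq_diagonal, Matrix.trace_diagonal]
  simp

lemma re_conj_sumOp_apply_zero (R : Op L) :
    ((sumOp L lo hi flipDown)ᴴ * R * sumOp L lo hi flipDown) 0 0 =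
      star (fun s => ((flatVec L lo hi s : ℝ) : ℂ)) ⬝ᵥ
        (R *ᵥ fun s => ((flatVec L lo hi s : ℝ) : ℂ)) := by
  rw [Matrix.mul_assoc, Matrix.mul_apply, dotProduct]
  refine Finset.sum_congr rfl fun s _ => ?_
  rw [Matrix.conjTranspose_apply, sumOp_flipDown_apply_zero, Pi.star_apply, Matrix.mul_apply,
    Matrix.mulVec, dotProduct]
  simp only [sumOp_flipDown_apply_zero]

/-- Duality with the test operator `y O xᴴ`. Since `O` has rank one, the trace factorizes into the
two expectations of `R` in the flat vectors `x` and `y` create from the vacuum. -/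
lemma qform_mul_qform_le_traceNorm {R : Op L} {x y : Op L} (hx : x = sumOp L lo hi flipDown)
    (hy : y = sumOp L lo' hi' flipDown)
    (h1 : 0 ≤ qform R (fun s => ((flatVec L lo hi s : ℝ) : ℂ))) :
    qform R (fun s => ((flatVec L lo hi s : ℝ) : ℂ)) *
      qform R (fun s => ((flatVec L lo' hi' s : ℝ) : ℂ)) ≤
      ‖x‖ * ‖y‖ * traceNorm (R * (x * vacProj L * yᴴ) * R) := by
  have hOO : vacProj L * vacProj L = vacProj L := one_sub_downProj_mul_of_subset subset_rfl
  have hO : ‖vacProj L‖ ≤ 1 := norm_one_sub_downProj_le _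
  have e1 := vacProj_mul_mul_vacProj (xᴴ * R * x)
  have e2 := vacProj_mul_mul_vacProj (yᴴ * R * y)
  rw [hx, re_conj_sumOp_apply_zero, ← hx] at e1
  rw [hy, re_conj_sumOp_apply_zero, ← hy] at e2
  set a := star (fun s => ((flatVec L lo hi s : ℝ) : ℂ)) ⬝ᵥ
    (R *ᵥ fun s => ((flatVec L lo hi s : ℝ) : ℂ)) with ha
  set b := star (fun s => ((flatVec L lo' hi' s : ℝ) : ℂ)) ⬝ᵥ
    (R *ᵥ fun s => ((flatVec L lo' hi' s : ℝ) : ℂ)) with hb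
  set O := vacProj L with hOdef
  have htr : ((y * O * xᴴ) * (R * (x * O * yᴴ) * R)).trace = a * b := by
    calc ((y * O * xᴴ) * (R * (x * O * yᴴ) * R)).trace
        = (y * (O * (xᴴ * R * x) * (O * (yᴴ * R)))).trace := by simp only [Matrix.mul_assoc]
      _ = (O * (xᴴ * R * x) * (O * (yᴴ * R)) * y).trace := Matrix.trace_mul_comm _ _
      _ = (O * O * (xᴴ * R * x) * (O * O * (yᴴ * R * y))).trace := by
          rw [hOO]; simp only [Matrix.mul_assoc]
      _ = (O * (O * (xᴴ * R * x) * O * (O * (yᴴ * R * y)))).trace := by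
          simp only [Matrix.mul_assoc]
      _ = (O * (xᴴ * R * x) * O * (O * (yᴴ * R * y)) * O).trace := Matrix.trace_mul_comm _ _
      _ = ((O * (xᴴ * R * x) * O) * (O * (yᴴ * R * y) * O)).trace := by
          simp only [Matrix.mul_assoc]
      _ = a * b := by
          rw [e1, e2, Matrix.smul_mul, Matrix.mul_smul, hOO, Matrix.trace_smul, Matrix.trace_smul,
            trace_vacProj]
          simp
  have h2 := norm_trace_mul_le (y * O * xᴴ) (R * (x * O * yᴴ) * R)
  rw [htr, norm_mul] at h2
  have h3 : ‖y * O * xᴴ‖ ≤ ‖x‖ * ‖y‖ := by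
    refine (norm_mul_le _ _).trans ?_
    rw [Matrix.l2_opNorm_conjTranspose, mul_comm]
    exact mul_le_mul_of_nonneg_left (norm_mul_le_of_le_one_right hO) (norm_nonneg _)
  calc qform R (fun s => ((flatVec L lo hi s : ℝ) : ℂ)) *
        qform R (fun s => ((flatVec L lo' hi' s : ℝ) : ℂ))
      ≤ ‖a‖ * ‖b‖ := by
        refine (mul_le_mul_of_nonneg_left (Complex.re_le_norm b) h1).trans ?_
        exact mul_le_mul_of_nonneg_right (Complex.re_le_norm a) (norm_nonneg _)
    _ ≤ _ := h2.trans (mul_le_mul_of_nonneg_right h3 (traceNorm_nonneg _))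

end Counterterm

end XXZ

namespace XXZ

/-! ### Necessity of the counterterms -/

section Converse

open scoped Matrix.Norms.L2Operator

variable {L : ℕ} {lo hi lo' hi' : ℤ} {p : Params} {Θ₁ C m : ℝ} {Ω : Type*} [MeasurableSpace Ω]
  {P : Measure Ω} {ω : ℤ → Ω → ℝ}

lemma norm_sumObs_flipDown_le (h1 : -(L : ℤ) ≤ lo) (h2 : lo ≤ hi) (h3 : hi ≤ (L : ℤ)) :
    (sumObs h1 h2 h3 flipDown).norm ≤ ((hi - lo + 1 : ℤ) : ℝ) := by
  rw [LocalObs.norm, opNorm_eq_norm, sumObs_op]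
  exact norm_sumOp_flipDown_le h1 h2 h3

lemma norm_sumObs_flipDown_conjTranspose_le (h1 : -(L : ℤ) ≤ lo) (h2 : lo ≤ hi)
    (h3 : hi ≤ (L : ℤ)) : (sumObs h1 h2 h3 flipDownᴴ).norm ≤ ((hi - lo + 1 : ℤ) : ℝ) := by
  rw [LocalObs.norm, opNorm_eq_norm, sumObs_op, ← sumOp_conjTranspose,
    Matrix.l2_opNorm_conjTranspose]
  exact norm_sumOp_flipDown_le h1 h2 h3

lemma dist_sumObs (h1 : -(L : ℤ) ≤ lo) (h2 : lo ≤ hi) (h3 : hi ≤ (L : ℤ)) (h1' : -(L : ℤ) ≤ lo')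
    (h2' : lo' ≤ hi') (h3' : hi' ≤ (L : ℤ)) (a b : Matrix (Fin 2) (Fin 2) ℂ) {D : ℕ}
    (hD : lo' = hi + D) : (sumObs h1 h2 h3 a).dist (sumObs h1' h2' h3' b) = D := by
  refine le_antisymm ?_ (le_csInf ⟨_, lo, ⟨le_rfl, h2⟩, lo', ⟨le_rfl, h2'⟩, rfl⟩ ?_)
  · have := (sumObs h1 h2 h3 a).dist_le (sumObs h1' h2' h3' b) (i := hi) (j := lo')
      ⟨h2, le_rfl⟩ ⟨le_rfl, h2'⟩
    omega
  · rintro d ⟨i, hi4, j, hj5, rfl⟩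
    have h4 : i ≤ _ := hi4.2
    have h5 : _ ≤ j := hj5.1
    change i ≤ hi at h4
    change lo' ≤ j at h5
    omega

/-- In a region of small field the counterterm of two collective spin flips is bounded below. -/
lemma quarter_le_traceNorm_counterterm {v : ℤ → ℝ} (hv0 : ∀ i, 0 ≤ v i) (hΘ : p.Θ₀ < Θ₁)
    (h1 : -(L : ℤ) < lo) (h2 : lo ≤ hi) (h3 : hi < (L : ℤ)) (h1' : -(L : ℤ) < lo')
    (h2' : lo' ≤ hi') (h3' : hi' < (L : ℤ)) (hlen : hi' - lo' = hi - lo)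
    (hv : ∀ k ∈ Set.Icc lo hi ∪ Set.Icc lo' hi', v k ≤ (Θ₁ - p.Θ₀) / (4 * p.lam))
    (hℓ : 4 / ((Θ₁ - p.Θ₀) * p.Δ) ≤ ((hi - lo + 1 : ℤ) : ℝ)) :
    1 / 4 ≤ traceNorm (window p L v (Set.Icc p.Θ₀ Θ₁)
      (sumOp L lo hi flipDown * specProj p L v {0} * sumOp L lo' hi' flipDownᴴ -
        sumOp L lo' hi' flipDownᴴ * specProj p L v {0} * sumOp L lo hi flipDown)) := by
  have b1 := half_le_qform_specProj p hv0 hΘ h1 h2 h3 (fun k hk => hv k (Or.inl hk)) hℓ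
  have b2 := half_le_qform_specProj p hv0 hΘ h1' h2' h3' (fun k hk => hv k (Or.inr hk))
    (by rwa [hlen])
  have n1 := norm_sumOp_flipDown_le h1.le h2 h3.le
  have n2 := norm_sumOp_flipDown_le h1'.le h2' h3'.le
  rw [hlen] at b2 n2
  have hℓ1 : (1 : ℝ) ≤ ((hi - lo + 1 : ℤ) : ℝ) := by
    exact_mod_cast (show (1 : ℤ) ≤ hi - lo + 1 by omega)
  rw [window, specProj_singleton_zero p hv0, Matrix.mul_assoc (sumOp L lo' hi' flipDownᴴ),
    vacProj_mul_sumOp_flipDown, Matrix.mul_zero, sub_zero, ← sumOp_conjTranspose]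
  have key := qform_mul_qform_le_traceNorm (R := specProj p L v (Set.Icc p.Θ₀ Θ₁))
    (rfl : sumOp L lo hi flipDown = _) (rfl : sumOp L lo' hi' flipDown = _) (by linarith)
  set T := traceNorm (specProj p L v (Set.Icc p.Θ₀ Θ₁) *
    (sumOp L lo hi flipDown * vacProj L * (sumOp L lo' hi' flipDown)ᴴ) *
      specProj p L v (Set.Icc p.Θ₀ Θ₁))
  have hT : 0 ≤ T := traceNorm_nonneg _
  generalize ((hi - lo + 1 : ℤ) : ℝ) = ℓ at *
  have k1 : ℓ / 2 * (ℓ / 2) ≤ ℓ * ℓ * T :=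
    -- Both norms are at most `ℓ` and both expectations at least `ℓ/2`, so `ℓ` cancels and leaves
    -- the bound `1/4`, whatever the block length.
    (mul_le_mul b1 b2 (by linarith) (by linarith)).trans (key.trans
      (mul_le_mul_of_nonneg_right (mul_le_mul n1 n2 (norm_nonneg _) (by linarith)) hT))
  have hℓ2 : 0 < ℓ * ℓ := by nlinarith
  refine le_of_mul_le_mul_left (k1.trans' ?_) hℓ2
  linarith

lemma IsDisorder.measure_le_pos [IsProbabilityMeasure P] (hω : IsDisorder P ω) {ε : ℝ}
    (hε : 0 < ε) : 0 < P (ω 0 ⁻¹' Set.Iic ε) := by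
  rw [← Measure.map_apply (hω.measurable 0) measurableSet_Iic]
  exact (Measure.mem_support_iff_forall _).1 (hω.subset_support (by simp)) _ (Iic_mem_nhds hε)

/-- The only use of independence: the probability depends on the number of sites and not on their
positions, hence not on the distance between the blocks. -/
lemma IsDisorder.measure_forall_le (hω : IsDisorder P ω) (hi : iIndepFun ω P) (S : Finset ℤ)
    (ε : ℝ) : P (⋂ k ∈ S, ω k ⁻¹' Set.Iic ε) = P (ω 0 ⁻¹' Set.Iic ε) ^ S.card := by
  rw [hi.measure_inter_preimage_eq_mul S (fun _ _ => measurableSet_Iic), Finset.prod_congr rfl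
    fun k _ => (hω.identDistrib k).measure_preimage_eq measurableSet_Iic, Finset.prod_const]

/-- A lower bound on the expected size of the commutators of collective spin flips. -/
lemma exists_forall_dist_le_lintegral [IsProbabilityMeasure P] (hω : IsDisorder P ω)
    (hDL : PropertyDL p P ω Θ₁ C m) (hi : iIndepFun ω P) :
    ∃ (ℓ : ℝ) (c : ℝ≥0∞), c ≠ 0 ∧ ∀ D : ℕ, 0 < D → ∃ (L : ℕ) (X Y : LocalObs L),
      X.dist Y = D ∧ X.norm ≤ ℓ ∧ Y.norm ≤ ℓ ∧
      c ≤ (∫⁻ w, ⨆ t : ℝ, ENNReal.ofReal (traceNorm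
        ⁅evol p L (fun k => ω k w) t (window p L (fun k => ω k w) (Set.Icc 0 Θ₁) X.op),
          window p L (fun k => ω k w) (Set.Icc 0 Θ₁) Y.op⁆) ∂P) +
        ENNReal.ofReal (8 * ℓ * ℓ * totalConst C m * Real.exp (-(1 / 8) * m * D)) := by
  have hΘ := hDL.lt
  have hw : 0 < Θ₁ - p.Θ₀ := sub_pos.2 hΘ
  have hlam := p.lam_pos
  set ε := (Θ₁ - p.Θ₀) / (4 * p.lam) with hε
  have hε0 : 0 < ε := by positivity
  -- Blocks of `n + 1` sites are long enough for the kinetic cost of the flat superposition; `n`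
  -- depends on the parameters but not on `D`.
  obtain ⟨n, hn⟩ := exists_nat_ge (4 / ((Θ₁ - p.Θ₀) * p.Δ))
  refine ⟨((n + 1 : ℕ) : ℝ), ENNReal.ofReal (1 / 4) * P (ω 0 ⁻¹' Set.Iic ε) ^ (2 * (n + 1)),
    mul_ne_zero (by simp) (pow_ne_zero _ (hω.measure_le_pos hε0).ne'), fun D hD => ?_⟩
  -- The blocks are `[0, n]` and `[n + D, n + D + n]` in a chain long enough that neither touches an
  -- end, so the boundary field is not felt.
  have a1 : -((2 * (n + 1) + D : ℕ) : ℤ) < 0 := by omega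
  have a2 : (0 : ℤ) ≤ n := by omega
  have a3 : (n : ℤ) < ((2 * (n + 1) + D : ℕ) : ℤ) := by omega
  have b1 : -((2 * (n + 1) + D : ℕ) : ℤ) < (n + D : ℤ) := by omega
  have b2 : (n + D : ℤ) ≤ n + D + n := by omega
  have b3 : (n + D + n : ℤ) < ((2 * (n + 1) + D : ℕ) : ℤ) := by omega
  have e1 : (((n : ℤ) - 0 + 1 : ℤ) : ℝ) = ((n + 1 : ℕ) : ℝ) := by push_cast; ring
  have e2 : (((n + D + n : ℤ) - (n + D) + 1 : ℤ) : ℝ) = ((n + 1 : ℕ) : ℝ) := by push_cast; ring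
  have hXn := norm_sumObs_flipDown_le a1.le a2 a3.le
  have hYn := norm_sumObs_flipDown_conjTranspose_le b1.le b2 b3.le
  have hd := dist_sumObs a1.le a2 a3.le b1.le b2 b3.le flipDown flipDownᴴ (D := D) rfl
  have hXop := sumObs_op a1.le a2 a3.le flipDown
  have hYop := sumObs_op b1.le b2 b3.le flipDownᴴ
  rw [e1] at hXn
  rw [e2] at hYn
  generalize sumObs a1.le a2 a3.le flipDown = X at *
  generalize sumObs b1.le b2 b3.le flipDownᴴ = Y at *
  refine ⟨2 * (n + 1) + D, X, Y, hd, hXn, hYn, ?_⟩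
  set S : Finset ℤ := Finset.Icc 0 (n : ℤ) ∪ Finset.Icc (n + D : ℤ) (n + D + n) with hS
  have hcard : S.card = 2 * (n + 1) := by
    rw [hS, Finset.card_union_of_disjoint, Int.card_Icc, Int.card_Icc]
    · omega
    · rw [Finset.disjoint_left]
      intro k hk hk'
      rw [Finset.mem_Icc] at hk hk'
      omega
  set E : Set Ω := ⋂ k ∈ S, ω k ⁻¹' Set.Iic ε with hE
  have hEm : MeasurableSet E :=
    Finset.measurableSet_biInter S fun k _ => hω.measurable k measurableSet_Iic
  set f : Ω → ℝ≥0∞ := fun w => ⨆ t : ℝ, ENNReal.ofReal (traceNorm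
    ⁅evol p _ (fun k => ω k w) t (window p _ (fun k => ω k w) (Set.Icc 0 Θ₁) X.op),
      window p _ (fun k => ω k w) (Set.Icc 0 Θ₁) Y.op⁆) with hf
  have hX0 := X.norm_nonneg
  have hY0 := Y.norm_nonneg
  have hdist : 0 < X.dist Y := by rw [hd]; exact hD
  -- On the event of small fields the counterterm at time zero has trace norm at least `1/4`; by the
  -- triangle inequality either the commutator or the error in the corrected estimate must account
  -- for it.
  have hpt : ∀ w, (∀ i, 0 ≤ ω i w) → E.indicator (fun _ => ENNReal.ofReal (1 / 4)) w ≤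
      f w + ENNReal.ofReal (8 * X.norm * Y.norm) * obsErr p (fun k => ω k w) Θ₁ m X Y := by
    intro w h0
    by_cases hwE : w ∈ E
    · rw [Set.indicator_of_mem hwE]
      have hsmall : ∀ k ∈ Set.Icc (0 : ℤ) n ∪ Set.Icc (n + D : ℤ) (n + D + n), ω k w ≤ ε := by
        intro k hk
        refine Set.mem_iInter₂.1 hwE k ?_
        rw [hS, Finset.mem_union, Finset.mem_Icc, Finset.mem_Icc]
        exact hk
      have q := quarter_le_traceNorm_counterterm (v := fun k => ω k w) h0 hΘ a1 a2 a3 b1 b2 b3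
        (by ring) hsmall (by rw [e1]; push_cast; linarith)
      rw [← hXop, ← hYop] at q
      have r := ofReal_traceNorm_lie_sub_counterterm_le (m := m) h0 hΘ X Y hdist 0
      rw [evol_zero, evol_zero] at r
      have f0 := le_iSup (fun t : ℝ => ENNReal.ofReal (traceNorm
        ⁅evol p _ (fun k => ω k w) t (window p _ (fun k => ω k w) (Set.Icc 0 Θ₁) X.op),
          window p _ (fun k => ω k w) (Set.Icc 0 Θ₁) Y.op⁆)) 0
      rw [evol_zero] at f0
      refine le_trans ?_ (add_le_add f0 r)
      refine le_trans (ENNReal.ofReal_le_ofReal (q.trans ?_)) ENNReal.ofReal_add_le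
      have := fun A B : Op (2 * (n + 1) + D) => traceNorm_sub_le A (A - B)
      simp only [sub_sub_cancel] at this
      exact this _ _
    · rw [Set.indicator_of_notMem hwE]
      exact zero_le
  have hme := measurable_obsErr (p := p) (Θ₁ := Θ₁) (m := m) hω.measurable X Y
  calc ENNReal.ofReal (1 / 4) * P (ω 0 ⁻¹' Set.Iic ε) ^ (2 * (n + 1))
      = ∫⁻ w, E.indicator (fun _ => ENNReal.ofReal (1 / 4)) w ∂P := by
        rw [lintegral_indicator_const hEm, hE, hω.measure_forall_le hi, hcard]
    _ ≤ ∫⁻ w, (f w + ENNReal.ofReal (8 * X.norm * Y.norm) *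
          obsErr p (fun k => ω k w) Θ₁ m X Y) ∂P :=
        lintegral_mono_ae (hω.ae_nonneg.mono hpt)
    _ = (∫⁻ w, f w ∂P) + ENNReal.ofReal (8 * X.norm * Y.norm) *
          ∫⁻ w, obsErr p (fun k => ω k w) Θ₁ m X Y ∂P := by
        rw [lintegral_add_right _ (hme.const_mul _), lintegral_const_mul _ hme]
    _ ≤ _ := by
        refine add_le_add le_rfl ?_
        have hn0 : 0 ≤ 8 * X.norm * Y.norm := mul_nonneg (mul_nonneg (by norm_num) hX0) hY0
        refine (mul_le_mul_right (lintegral_obsErr_le hω.measurable hDL X Y hdist hd.ge) _).trans ?_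
        rw [← ENNReal.ofReal_mul hn0, mul_assoc (8 * _ * _)]
        refine ENNReal.ofReal_le_ofReal (mul_le_mul_of_nonneg_right ?_
          (mul_nonneg (totalConst_nonneg hDL.m_pos) (Real.exp_pos _).le))
        refine mul_le_mul (mul_le_mul_of_nonneg_left hXn (by norm_num)) hYn hY0 (by positivity)

/-- As `D → ∞` the norms stay below the fixed `ℓ`, so the assumed bound and the error of the
corrected estimate both vanish, against the fixed positive lower bound `c`. -/
lemma not_exists_lintegral_lie_le [IsProbabilityMeasure P] (hω : IsDisorder P ω)
    (hDL : PropertyDL p P ω Θ₁ C m) (hi : iIndepFun ω P) {Υ : ℕ → ℝ} (hΥ : ∀ r, 0 ≤ Υ r)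
    (hΥ0 : Tendsto Υ atTop (𝓝 0)) :
    ¬ ∃ K : ℝ, ∀ (L : ℕ) (X Y : LocalObs L), 0 < X.dist Y →
      ∫⁻ w, ⨆ t : ℝ, ENNReal.ofReal (traceNorm
        ⁅evol p L (fun k => ω k w) t (window p L (fun k => ω k w) (Set.Icc 0 Θ₁) X.op),
          window p L (fun k => ω k w) (Set.Icc 0 Θ₁) Y.op⁆) ∂P
        ≤ ENNReal.ofReal (K * X.norm * Y.norm * Υ (X.dist Y)) := by
  rintro ⟨K, hK⟩
  obtain ⟨ℓ, c, hc, h⟩ := exists_forall_dist_le_lintegral hω hDL hi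
  have hb : ∀ D : ℕ, 0 < D → c ≤ ENNReal.ofReal (|K| * ℓ * ℓ * Υ D) +
      ENNReal.ofReal (8 * ℓ * ℓ * totalConst C m * Real.exp (-(1 / 8) * m * D)) := by
    intro D hD
    obtain ⟨L, X, Y, hd, hX, hY, hle⟩ := h D hD
    refine hle.trans (add_le_add ((hK L X Y (hd ▸ hD)).trans (ENNReal.ofReal_le_ofReal ?_)) le_rfl)
    rw [hd]
    refine mul_le_mul_of_nonneg_right ?_ (hΥ D)
    have hX0 := X.norm_nonneg
    have hY0 := Y.norm_nonneg
    have hK0 := abs_nonneg K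
    calc K * X.norm * Y.norm ≤ |K| * X.norm * Y.norm :=
          mul_le_mul_of_nonneg_right (mul_le_mul_of_nonneg_right (le_abs_self K) hX0) hY0
      _ ≤ |K| * ℓ * ℓ := mul_le_mul (mul_le_mul_of_nonneg_left hX hK0) hY hY0
          (mul_nonneg hK0 (hX0.trans hX))
  have hexp : Tendsto (fun D : ℕ => Real.exp (-(1 / 8) * m * D)) atTop (𝓝 0) := by
    refine Real.tendsto_exp_atBot.comp ?_
    exact tendsto_natCast_atTop_atTop.const_mul_atTop_of_neg (by linarith [hDL.m_pos])
  have t1 := ENNReal.tendsto_ofReal (hΥ0.const_mul (|K| * ℓ * ℓ))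
  have t2 := ENNReal.tendsto_ofReal (hexp.const_mul (8 * ℓ * ℓ * totalConst C m))
  have t3 := t1.add t2
  rw [mul_zero, mul_zero, ENNReal.ofReal_zero, add_zero] at t3
  refine hc (le_antisymm (ge_of_tendsto t3 ?_) zero_le)
  filter_upwards [eventually_gt_atTop 0] with D hD using hb D hD

end Converse

end XXZ

/-! ### The main theorem -/

theorem theorem2p2 {Ω : Type*} [MeasurableSpace Ω] (P : Measure Ω) [IsProbabilityMeasure P]
    (ω : ℤ → Ω → ℝ) (hω : XXZ.IsDisorder P ω) (p : XXZ.Params)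
    (Θ₁ C₀ m : ℝ) (hDL : XXZ.PropertyDL p P ω Θ₁ C₀ m) :
    -- the three bounds, with a constant uniform in the size of the chain and the observables
    (∃ C : ℝ, ∀ L : ℕ,
      (∀ X Y : XXZ.LocalObs L, 0 < X.dist Y →
        ∫⁻ w, ⨆ t : ℝ, ENNReal.ofReal (XXZ.traceNorm
            ⁅XXZ.evol p L (fun k => ω k w) t
                (XXZ.window p L (fun k => ω k w) (Set.Icc p.Θ₀ Θ₁) X.op),
              XXZ.window p L (fun k => ω k w) (Set.Icc p.Θ₀ Θ₁) Y.op⁆) ∂P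
          ≤ ENNReal.ofReal (C * X.norm * Y.norm * Real.exp (-(1 / 8) * m * (X.dist Y : ℝ)))) ∧
      (∀ X Y : XXZ.LocalObs L, 0 < X.dist Y →
        ∫⁻ w, ⨆ t : ℝ, ENNReal.ofReal (XXZ.traceNorm
            (⁅XXZ.evol p L (fun k => ω k w) t
                (XXZ.window p L (fun k => ω k w) (Set.Icc 0 Θ₁) X.op),
              XXZ.window p L (fun k => ω k w) (Set.Icc 0 Θ₁) Y.op⁆
            - XXZ.window p L (fun k => ω k w) (Set.Icc p.Θ₀ Θ₁)
                (XXZ.evol p L (fun k => ω k w) t X.op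
                    * XXZ.specProj p L (fun k => ω k w) {0} * Y.op
                  - Y.op * XXZ.specProj p L (fun k => ω k w) {0}
                    * XXZ.evol p L (fun k => ω k w) t X.op))) ∂P
          ≤ ENNReal.ofReal (C * X.norm * Y.norm * Real.exp (-(1 / 8) * m * (X.dist Y : ℝ)))) ∧
      (∀ X Y Z : XXZ.LocalObs L, 0 < X.dist Y → 0 < X.dist Z → 0 < Y.dist Z →
        ∫⁻ w, ⨆ (t : ℝ) (s : ℝ), ENNReal.ofReal (XXZ.traceNorm
            ⁅⁅XXZ.evol p L (fun k => ω k w) t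
                  (XXZ.window p L (fun k => ω k w) (Set.Icc 0 Θ₁) X.op),
                XXZ.evol p L (fun k => ω k w) s
                  (XXZ.window p L (fun k => ω k w) (Set.Icc 0 Θ₁) Y.op)⁆,
              XXZ.window p L (fun k => ω k w) (Set.Icc 0 Θ₁) Z.op⁆) ∂P
          ≤ ENNReal.ofReal (C * X.norm * Y.norm * Z.norm * Real.exp (-(1 / 8) * m *
              ((min (X.dist Y) (min (X.dist Z) (Y.dist Z)) : ℕ) : ℝ))))) ∧
    -- for independent disorder, the second bound fails without the counterterms, even with an
    -- arbitrary rate that tends to zero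
    (iIndepFun ω P →
      ∀ Υ : ℕ → ℝ, (∀ r, 0 ≤ Υ r) → Tendsto Υ atTop (𝓝 0) →
        ¬ ∃ C : ℝ, ∀ (L : ℕ) (X Y : XXZ.LocalObs L), 0 < X.dist Y →
          ∫⁻ w, ⨆ t : ℝ, ENNReal.ofReal (XXZ.traceNorm
              ⁅XXZ.evol p L (fun k => ω k w) t
                  (XXZ.window p L (fun k => ω k w) (Set.Icc 0 Θ₁) X.op),
                XXZ.window p L (fun k => ω k w) (Set.Icc 0 Θ₁) Y.op⁆) ∂P
            ≤ ENNReal.ofReal (C * X.norm * Y.norm * Υ (X.dist Y))) := by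
  refine ⟨⟨96 * XXZ.totalConst C₀ m, fun L => ⟨fun X Y h => ?_, fun X Y h => ?_,
    fun X Y Z hXY hXZ hYZ => ?_⟩⟩, fun hi Υ hΥ hΥ0 =>
    XXZ.not_exists_lintegral_lie_le hω hDL hi hΥ hΥ0⟩
  · exact XXZ.lintegral_le_of_ae_le_mul_obsErr hω hDL X Y h fun w hw =>
      iSup_le fun t => XXZ.ofReal_traceNorm_lie_le hw hDL.lt X Y h t
  · exact XXZ.lintegral_le_of_ae_le_mul_obsErr hω hDL X Y h fun w hw =>
      iSup_le fun t => XXZ.ofReal_traceNorm_lie_sub_counterterm_le hw hDL.lt X Y h t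
  · exact XXZ.lintegral_le_of_ae_le_mul_obsErr₃ hω hDL X Y Z hXY hXZ hYZ fun w hw =>
      iSup₂_le fun t s => XXZ.ofReal_traceNorm_lie_lie_le hw hDL.lt X Y Z hXY hXZ hYZ t s
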